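/- Let $p > 5$ be a prime and let $E$ be a supersingular elliptic curve defined over $\mathbb{F}_p$, i.e. $E(\overline{\mathbb{F}}_p)$ has no nontrivial $p^k$-torsion for any $k \ge 1$. Let $\operatorname{End}_{\mathbb{F}_p}(E)$ denote the ring of endomorphisms of $E$ defined over $\mathbb{F}_p$, and let $E[2]$ be the group of all points $P \in E(\overline{\mathbb{F}}_p)$ with $2P = 0$. Then $$\operatorname{End}_{\mathbb{F}_p}(E) \cong \mathbb{Z}\left[\tfrac{1+\sqrt{-p}}{2}\right] \text{ as rings} \quad\text{if and only if}\quad E[2] \subset E(\mathbb{F}_p).$$ -/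

import Mathlib

open WeierstrassCurve

namespace WeierstrassCurve

/-- The standard homogeneous coordinates of a point of a Weierstrass curve in the projective plane:
`[x : y : 1]` for an affine point `(x, y)`, and `[0 : 1 : 0]` for the point at infinity. -/
def homCoords {F : Type*} [Field F] {V : WeierstrassCurve F} : V.toAffine.Point → Fin 3 → F
  | .zero => ![0, 1, 0]
  | .some x y _ => ![x, y, 1]

/-- Let `W` be a Weierstrass curve over `K` and let `L` be an algebraically closed field over `K`.
A map `φ : W(L) → W(L)` is *given by a rational map over `K`* if there are homogeneous polynomials
`F₀, F₁, F₂` of the same degree with coefficients in `K` such that, for all but finitely many points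
`Q` of `W(L)`, the triple `(F₀(Q), F₁(Q), F₂(Q))` is nonzero and `φ(Q)` is the point
`[F₀(Q) : F₁(Q) : F₂(Q)]` of the projective plane. -/
def IsRationalOver {K : Type*} [Field K] (L : Type*) [Field L] [Algebra K L]
    (W : WeierstrassCurve K) (φ : (W⁄L).toAffine.Point → (W⁄L).toAffine.Point) : Prop :=
  ∃ (n : ℕ) (F : Fin 3 → MvPolynomial (Fin 3) K), (∀ i, (F i).IsHomogeneous n) ∧
    {Q : (W⁄L).toAffine.Point | ¬ ∃ c : L, c ≠ 0 ∧
      (fun i ↦ MvPolynomial.aeval (homCoords Q) (F i)) = c • homCoords (φ Q)}.Finite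

section Aux

variable {L : Type*} [Field L] {V : WeierstrassCurve L}

theorem homCoords_nonsingular (P : V.toAffine.Point) : V.toProjective.Nonsingular (homCoords P) := by
  rcases P with _ | ⟨x, y, h⟩
  · exact Projective.nonsingular_zero
  · exact (Projective.nonsingular_some x y).mpr h

theorem toAffine_homCoords (P : V.toAffine.Point) :
    Projective.Point.toAffine V.toProjective (homCoords P) = P := by
  rcases P with _ | ⟨x, y, h⟩
  · exact Projective.Point.toAffine_zero
  · exact Projective.Point.toAffine_some ((Projective.nonsingular_some x y).mpr h)

theorem exists_smul_homCoords {v : Fin 3 → L} (hv : V.toProjective.Nonsingular v) :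
    ∃ c : L, c ≠ 0 ∧
      v = c • homCoords (Projective.Point.toAffine V.toProjective v) := by
  by_cases hz : v 2 = 0
  · obtain ⟨u, hu⟩ := Projective.equiv_zero_of_Z_eq_zero hv hz
    refine ⟨u, u.ne_zero, ?_⟩
    rw [Projective.Point.toAffine_of_Z_eq_zero hz]
    exact hu.symm
  · obtain ⟨u, hu⟩ := Projective.equiv_some_of_Z_ne_zero hz
    refine ⟨u, u.ne_zero, ?_⟩
    rw [Projective.Point.toAffine_of_Z_ne_zero hv hz]
    exact hu.symm

theorem homCoords_inj {P Q : V.toAffine.Point} {c d : L} (hc : c ≠ 0) (hd : d ≠ 0)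
    (h : c • homCoords P = d • homCoords Q) : P = Q := by
  have := congrArg (Projective.Point.toAffine V.toProjective) h
  rwa [Projective.Point.toAffine_smul _ hc.isUnit, Projective.Point.toAffine_smul _ hd.isUnit,
    toAffine_homCoords, toAffine_homCoords] at this

/-- The vanishing locus of a polynomial on a Weierstrass curve is finite, or it contains all affine
points. -/
theorem vanishing_finite_or (f : MvPolynomial (Fin 3) L) :
    {Q : V.toAffine.Point | MvPolynomial.aeval (homCoords Q) f = 0}.Finite ∨
      ∀ Q : V.toAffine.Point, Q ≠ 0 → MvPolynomial.aeval (homCoords Q) f = 0 := by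
  classical
  let g : Polynomial (Polynomial L) :=
    MvPolynomial.aeval ![Polynomial.C Polynomial.X, Polynomial.X, 1] f
  have hg : ∀ x y : L, g.evalEval x y = MvPolynomial.aeval ![x, y, 1] f := by
    intro x y
    have : ((Polynomial.evalEvalRingHom x y).comp
        (MvPolynomial.aeval (R := L) (S₁ := Polynomial (Polynomial L))
          ![Polynomial.C Polynomial.X, Polynomial.X, 1]).toRingHom) =
        (MvPolynomial.aeval (R := L) ![x, y, 1]).toRingHom := by
      apply MvPolynomial.ringHom_ext
      · intro r
        simp [Polynomial.algebraMap_apply]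
      · intro i
        fin_cases i <;> simp
    exact congrArg (fun h ↦ h f) this
  have hmk : ∀ (a b : Polynomial (Polynomial L)) (x y : L), V.toAffine.Equation x y →
      Affine.CoordinateRing.mk V.toAffine a = Affine.CoordinateRing.mk V.toAffine b →
      a.evalEval x y = b.evalEval x y := by
    intro a b x y h hab
    obtain ⟨k, hk⟩ := AdjoinRoot.mk_eq_mk.mp hab
    have := congrArg (Polynomial.evalEval x y) hk
    rw [Polynomial.evalEval_mul, h, zero_mul, Polynomial.evalEval_sub] at this
    exact sub_eq_zero.mp this
  by_cases h0 : Affine.CoordinateRing.mk V.toAffine g = 0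
  · right
    rintro (_ | ⟨x, y, h⟩) hQ
    · exact absurd rfl hQ
    · change MvPolynomial.aeval ![x, y, 1] f = 0
      rw [← hg, hmk g 0 x y h.1 (by rw [h0, map_zero]), Polynomial.evalEval_zero]
  · left
    obtain ⟨p, q, hpq⟩ := Affine.CoordinateRing.exists_smul_basis_eq
      (Affine.CoordinateRing.mk V.toAffine g)
    have : Module.Finite (Polynomial L) V.toAffine.CoordinateRing :=
      Module.Finite.of_basis (Affine.CoordinateRing.basis V.toAffine)
    have hN : Algebra.norm (Polynomial L) (Affine.CoordinateRing.mk V.toAffine g) ≠ 0 :=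
      Algebra.norm_ne_zero_iff.mpr h0
    set N := Algebra.norm (Polynomial L) (Affine.CoordinateRing.mk V.toAffine g) with hNdef
    have key : ∃ k : Polynomial (Polynomial L), Affine.CoordinateRing.mk V.toAffine
        (Polynomial.C N) = Affine.CoordinateRing.mk V.toAffine (g * k) := by
      refine ⟨Polynomial.C p + Polynomial.C q * (-Polynomial.X -
        Polynomial.C (Polynomial.C V.a₁ * Polynomial.X + Polynomial.C V.a₃)), ?_⟩
      have h := Affine.CoordinateRing.coe_norm_smul_basis (W' := V.toAffine) p q
      rw [hpq] at h
      rw [map_mul, ← hpq, Affine.CoordinateRing.smul, Affine.CoordinateRing.smul, mul_one,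
        ← map_mul, ← map_add, ← map_mul]
      exact h
    obtain ⟨k, hk⟩ := key
    have hroot : ∀ x y, V.toAffine.Equation x y → MvPolynomial.aeval ![x, y, 1] f = 0 →
        N.eval x = 0 := by
      intro x y h hf
      have := hmk _ _ x y h hk
      rwa [Polynomial.evalEval_mul, hg, hf, zero_mul, Polynomial.evalEval_C] at this
    have hfib : ∀ x : L, {Q : V.toAffine.Point | homCoords Q 2 = 1 ∧ homCoords Q 0 = x}.Finite := by
      intro x
      by_cases hx : ∃ Q₀ : V.toAffine.Point, homCoords Q₀ 2 = 1 ∧ homCoords Q₀ 0 = x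
      · obtain ⟨Q₀, h2, h1⟩ := hx
        refine (Set.toFinite ({Q₀, -Q₀} : Set V.toAffine.Point)).subset ?_
        rintro Q ⟨h2', h1'⟩
        rcases Q with _ | ⟨x', y', h'⟩
        · simp [homCoords] at h2'
        rcases Q₀ with _ | ⟨x₀, y₀, h₀⟩
        · simp [homCoords] at h2
        simp only [homCoords, Matrix.cons_val_zero] at h1 h1'
        exact Affine.Point.X_eq_iff.mp (h1'.trans h1.symm)
      · convert! Set.finite_empty
        ext Q
        simp only [Set.mem_ofPred_eq, Set.mem_empty_iff_false, iff_false]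
        exact fun h ↦ hx ⟨Q, h⟩
    refine ((Set.finite_singleton (0 : V.toAffine.Point)).union
      ((Polynomial.finite_setOfPred_isRoot hN).biUnion (fun x _ ↦ hfib x))).subset ?_
    intro Q hQ
    rcases Q with _ | ⟨x, y, h⟩
    · exact Or.inl rfl
    · right
      simp only [Set.mem_iUnion]
      exact ⟨x, hroot x y h.1 hQ, rfl, rfl⟩

theorem eq_of_minors {P Q : V.toAffine.Point}
    (h : ∀ i j, homCoords P i * homCoords Q j = homCoords P j * homCoords Q i) : P = Q := by
  have h02 := h 0 2
  have h12 := h 1 2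
  rcases P with _ | ⟨x, y, hP⟩ <;> rcases Q with _ | ⟨x', y', hQ⟩
  · rfl
  · simp [homCoords] at h12
  · simp [homCoords] at h12
  · simp only [homCoords, Matrix.cons_val_zero, Matrix.cons_val_one, Matrix.cons_val, mul_one,
      one_mul] at h02 h12
    subst h02 h12
    rfl

/-- Two rational maps that agree at infinitely many points agree at all but finitely many. -/
theorem finite_ne_of_infinite_eq {φ ψ : V.toAffine.Point → V.toAffine.Point}
    {F G : Fin 3 → MvPolynomial (Fin 3) L}
    (hF : {Q : V.toAffine.Point | ¬ ∃ c : L, c ≠ 0 ∧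
      (fun i ↦ MvPolynomial.aeval (homCoords Q) (F i)) = c • homCoords (φ Q)}.Finite)
    (hG : {Q : V.toAffine.Point | ¬ ∃ c : L, c ≠ 0 ∧
      (fun i ↦ MvPolynomial.aeval (homCoords Q) (G i)) = c • homCoords (ψ Q)}.Finite)
    (h : {Q | φ Q = ψ Q}.Infinite) : {Q | φ Q ≠ ψ Q}.Finite := by
  have hm : ∀ i j, ∀ Q : V.toAffine.Point, Q ≠ 0 →
      MvPolynomial.aeval (homCoords Q) (F i * G j - F j * G i) = 0 := by
    intro i j
    refine (vanishing_finite_or _).resolve_left fun hfin ↦ h ?_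
    refine ((hF.union hG).union hfin).subset fun Q hQ ↦ ?_
    by_contra hcon
    simp only [Set.mem_union, Set.mem_ofPred_eq, not_or, not_not] at hcon
    obtain ⟨⟨⟨c, hc, hc'⟩, ⟨d, hd, hd'⟩⟩, h3⟩ := hcon
    apply h3
    have e1 := fun i ↦ congrFun hc' i
    have e2 := fun i ↦ congrFun hd' i
    simp only [Pi.smul_apply, smul_eq_mul] at e1 e2
    rw [map_sub, map_mul, map_mul, e1, e1, e2, e2, show φ Q = ψ Q from hQ]
    ring
  refine ((hF.union hG).union (Set.finite_singleton 0)).subset fun Q hQ ↦ ?_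
  by_contra hcon
  simp only [Set.mem_union, Set.mem_ofPred_eq, not_or, not_not, Set.mem_singleton_iff] at hcon
  obtain ⟨⟨⟨c, hc, hc'⟩, ⟨d, hd, hd'⟩⟩, h3⟩ := hcon
  refine hQ (eq_of_minors fun i j ↦ ?_)
  have e1 := fun i ↦ congrFun hc' i
  have e2 := fun i ↦ congrFun hd' i
  simp only [Pi.smul_apply, smul_eq_mul] at e1 e2
  have := hm i j Q h3
  rw [map_sub, map_mul, map_mul, e1, e1, e2, e2] at this
  refine mul_left_cancel₀ (mul_ne_zero hc hd) ?_
  linear_combination this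

theorem addMonoidHom_eq_zero {A : Type*} [AddCommGroup A] [Infinite A] (ψ : A →+ A) (P : A)
    (h : {Q | ψ Q ≠ P}.Finite) : ψ = 0 := by
  ext a
  have hfin : ({Q | ψ Q ≠ P} ∪ (fun b ↦ a + b) ⁻¹' {Q | ψ Q ≠ P}).Finite :=
    h.union (h.preimage (add_right_injective a).injOn)
  obtain ⟨b, hb⟩ := hfin.infinite_compl.nonempty
  simp only [Set.mem_compl_iff, Set.mem_union, Set.mem_preimage, Set.mem_ofPred_eq, not_or,
    not_not] at hb
  have := hb.2
  rw [map_add, hb.1] at this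
  simpa using this

/-- Homogenization: evaluation at points with last coordinate `1` does not see the difference. -/
theorem exists_homogeneous {K : Type*} [Field K] [Algebra K L]
    (f : Fin 3 → MvPolynomial (Fin 3) K) :
    ∃ (n : ℕ) (F : Fin 3 → MvPolynomial (Fin 3) K), (∀ i, (F i).IsHomogeneous n) ∧
      ∀ v : Fin 3 → L, v 2 = 1 → ∀ i, MvPolynomial.aeval v (F i) = MvPolynomial.aeval v (f i) := by
  obtain ⟨n, hn⟩ : ∃ n, ∀ i, (f i).totalDegree ≤ n :=
    ⟨Finset.univ.sup fun i ↦ (f i).totalDegree,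
      fun i ↦ Finset.le_sup (f := fun i ↦ (f i).totalDegree) (Finset.mem_univ i)⟩
  refine ⟨n, fun i ↦ ∑ d ∈ Finset.range (n + 1),
    MvPolynomial.X 2 ^ (n - d) * MvPolynomial.homogeneousComponent d (f i), fun i ↦ ?_, ?_⟩
  · refine MvPolynomial.IsHomogeneous.sum _ _ _ fun d hd ↦ ?_
    have := (MvPolynomial.isHomogeneous_X_pow (R := K) (2 : Fin 3) (n - d)).mul
      (MvPolynomial.homogeneousComponent_isHomogeneous d (f i))
    rwa [Nat.sub_add_cancel (Nat.lt_succ_iff.mp (Finset.mem_range.mp hd))] at this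
  · intro v hv i
    have hsum : f i = ∑ d ∈ Finset.range (n + 1),
        MvPolynomial.homogeneousComponent d (f i) := by
      conv_lhs => rw [← MvPolynomial.sum_homogeneousComponent (f i)]
      refine Finset.sum_subset (Finset.range_mono (Nat.succ_le_succ (hn i))) fun d _ hd ↦ ?_
      exact MvPolynomial.homogeneousComponent_eq_zero _ _ (by simpa using hd)
    conv_rhs => rw [hsum]
    simp [map_sum, hv]

theorem aeval_smul_of_homogeneous {K : Type*} [Field K] [Algebra K L] {n : ℕ}
    {f : MvPolynomial (Fin 3) K} (hf : f.IsHomogeneous n) (c : L) (v : Fin 3 → L) :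
    MvPolynomial.aeval (c • v) f = c ^ n * MvPolynomial.aeval v f := by
  rw [MvPolynomial.aeval_def, MvPolynomial.aeval_def, MvPolynomial.eval₂_eq',
    MvPolynomial.eval₂_eq', Finset.mul_sum]
  refine Finset.sum_congr rfl fun d hd ↦ ?_
  have hdeg : ∑ i, d i = n := by
    rw [← Finsupp.degree_eq_sum]
    by_contra hne
    exact (MvPolynomial.mem_support_iff.mp hd) (hf.coeff_eq_zero hne)
  simp only [Pi.smul_apply, smul_eq_mul, mul_pow, Finset.prod_mul_distrib,
    Finset.prod_pow_eq_pow_sum, hdeg]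
  ring

variable {K : Type*} [Field K] [Algebra K L] {W : WeierstrassCurve K}

theorem IsRationalOver.of_polynomials {φ : (W⁄L).toAffine.Point → (W⁄L).toAffine.Point}
    (f : Fin 3 → MvPolynomial (Fin 3) K)
    (h : {Q : (W⁄L).toAffine.Point | ¬ ∃ c : L, c ≠ 0 ∧
      (fun i ↦ MvPolynomial.aeval (homCoords Q) (f i)) = c • homCoords (φ Q)}.Finite) :
    IsRationalOver L W φ := by
  obtain ⟨n, F, hF, hFf⟩ := exists_homogeneous (L := L) f
  refine ⟨n, F, hF, (h.union (Set.finite_singleton 0)).subset fun Q hQ ↦ ?_⟩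
  by_contra hcon
  simp only [Set.mem_union, Set.mem_ofPred_eq, not_or, not_not, Set.mem_singleton_iff] at hcon
  obtain ⟨⟨c, hc, hc'⟩, h0⟩ := hcon
  refine hQ ⟨c, hc, hc' ▸ funext fun i ↦ hFf _ ?_ i⟩
  rcases Q with _ | ⟨x, y, hxy⟩
  · exact absurd rfl h0
  · rfl

theorem finite_ne_of_infinite_eq' {φ ψ : (W⁄L).toAffine.Point → (W⁄L).toAffine.Point}
    (hφ : IsRationalOver L W φ) (hψ : IsRationalOver L W ψ)
    (h : {Q | φ Q = ψ Q}.Infinite) : {Q | φ Q ≠ ψ Q}.Finite := by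
  obtain ⟨_, F, -, hF⟩ := hφ
  obtain ⟨_, G, -, hG⟩ := hψ
  refine finite_ne_of_infinite_eq (F := fun i ↦ MvPolynomial.map (algebraMap K L) (F i))
    (G := fun i ↦ MvPolynomial.map (algebraMap K L) (G i)) ?_ ?_ h
  · simpa only [MvPolynomial.aeval_map_algebraMap] using hF
  · simpa only [MvPolynomial.aeval_map_algebraMap] using hG

theorem finite_ne_const {φ : (W⁄L).toAffine.Point → (W⁄L).toAffine.Point}
    (hφ : IsRationalOver L W φ) (P : (W⁄L).toAffine.Point)
    (h : {Q | φ Q = P}.Infinite) : {Q | φ Q ≠ P}.Finite := by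
  obtain ⟨_, F, -, hF⟩ := hφ
  refine finite_ne_of_infinite_eq (φ := φ) (ψ := fun _ ↦ P)
    (F := fun i ↦ MvPolynomial.map (algebraMap K L) (F i))
    (G := fun i ↦ MvPolynomial.C (homCoords P i)) ?_ ?_ h
  · simpa only [MvPolynomial.aeval_map_algebraMap] using hF
  · convert! Set.finite_empty
    ext Q
    simp only [Set.mem_ofPred_eq, Set.mem_empty_iff_false, iff_false, not_not]
    exact ⟨1, one_ne_zero, by ext i; simp⟩

theorem isRationalOver_zero : IsRationalOver L W fun _ ↦ 0 := by
  refine IsRationalOver.of_polynomials ![0, 1, 0] ?_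
  convert! Set.finite_empty
  ext Q
  simp only [Set.mem_ofPred_eq, Set.mem_empty_iff_false, iff_false, not_not]
  exact ⟨1, one_ne_zero, by ext i; fin_cases i <;> simp [homCoords]⟩

theorem isRationalOver_id : IsRationalOver L W id := by
  refine IsRationalOver.of_polynomials (fun i ↦ MvPolynomial.X i) ?_
  convert! Set.finite_empty
  ext Q
  simp only [Set.mem_ofPred_eq, Set.mem_empty_iff_false, iff_false, not_not]
  exact ⟨1, one_ne_zero, by ext i; simp⟩

variable [DecidableEq L]

theorem isRationalOver_neg {φ : AddMonoid.End (W⁄L).toAffine.Point} (hφ : IsRationalOver L W φ) :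
    IsRationalOver L W (-φ : AddMonoid.End (W⁄L).toAffine.Point) := by
  obtain ⟨_, F, -, hF⟩ := hφ
  refine IsRationalOver.of_polynomials
    ![F 0, -F 1 - MvPolynomial.C W.a₁ * F 0 - MvPolynomial.C W.a₃ * F 2, F 2] (hF.subset ?_)
  intro Q hQ hcon
  refine hQ ?_
  obtain ⟨c, hc, h⟩ := hcon
  have e := fun i ↦ congrFun h i
  simp only [Pi.smul_apply, smul_eq_mul] at e
  change ∃ c : L, c ≠ 0 ∧ _ = c • homCoords (-(φ Q))
  generalize φ Q = R at e ⊢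
  generalize homCoords Q = v at e ⊢
  rcases R with _ | ⟨x, y, hxy⟩
  · refine ⟨-c, neg_ne_zero.mpr hc, ?_⟩
    have hneg : homCoords (-(Affine.Point.zero : (W⁄L).toAffine.Point)) = ![0, 1, 0] := rfl
    rw [hneg]
    ext i
    fin_cases i <;> simp [e] <;> simp [homCoords]
  · refine ⟨c, hc, ?_⟩
    ext i
    fin_cases i <;> simp [e] <;> simp [homCoords]
    ring

theorem addMonoidEnd_ext {φ ψ : AddMonoid.End (W⁄L).toAffine.Point}
    (hφ : IsRationalOver L W φ) (hψ : IsRationalOver L W ψ)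
    (h : {Q | φ Q = ψ Q}.Infinite) : φ = ψ := by
  have : Infinite (W⁄L).toAffine.Point := Set.infinite_univ_iff.mp (h.mono (Set.subset_univ _))
  have hfin := finite_ne_of_infinite_eq' hφ hψ h
  refine sub_eq_zero.mp (addMonoidHom_eq_zero (φ - ψ : AddMonoid.End _) 0 ?_)
  refine hfin.subset fun Q hQ hQ' ↦ hQ ?_
  change φ Q - ψ Q = 0
  exact sub_eq_zero.mpr hQ'

theorem isRationalOver_add {φ ψ : AddMonoid.End (W⁄L).toAffine.Point}
    (hφ : IsRationalOver L W φ) (hψ : IsRationalOver L W ψ) :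
    IsRationalOver L W (φ + ψ : AddMonoid.End (W⁄L).toAffine.Point) := by
  have hφ' := hφ
  have hψ' := hψ
  obtain ⟨_, F, -, hF⟩ := hφ
  obtain ⟨_, G, -, hG⟩ := hψ
  have hW : ∀ Q : (W⁄L).toAffine.Point, (W.map (MvPolynomial.C (σ := Fin 3))).map
      (MvPolynomial.aeval (R := K) (homCoords Q)).toRingHom = W⁄L := by
    intro Q
    rw [WeierstrassCurve.map_map]
    congr 1
    ext
    simp
  have main : ∀ (Q : (W⁄L).toAffine.Point) (H : Fin 3 → MvPolynomial (Fin 3) K) (c d : L),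
      c ≠ 0 → d ≠ 0 →
      (fun i ↦ MvPolynomial.aeval (homCoords Q) (H i)) =
        (W⁄L).toProjective.add (c • homCoords (φ Q)) (d • homCoords (ψ Q)) →
      ∃ e : L, e ≠ 0 ∧ (fun i ↦ MvPolynomial.aeval (homCoords Q) (H i)) =
        e • homCoords ((φ + ψ) Q) := by
    intro Q H c d hc hd h
    have h1 := (Projective.nonsingular_smul _ hc.isUnit).mpr (homCoords_nonsingular (φ Q))
    have h2 := (Projective.nonsingular_smul _ hd.isUnit).mpr (homCoords_nonsingular (ψ Q))
    obtain ⟨e, he, he'⟩ := exists_smul_homCoords (Projective.nonsingular_add h1 h2)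
    rw [Projective.Point.toAffine_add h1 h2, Projective.Point.toAffine_smul _ hc.isUnit,
      Projective.Point.toAffine_smul _ hd.isUnit, toAffine_homCoords, toAffine_homCoords] at he'
    exact ⟨e, he, h.trans he'⟩
  by_cases hinf : {Q | φ Q = ψ Q}.Infinite
  · obtain rfl := addMonoidEnd_ext hφ' hψ' hinf
    refine IsRationalOver.of_polynomials
      ((W.map (MvPolynomial.C (σ := Fin 3))).toProjective.dblXYZ F) (hF.subset fun Q hQ hcon ↦ ?_)
    obtain ⟨c, hc, h⟩ := hcon
    refine hQ (main Q _ c c hc hc ?_)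
    rw [Projective.add_self]
    have := Projective.map_dblXYZ (W' := (W.map (MvPolynomial.C (σ := Fin 3))).toProjective)
      (MvPolynomial.aeval (R := K) (homCoords Q)).toRingHom F
    change WeierstrassCurve.Projective.dblXYZ ((W.map (MvPolynomial.C (σ := Fin 3))).map
      (MvPolynomial.aeval (R := K) (homCoords Q)).toRingHom) _ = _ at this
    rw [hW] at this
    rw [← h]
    exact this.symm
  · refine IsRationalOver.of_polynomials
      ((W.map (MvPolynomial.C (σ := Fin 3))).toProjective.addXYZ F G)
      (((hF.union hG).union (Set.not_infinite.mp hinf)).subset fun Q hQ ↦ ?_)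
    by_contra hcon
    simp only [Set.mem_union, Set.mem_ofPred_eq, not_or, not_not] at hcon
    obtain ⟨⟨⟨c, hc, h⟩, ⟨d, hd, h'⟩⟩, hne⟩ := hcon
    refine hQ (main Q _ c d hc hd ?_)
    rw [Projective.add_of_not_equiv]
    · have := Projective.map_addXYZ (W' := (W.map (MvPolynomial.C (σ := Fin 3))).toProjective)
        (MvPolynomial.aeval (R := K) (homCoords Q)).toRingHom F G
      change WeierstrassCurve.Projective.addXYZ ((W.map (MvPolynomial.C (σ := Fin 3))).map
        (MvPolynomial.aeval (R := K) (homCoords Q)).toRingHom) _ _ = _ at this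
      rw [hW] at this
      rw [← h, ← h']
      exact this.symm
    · rintro ⟨u, hu⟩
      refine hne (homCoords_inj (c := c) (d := u * d) hc (mul_ne_zero u.ne_zero hd) ?_)
      rw [mul_smul]
      exact hu.symm

theorem isRationalOver_mul {φ ψ : AddMonoid.End (W⁄L).toAffine.Point}
    (hφ : IsRationalOver L W φ) (hψ : IsRationalOver L W ψ) :
    IsRationalOver L W (φ * ψ : AddMonoid.End (W⁄L).toAffine.Point) := by
  by_cases h0 : ψ = 0
  · subst h0
    rw [mul_zero]
    exact isRationalOver_zero
  have hfib : ∀ P, {Q | ψ Q = P}.Finite := by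
    intro P
    by_contra hinf
    have : Infinite (W⁄L).toAffine.Point :=
      Set.infinite_univ_iff.mp (Set.Infinite.mono (Set.subset_univ _) hinf)
    exact h0 (addMonoidHom_eq_zero ψ P (finite_ne_const hψ P hinf))
  obtain ⟨n, F, hFn, hF⟩ := hφ
  obtain ⟨_, G, -, hG⟩ := hψ
  refine IsRationalOver.of_polynomials (fun i ↦ MvPolynomial.bind₁ G (F i))
    ((hG.union (hF.preimage' fun P _ ↦ hfib P)).subset fun Q hQ ↦ ?_)
  by_contra hcon
  simp only [Set.mem_union, Set.mem_preimage, Set.mem_ofPred_eq, not_or, not_not] at hcon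
  obtain ⟨⟨d, hd, h'⟩, ⟨c, hc, h⟩⟩ := hcon
  refine hQ ⟨d ^ n * c, mul_ne_zero (pow_ne_zero _ hd) hc, ?_⟩
  ext i
  rw [MvPolynomial.aeval_bind₁, h', aeval_smul_of_homogeneous (hFn i)]
  have := congrFun h i
  simp only [Pi.smul_apply, smul_eq_mul] at this ⊢
  rw [this, mul_assoc]
  rfl

end Aux

/-- The ring `End_K(W)` of endomorphisms over `K` of an elliptic curve `W` over `K`, realized
through its faithful action on the group `W(L)`, where `L` is an algebraic closure of `K`. Its
elements are the group endomorphisms of `W(L)` that are given by a rational map over `K` (a rational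
map from a smooth projective curve to itself extends uniquely to a morphism), addition is pointwise
and multiplication is composition. -/
def endRing {K : Type*} [Field K] (L : Type*) [Field L] [Algebra K L] [DecidableEq L]
    (W : WeierstrassCurve K) : Subring (AddMonoid.End (W⁄L).toAffine.Point) where
  carrier := {φ | IsRationalOver L W φ}
  mul_mem' := isRationalOver_mul
  one_mem' := isRationalOver_id
  add_mem' := isRationalOver_add
  zero_mem' := isRationalOver_zero
  neg_mem' := isRationalOver_neg

/-- An elliptic curve `W` over a field `K` of characteristic `p` is supersingular if it has no
nontrivial points of `p`-power order over an algebraic closure `L` of `K`. -/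
def IsSupersingular {K : Type*} [Field K] (L : Type*) [Field L] [Algebra K L] [DecidableEq L]
    (W : WeierstrassCurve K) (p : ℕ) : Prop :=
  ∀ k : ℕ, 1 ≤ k → ∀ P : (W⁄L).toAffine.Point, p ^ k • P = 0 → P = 0

end WeierstrassCurve

/-- The subring `ℤ[(1 + √-p)/2]` of the complex numbers. -/
noncomputable def intAdjoinHalf (p : ℕ) : Subring ℂ :=
  Subring.closure {(1 + Complex.I * (Real.sqrt p : ℂ)) / 2}

/-! Let `R` be the ring of endomorphisms over `F_p` and `π` the Frobenius. The degree of an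
endomorphism is realised as the degree of the rational function by which it acts on `x`-coordinates.
It is multiplicative, satisfies the parallelogram law and vanishes only at `0`
(`isDegreeForm_xDegree`). These properties alone give each `φ` in `R` an equation `φ² - tφ + d = 0`
with `t² ≤ 4d` (`mul_self_eq`, `trace_sq_le`).

For a supersingular curve `π (t - π) = p` is injective on points, so `t - π` is an injective map of
degree `p`. It is therefore inseparable and equals `ψ π` for some `ψ`
(`exists_eq_mul_frobeniusEnd`). Hence `t = (ψ + 1) π`, so `p` divides `t²`, and `t² ≤ 4p` leaves
only `t = 0`. Thus `π² = -p`. As everything in `R` commutes with `π`, the ring lies between `ℤ[π]`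
and `(1/2) ℤ[π]` (`exists_two_zsmul_eq`), and it is `ℤ[(1 + √-p)/2]` as soon as `1 + π` is divisible
by `2` in `R`.

If `R` is isomorphic to `ℤ[(1 + √-p)/2]`, then `2α - 1 = ±π` for some `α`, so `π` acts trivially on
`E[2]`. Conversely, if `E[2]` is rational, then `π - 1` kills `E[2]` and factors through
multiplication by `2` as a group homomorphism. That the quotient is a rational map over `F_p`
follows from explicit halving formulas: the square roots they need for the point `π P - P` are
rational functions of `P` (`exists_isRationalOver_two_nsmul_eq`). -/

/-- A positive definite integral form on a ring that satisfies the parallelogram law and permits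
composition. -/
structure IsDegreeForm {R : Type*} [Ring R] (d : R → ℤ) : Prop where
  parallelogram : ∀ x y, d (x + y) + d (x - y) = 2 * d x + 2 * d y
  map_mul : ∀ x y, d (x * y) = d x * d y
  map_one : d 1 = 1
  nonneg : ∀ x, 0 ≤ d x
  eq_zero : ∀ x, d x = 0 → x = 0

/-! ### Rings with a multiplicative positive definite quadratic form -/

namespace IsDegreeForm

variable {R : Type*} [Ring R] {d : R → ℤ} (hd : IsDegreeForm d)
include hd

theorem map_zero : d 0 = 0 := by
  have := hd.parallelogram 0 0
  simp only [add_zero, sub_zero] at this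
  lia

theorem map_neg (x : R) : d (-x) = d x := by
  have := hd.parallelogram 0 x
  simp only [zero_add, zero_sub, hd.map_zero] at this
  lia

/-- The Jordan–von Neumann argument: four instances of the parallelogram law, combined and divided
by `2`, show that `d` is quadratic. This is what makes `polar` biadditive. -/
theorem map_add_add (x y z : R) :
    d (x + y + z) = d (x + y) + d (x + z) + d (y + z) - d x - d y - d z := by
  have h1 := hd.parallelogram (x + z) y
  have h2 := hd.parallelogram x (z - y)
  have h3 := hd.parallelogram (x + y) z
  have h4 := hd.parallelogram y z
  have h5 := hd.map_neg (y - z)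
  rw [neg_sub] at h5
  rw [show x + z + y = x + y + z by abel, show x + z - y = x + (z - y) by abel] at h1
  rw [show x - (z - y) = x + y - z by abel] at h2
  lia

/-- The polar form of a degree form. -/
def polar : R →+ R →+ ℤ :=
  AddMonoidHom.mk' (fun x ↦ AddMonoidHom.mk' (fun y ↦ d (x + y) - d x - d y) fun y z ↦ by
    have := hd.map_add_add x y z
    rw [add_assoc] at this
    lia) fun x y ↦ by
    ext z
    have := hd.map_add_add x y z
    simp only [AddMonoidHom.mk'_apply, AddMonoidHom.add_apply]
    lia

theorem polar_apply (x y : R) : hd.polar x y = d (x + y) - d x - d y := rfl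

theorem polar_comm (x y : R) : hd.polar x y = hd.polar y x := by
  rw [polar_apply, polar_apply, add_comm]
  ring

theorem polar_self (x : R) : hd.polar x x = 2 * d x := by
  have := hd.parallelogram x x
  rw [sub_self, hd.map_zero] at this
  rw [polar_apply]
  lia

theorem polar_mul_mul_left (x y z : R) : hd.polar (x * y) (x * z) = d x * hd.polar y z := by
  simp only [polar_apply, ← mul_add, hd.map_mul]
  ring

/-- Linearisation of `polar_mul_mul_left` in the common left factor. -/
theorem polar_mul_add_polar_mul (x w y z : R) :
    hd.polar (x * y) (w * z) + hd.polar (w * y) (x * z) = hd.polar x w * hd.polar y z := by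
  have h := hd.polar_mul_mul_left (x + w) y z
  simp only [add_mul, _root_.map_add, AddMonoidHom.add_apply, hd.polar_mul_mul_left] at h
  rw [hd.polar_apply x w]
  linear_combination h

/-- The trace of an element: the coefficient in its quadratic equation. -/
def trace : R →+ ℤ := hd.polar 1

/-- By the composition identities, the difference of the two sides is orthogonal to every `z`, in
particular to itself; definiteness then makes it zero. No conjugation on `R` is needed. -/
theorem mul_self_eq (x : R) : x * x = hd.trace x • x - d x • (1 : R) := by
  have h : ∀ z, hd.polar (x * x - (hd.trace x • x - d x • (1 : R))) z = 0 := by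
    intro z
    have h1 := hd.polar_mul_add_polar_mul x 1 x z
    have h2 := hd.polar_mul_mul_left x 1 z
    rw [one_mul, one_mul] at h1
    rw [mul_one] at h2
    simp only [_root_.map_sub, map_zsmul, AddMonoidHom.sub_apply, AddMonoidHom.coe_smul,
      Pi.smul_apply, smul_eq_mul]
    rw [trace, hd.polar_comm 1 x]
    linear_combination h1 - h2
  have h0 := h (x * x - (hd.trace x • x - d x • (1 : R)))
  rw [hd.polar_self] at h0
  exact sub_eq_zero.mp (hd.eq_zero _ (by lia))

theorem map_zsmul_one (n : ℤ) : d (n • (1 : R)) = n ^ 2 := by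
  have := hd.polar_self (n • (1 : R))
  simp only [map_zsmul, AddMonoidHom.coe_smul, Pi.smul_apply, smul_eq_mul, hd.polar_self,
    hd.map_one] at this
  linarith

theorem map_add_zsmul (x : R) (m n : ℤ) :
    d (m • 1 + n • x) = m ^ 2 + m * n * hd.trace x + n ^ 2 * d x := by
  have h := hd.polar_apply (m • 1) (n • x)
  have h1 := hd.polar_self (n • x)
  simp only [map_zsmul, AddMonoidHom.coe_smul, Pi.smul_apply, smul_eq_mul, hd.polar_self] at h h1
  rw [hd.map_zsmul_one] at h
  rw [trace]
  linarith

/-- The number `4d - t²` is the value of `d` at `2x - t`. Applied to Frobenius this is the Hasse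
bound. -/
theorem trace_sq_le (x : R) : hd.trace x ^ 2 ≤ 4 * d x := by
  have h := hd.nonneg ((-hd.trace x) • 1 + (2 : ℤ) • x)
  rw [hd.map_add_zsmul] at h
  linarith

theorem noZeroDivisors : NoZeroDivisors R where
  eq_zero_or_eq_zero_of_mul_eq_zero {a b} h := by
    have h1 := hd.map_mul a b
    rw [h, hd.map_zero, eq_comm, mul_eq_zero] at h1
    exact h1.imp (hd.eq_zero a) (hd.eq_zero b)

theorem eq_zero_of_zsmul_eq_zero {n : ℤ} (hn : n ≠ 0) {x : R} (h : n • x = 0) : x = 0 := by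
  have h1 : (n • (1 : R)) * x = 0 := by rw [smul_mul_assoc, one_mul, h]
  have h2 := hd.map_mul (n • (1 : R)) x
  rw [h1, hd.map_zero, hd.map_zsmul_one, eq_comm, mul_eq_zero] at h2
  exact hd.eq_zero x (h2.resolve_left (pow_ne_zero 2 hn))

theorem zsmul_right_injective {n : ℤ} (hn : n ≠ 0) {x y : R} (h : n • x = n • y) : x = y :=
  sub_eq_zero.mp (hd.eq_zero_of_zsmul_eq_zero hn (by rw [smul_sub, h, sub_self]))

/-- An element of degree form `p` and trace `0` is a square root of `-p`. -/
theorem mul_self_of_trace_eq_zero {x : R} (h : hd.trace x = 0) : x * x = -(d x • (1 : R)) := by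
  rw [hd.mul_self_eq, h, zero_smul, zero_sub]

/-- A square root of `-p` has degree form `p`. -/
theorem map_of_mul_self {p : ℕ} {π : R} (hπ : π * π = -((p : ℤ) • (1 : R))) : d π = p := by
  have h1 : d π ^ 2 = (p : ℤ) ^ 2 := by rw [sq, ← hd.map_mul, hπ, hd.map_neg, hd.map_zsmul_one]
  exact (pow_left_inj₀ (hd.nonneg _) (by positivity) two_ne_zero).mp h1

/-- A square root of `-p` has trace zero. -/
theorem trace_of_mul_self {p : ℕ} (hp : p ≠ 0) {π : R} (hπ : π * π = -((p : ℤ) • (1 : R))) :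
    hd.trace π = 0 := by
  have hdπ := hd.map_of_mul_self hπ
  by_contra h0
  have h1 := hd.mul_self_eq π
  rw [hπ, hdπ, neg_eq_iff_add_eq_zero] at h1
  have h2 : hd.trace π • π = 0 := by rw [← h1]; abel
  have := hd.eq_zero_of_zsmul_eq_zero h0 h2
  rw [this, hd.map_zero] at hdπ
  exact hp (by exact_mod_cast hdπ.symm)

theorem map_add_zsmul_of_mul_self {p : ℕ} (hp : p ≠ 0) {π : R}
    (hπ : π * π = -((p : ℤ) • (1 : R))) (m n : ℤ) : d (m • 1 + n • π) = m ^ 2 + n ^ 2 * p := by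
  rw [hd.map_add_zsmul, hd.trace_of_mul_self hp hπ, hd.map_of_mul_self hπ]
  ring

theorem map_two_zsmul (x : R) : d ((2 : ℤ) • x) = 4 * d x := by
  have := hd.map_add_zsmul x 0 2
  rw [zero_smul, zero_add] at this
  rw [this]
  ring

theorem four_mul_map {p : ℕ} (hp : p ≠ 0) {π α : R} (hπ : π * π = -((p : ℤ) • (1 : R)))
    (hα : (2 : ℤ) • α = 1 + π) : 4 * d α = 1 + p := by
  have := hd.map_add_zsmul_of_mul_self hp hπ 1 1
  rw [one_smul, one_smul, ← hα, hd.map_two_zsmul] at this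
  linarith

/-- The centralizer of a square root `π` of `-p` consists of elements of `ℤ[π/2]`. -/
theorem exists_two_zsmul_eq {p : ℕ} (hp : p.Prime) {π x : R} (hπ : π * π = -((p : ℤ) • (1 : R)))
    (hx : x * π = π * x) : ∃ k : ℤ, (2 : ℤ) • x = hd.trace x • 1 + k • π := by
  set t := hd.trace x with ht
  set n := d x with hn
  have hp0 : (p : ℤ) ≠ 0 := by exact_mod_cast hp.ne_zero
  -- The traceless part of `2x`; its square is the scalar `-D` with `D = 4n - t² ≥ 0`. The aim is
  -- that `a` is an integer multiple of `π`.
  set a := (2 : ℤ) • x - t • (1 : R) with ha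
  have haa : a * a = (t ^ 2 - 4 * n) • (1 : R) := by
    have h := hd.mul_self_eq x
    rw [← ht, ← hn] at h
    simp only [ha, sub_mul, mul_sub, smul_mul_assoc, mul_smul_comm, one_mul, mul_one, h]
    module
  have haπ : a * π = π * a := by
    simp only [ha, sub_mul, mul_sub, smul_mul_assoc, mul_smul_comm, one_mul, mul_one, hx]
  suffices h : ∃ k : ℤ, a = k • π by
    obtain ⟨k, hk⟩ := h
    exact ⟨k, by rw [← hk, ha]; abel⟩
  set D := 4 * n - t ^ 2 with hD
  by_cases hD0 : D = 0
  · refine ⟨0, ?_⟩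
    have := hd.noZeroDivisors
    rw [show t ^ 2 - 4 * n = 0 by lia, zero_smul] at haa
    rw [zero_smul]
    exact mul_self_eq_zero.mp haa
  have hcc : (a * π) * (a * π) = (D * p) • (1 : R) := by
    rw [mul_assoc, ← mul_assoc π, ← haπ, mul_assoc, ← mul_assoc a, haa, hπ]
    simp only [smul_mul_assoc, one_mul, smul_smul, ← neg_smul]
    congr 1
    ring
  -- Since `a` commutes with `π`, the square of `c` is the positive scalar `D p`, which forces `c`
  -- to be a rational scalar.
  set c := a * π with hc
  have hc1 := hd.mul_self_eq c
  have hdc : d c = D * p := by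
    have h1 : d c ^ 2 = (D * p) ^ 2 := by rw [sq, ← hd.map_mul, hcc, hd.map_zsmul_one]
    have h2 : 0 ≤ D * p := mul_nonneg (by linarith [hd.trace_sq_le x]) (by positivity)
    exact (pow_left_inj₀ (hd.nonneg _) h2 two_ne_zero).mp h1
  rw [hcc, hdc] at hc1
  -- The quadratic equation of `c` reads `c² = s c - D p`, while `c² = D p`.
  have hs : hd.trace c • c = (2 * D * p) • (1 : R) := by
    rw [eq_sub_iff_add_eq] at hc1
    rw [← hc1]
    module
  set s := hd.trace c with hs'
  have hs0 : s ≠ 0 := by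
    intro h0
    rw [h0, zero_smul] at hs
    have := hd.map_zsmul_one (2 * D * p)
    rw [← hs, hd.map_zero] at this
    exact pow_ne_zero 2 (mul_ne_zero (mul_ne_zero two_ne_zero hD0) hp0) this.symm
  have hsa : s • a = (-(2 * D)) • π := by
    refine hd.zsmul_right_injective hp0 ?_
    have h1 : s • c * π = (2 * D * p) • π := by rw [hs, smul_mul_assoc, one_mul]
    rw [hc, smul_mul_assoc, mul_assoc, hπ] at h1
    simp only [mul_neg, mul_smul_comm, mul_one] at h1
    rw [smul_comm, ← neg_inj, ← smul_neg, h1, smul_smul, ← neg_smul]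
    congr 1
    ring
  have hsq : s ^ 2 * D = (2 * D) ^ 2 * p := by
    have h1 : (s • a) * (s • a) = (-(2 * D)) • π * (-(2 * D)) • π := by rw [hsa]
    simp only [smul_mul_assoc, mul_smul_comm, haa, hπ] at h1
    rw [← sub_eq_zero] at h1
    have h2 : ((2 * D) ^ 2 * p - s ^ 2 * D) • (1 : R) = 0 := by
      rw [← h1, hD]
      module
    have h3 := hd.map_zsmul_one ((2 * D) ^ 2 * p - s ^ 2 * D)
    rw [h2, hd.map_zero] at h3
    have := pow_eq_zero_iff two_ne_zero |>.mp h3.symm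
    linarith
  -- So `D p` is the square of `s / 2`; as `p` is prime, `D = p k²`, and `a = -k π`.
  have hs4 : s ^ 2 = 4 * D * p := mul_right_cancel₀ hD0 (by linear_combination hsq)
  have hps : (p : ℤ) ∣ s := (Nat.prime_iff_prime_int.mp hp).dvd_of_dvd_pow (n := 2)
    ⟨4 * D, by rw [hs4]; ring⟩
  have h2s : (2 : ℤ) ∣ s := Int.prime_two.dvd_of_dvd_pow (n := 2) ⟨2 * D * p, by rw [hs4]; ring⟩
  obtain ⟨m, hm⟩ := h2s
  have hm2 : m ^ 2 = D * p := by
    have : (2 * m) ^ 2 = 4 * D * p := by rw [← hm, hs4]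
    linarith
  have hpm : (p : ℤ) ∣ m := (Nat.prime_iff_prime_int.mp hp).dvd_of_dvd_pow (n := 2)
    ⟨D, by rw [hm2]; ring⟩
  obtain ⟨k, hk⟩ := hpm
  have hDk : D = p * k ^ 2 := by
    refine mul_right_cancel₀ hp0 ?_
    rw [← hm2, hk]
    ring
  refine ⟨-k, hd.zsmul_right_injective hs0 ?_⟩
  rw [hsa, hm, hk, hDk, smul_smul]
  congr 1
  ring

/-- If `π` is a square root of `-p` that commutes with everything and `1 + π` is divisible by `2`,
then the ring is generated by `(1 + π) / 2`. -/
theorem exists_eq_add_zsmul {p : ℕ} (hp : p.Prime) {π α : R}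
    (hπ : π * π = -((p : ℤ) • (1 : R))) (hα : (2 : ℤ) • α = 1 + π)
    (hcomm : ∀ x, x * π = π * x) (x : R) : ∃ m n : ℤ, x = m • 1 + n • α := by
  obtain ⟨k, hk⟩ := hd.exists_two_zsmul_eq hp hπ (hcomm x)
  have hp4 := hd.four_mul_map hp.ne_zero hπ hα
  have hx4 : 4 * d x = hd.trace x ^ 2 + k ^ 2 * p := by
    rw [← hd.map_two_zsmul, hk, hd.map_add_zsmul_of_mul_self hp.ne_zero hπ]
  -- Integrality of the norm: with `t = trace x`, `4 d x = t² + k² p` and `1 + p = 4 d α` make `t² -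
  -- k²` even, so `t` and `k` have the same parity.
  have hdvd : (2 : ℤ) ∣ hd.trace x - k := by
    have h5 : (2 : ℤ) ∣ (hd.trace x - k) * (hd.trace x + k) :=
      ⟨2 * d x - 2 * k ^ 2 * d α, by linear_combination -hx4 + k ^ 2 * hp4⟩
    rcases Int.prime_two.dvd_or_dvd h5 with h | h <;> lia
  obtain ⟨m, hm⟩ := hdvd
  refine ⟨m, k, hd.zsmul_right_injective two_ne_zero ?_⟩
  rw [hk, smul_add, smul_comm 2 k α, hα, show hd.trace x = 2 * m + k by lia]
  module

/-- The isomorphism with `ℤ[(1 + √-p)/2]`. -/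
theorem nonempty_ringEquiv_intAdjoinHalf {p : ℕ} (hp : p.Prime) {π α : R}
    (hπ : π * π = -((p : ℤ) • (1 : R))) (hα : (2 : ℤ) • α = 1 + π)
    (hcomm : ∀ x, x * π = π * x) : Nonempty (R ≃+* intAdjoinHalf p) := by
  have hp4 := hd.four_mul_map hp.ne_zero hπ hα
  -- The trace of `α` is `1`, half the trace of `1 + π`.
  have hα2 : α * α = (-d α) • (1 : R) + (1 : ℤ) • α := by
    have h1 : (2 : ℤ) • hd.trace α = hd.trace (1 + π) := by rw [← hα, map_zsmul]
    have h2 : hd.trace (1 : R) = 2 := by rw [trace, hd.polar_self, hd.map_one, mul_one]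
    rw [_root_.map_add, h2, hd.trace_of_mul_self hp.ne_zero hπ, smul_eq_mul] at h1
    rw [hd.mul_self_eq, show hd.trace α = 1 by lia, one_smul, neg_smul]
    abel
  set ω : ℂ := (1 + Complex.I * (Real.sqrt p : ℂ)) / 2 with hω
  have hpsq : (Real.sqrt p : ℂ) ^ 2 = p := by
    rw [← Complex.ofReal_pow, Real.sq_sqrt (Nat.cast_nonneg p), Complex.ofReal_natCast]
  have hω2 : ω * ω = (-d α) • (1 : ℂ) + (1 : ℤ) • ω := by
    have hp4' : 4 * (d α : ℂ) = 1 + p := by exact_mod_cast hp4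
    simp only [zsmul_eq_mul, Int.cast_neg, Int.cast_one, hω]
    linear_combination (1 / 4 : ℂ) * Complex.I ^ 2 * hpsq + (p / 4 : ℂ) * Complex.I_sq +
      (1 / 4 : ℂ) * hp4'
  -- Both rings are compared with `ℤ[X]/(X² - X + d α)`, where `d α = (1 + p)/4`.
  let f : QuadraticAlgebra ℤ (-d α) 1 →+* R := (QuadraticAlgebra.lift ⟨α, hα2⟩).toRingHom
  have hf : ∀ z, f z = z.re • 1 + z.im • α := fun z ↦ rfl
  let g : QuadraticAlgebra ℤ (-d α) 1 →+* ℂ := (QuadraticAlgebra.lift ⟨ω, hω2⟩).toRingHom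
  have hg : ∀ z, g z = z.re • 1 + z.im • ω := fun z ↦ rfl
  have hfb : Function.Bijective f := by
    constructor
    · rw [injective_iff_map_eq_zero]
      intro z hz
      rw [hf] at hz
      -- Doubling puts the element into `ℤ[π]`, where the form is `m² + p n²` and visibly definite.
      have h1 : (2 * z.re + z.im) • (1 : R) + z.im • π = 0 := by
        rw [← smul_zero (2 : ℤ), ← hz, smul_add, smul_comm 2 z.im α, hα]
        module
      have h2 := hd.map_add_zsmul_of_mul_self hp.ne_zero hπ (2 * z.re + z.im) z.im
      rw [h1, hd.map_zero] at h2
      have hp0 : (0 : ℤ) < p := by exact_mod_cast hp.pos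
      have h3 : z.im = 0 := by
        by_contra h0
        have := mul_pos (pow_pos (abs_pos.mpr h0) 2) hp0
        rw [sq_abs] at this
        nlinarith [sq_nonneg (2 * z.re + z.im)]
      rw [h3] at h2
      have h4 : 2 * z.re + 0 = 0 := pow_eq_zero_iff two_ne_zero |>.mp (by linarith)
      ext
      · simp only [QuadraticAlgebra.re_zero]
        lia
      · exact h3
    · intro x
      obtain ⟨m, n, rfl⟩ := hd.exists_eq_add_zsmul hp hπ hα hcomm x
      exact ⟨⟨m, n⟩, rfl⟩
  have hgi : Function.Injective g := by
    rw [injective_iff_map_eq_zero]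
    intro z hz
    rw [hg] at hz
    have him := congrArg Complex.im hz
    have hre := congrArg Complex.re hz
    simp [hω] at him hre
    have h3 : z.im = 0 := him.resolve_right hp.ne_zero
    ext
    · simpa [h3] using hre
    · exact h3
  have hgr : g.range = intAdjoinHalf p := by
    apply le_antisymm
    · rintro _ ⟨z, rfl⟩
      have : ω ∈ intAdjoinHalf p := Subring.subset_closure rfl
      exact add_mem (zsmul_mem (one_mem _) _) (zsmul_mem this _)
    · refine Subring.closure_le.mpr ?_
      rintro _ rfl
      exact ⟨⟨0, 1⟩, by rw [hg]; simp [hω]⟩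
  have hgb : Function.Bijective g.rangeRestrict :=
    ⟨fun a b hab ↦ hgi (congrArg Subtype.val hab), g.rangeRestrict_surjective⟩
  exact ⟨((RingEquiv.ofBijective f hfb).symm.trans (RingEquiv.ofBijective _ hgb)).trans
    (RingEquiv.subringCongr hgr)⟩

end IsDegreeForm

/-! ### Primitive vectors of polynomials as morphisms from the projective line -/

namespace Polynomial

universe u

variable {K : Type u} [Field K] {ι κ : Type*} [Fintype ι] [Fintype κ]

/-- A vector of polynomials is primitive if its entries generate the unit ideal. -/
def IsPrimitiveVec (v : ι → K[X]) : Prop := Ideal.span (Set.range v) = ⊤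

/-- The degree of a vector of polynomials: the maximum of the degrees of its entries. -/
def vecDegree (v : ι → K[X]) : ℕ := Finset.univ.sup fun i ↦ (v i).natDegree

theorem natDegree_le_vecDegree (v : ι → K[X]) (i : ι) : (v i).natDegree ≤ vecDegree v :=
  Finset.le_sup (f := fun i ↦ (v i).natDegree) (Finset.mem_univ i)

theorem isPrimitiveVec_iff {v : ι → K[X]} : IsPrimitiveVec v ↔ ∃ c : ι → K[X], ∑ i, c i * v i = 1 := by
  rw [IsPrimitiveVec, Ideal.eq_top_iff_one, Ideal.mem_span_range_iff_exists_fun]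

/-- This is nonvanishing at infinity, as primitivity is nonvanishing at finite points. Zero entries
have `natDegree` equal to `0`, so degree `0` needs a separate choice of a nonzero entry. -/
theorem IsPrimitiveVec.exists_coeff_ne_zero {v : ι → K[X]} (hv : IsPrimitiveVec v) :
    ∃ i, (v i).coeff (vecDegree v) ≠ 0 := by
  obtain ⟨c, hc⟩ := isPrimitiveVec_iff.mp hv
  obtain ⟨i, -, hi⟩ : ∃ i ∈ Finset.univ, c i * v i ≠ 0 := by
    refine Finset.exists_ne_zero_of_sum_ne_zero ?_
    rw [hc]
    exact one_ne_zero
  have : Nonempty ι := ⟨i⟩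
  obtain ⟨j, -, hj⟩ := Finset.exists_mem_eq_sup Finset.univ Finset.univ_nonempty
    fun i ↦ (v i).natDegree
  by_cases h : vecDegree v = 0
  · refine ⟨i, ?_⟩
    have h1 := natDegree_le_vecDegree v i
    rw [h, ← Nat.le_zero.mp (h ▸ h1)]
    exact leadingCoeff_ne_zero.mpr (right_ne_zero_of_mul hi)
  · refine ⟨j, ?_⟩
    have h1 : vecDegree v = (v j).natDegree := hj
    rw [h1]
    refine leadingCoeff_ne_zero.mpr fun h0 ↦ h ?_
    rw [h1, h0, natDegree_zero]

theorem vecDegree_eq {v : ι → K[X]} {n : ℕ} (h : ∀ i, (v i).natDegree ≤ n)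
    (h' : ∃ i, (v i).coeff n ≠ 0) : vecDegree v = n := by
  refine le_antisymm (Finset.sup_le fun i _ ↦ h i) ?_
  obtain ⟨i, hi⟩ := h'
  exact (le_natDegree_of_ne_zero hi).trans (natDegree_le_vecDegree v i)

omit [Fintype ι] in
/-- A criterion for primitivity in terms of residue fields. -/
theorem isPrimitiveVec_of_forall {v : ι → K[X]}
    (h : ∀ M : Ideal K[X], M.IsMaximal → ∃ i, v i ∉ M) : IsPrimitiveVec v := by
  by_contra hv
  obtain ⟨M, hM, hle⟩ := Ideal.exists_le_maximal _ hv
  obtain ⟨i, hi⟩ := h M hM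
  exact hi (hle (Ideal.subset_span ⟨i, rfl⟩))

omit [Fintype ι] in
theorem IsPrimitiveVec.exists_notMem {v : ι → K[X]} (hv : IsPrimitiveVec v) {M : Ideal K[X]}
    (hM : M.IsMaximal) : ∃ i, v i ∉ M := by
  by_contra! h
  exact hM.ne_top (top_le_iff.mp (hv ▸ Ideal.span_le.mpr (by rintro _ ⟨i, rfl⟩; exact h i)))

theorem coeff_finsetProd_of_natDegree_le {α : Type*} (s : Finset α) (f : α → K[X]) (n : α → ℕ)
    (h : ∀ i, (f i).natDegree ≤ n i) :
    (∏ i ∈ s, f i).natDegree ≤ ∑ i ∈ s, n i ∧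
      (∏ i ∈ s, f i).coeff (∑ i ∈ s, n i) = ∏ i ∈ s, (f i).coeff (n i) := by
  classical
  induction s using Finset.induction_on with
  | empty => simp
  | insert a s ha ih =>
    rw [Finset.prod_insert ha, Finset.sum_insert ha, Finset.prod_insert ha]
    exact ⟨natDegree_mul_le_of_le (h a) ih.1, by
      rw [coeff_mul_add_eq_of_natDegree_le (h a) ih.1, ih.2]⟩

/-- The top coefficient of a form in polynomials is the form in the top coefficients. -/
theorem coeff_aeval_of_isHomogeneous {F : MvPolynomial ι K} {m n : ℕ} (hF : F.IsHomogeneous m)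
    {v : ι → K[X]} (hv : ∀ i, (v i).natDegree ≤ n) :
    (MvPolynomial.aeval v F).natDegree ≤ m * n ∧
      (MvPolynomial.aeval v F).coeff (m * n) = MvPolynomial.aeval (fun i ↦ (v i).coeff n) F := by
  have key : ∀ e ∈ F.support,
      (∏ i, v i ^ e i).natDegree ≤ m * n ∧
      (∏ i, v i ^ e i).coeff (m * n) = ∏ i, (v i).coeff n ^ e i := by
    intro e he
    have hdeg : ∑ i, e i * n = m * n := by
      rw [← Finset.sum_mul, ← Finsupp.degree_eq_sum]
      congr 1
      by_contra hne
      exact (MvPolynomial.mem_support_iff.mp he) (hF.coeff_eq_zero hne)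
    have := coeff_finsetProd_of_natDegree_le Finset.univ (fun i ↦ v i ^ e i) (fun i ↦ e i * n)
      fun i ↦ natDegree_pow_le_of_le _ (hv i)
    rw [hdeg] at this
    refine ⟨this.1, this.2.trans (Finset.prod_congr rfl fun i _ ↦ ?_)⟩
    exact coeff_pow_of_natDegree_le (hv i)
  rw [MvPolynomial.aeval_def, MvPolynomial.aeval_def, MvPolynomial.eval₂_eq',
    MvPolynomial.eval₂_eq', finsetSum_coeff]
  constructor
  · refine natDegree_sum_le_of_forall_le _ _ fun e he ↦ ?_
    exact (natDegree_C_mul_le _ _).trans (key e he).1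
  · refine Finset.sum_congr rfl fun e he ↦ ?_
    rw [algebraMap_eq, coeff_C_mul, (key e he).2]
    rfl

/-- A system of forms of degree `m` without common zeros maps primitive vectors to primitive
vectors, and multiplies degrees by `m`. -/
theorem IsPrimitiveVec.aeval {v : ι → K[X]} (hv : IsPrimitiveVec v) {m : ℕ}
    {F : κ → MvPolynomial ι K} (hF : ∀ i, (F i).IsHomogeneous m)
    (h : ∀ (k : Type u) [Field k] [Algebra K k] (x : ι → k), x ≠ 0 →
      ∃ i, MvPolynomial.aeval x (F i) ≠ 0) :
    IsPrimitiveVec (fun i ↦ MvPolynomial.aeval v (F i)) ∧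
      vecDegree (fun i ↦ MvPolynomial.aeval v (F i)) = m * vecDegree v := by
  constructor
  -- At finite points: the forms are evaluated in the residue field of a maximal ideal.
  · refine isPrimitiveVec_of_forall fun M hM ↦ ?_
    let := Ideal.Quotient.field M
    obtain ⟨j, hj⟩ := hv.exists_notMem hM
    obtain ⟨i, hi⟩ := h (K[X] ⧸ M) (fun i ↦ Ideal.Quotient.mk M (v i)) fun h0 ↦
      hj (Ideal.Quotient.eq_zero_iff_mem.mp (congrFun h0 j))
    refine ⟨i, fun hmem ↦ hi ?_⟩
    rw [← Ideal.Quotient.eq_zero_iff_mem] at hmem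
    rw [← hmem]
    have := MvPolynomial.map_aeval v (Ideal.Quotient.mk M) (F i)
    rw [this, MvPolynomial.aeval_def]
    rfl
  -- At infinity: the same argument for the vector of top coefficients.
  · refine vecDegree_eq (fun i ↦ (coeff_aeval_of_isHomogeneous (hF i)
      (natDegree_le_vecDegree v)).1) ?_
    obtain ⟨j, hj⟩ := hv.exists_coeff_ne_zero
    obtain ⟨i, hi⟩ := h K (fun i ↦ (v i).coeff (vecDegree v)) fun h0 ↦ hj (congrFun h0 j)
    exact ⟨i, by rwa [(coeff_aeval_of_isHomogeneous (hF i) (natDegree_le_vecDegree v)).2]⟩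

/-- Proportional primitive vectors have the same degree. -/
theorem IsPrimitiveVec.vecDegree_eq_of_mul_eq_mul {v w : ι → K[X]} (hv : IsPrimitiveVec v)
    (hw : IsPrimitiveVec w) (h : ∀ i j, v i * w j = v j * w i) : vecDegree v = vecDegree w := by
  obtain ⟨c, hc⟩ := isPrimitiveVec_iff.mp hv
  obtain ⟨e, he⟩ := isPrimitiveVec_iff.mp hw
  -- The Bézout relations give `w = g v` and `v = k w`, so `g` is a unit and hence constant.
  set g := ∑ i, c i * w i
  set k := ∑ i, e i * v i
  have h1 : ∀ j, w j = g * v j := by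
    intro j
    rw [← one_mul (w j), ← hc, Finset.sum_mul, Finset.sum_mul]
    exact Finset.sum_congr rfl fun i _ ↦ by linear_combination c i * h i j
  have h2 : ∀ j, v j = k * w j := by
    intro j
    rw [← one_mul (v j), ← he, Finset.sum_mul, Finset.sum_mul]
    exact Finset.sum_congr rfl fun i _ ↦ by linear_combination -e i * h i j
  obtain ⟨i, hi⟩ := hv.exists_coeff_ne_zero
  have hi0 : v i ≠ 0 := fun h0 ↦ hi (by rw [h0, coeff_zero])
  have hkg : k * g = 1 := by
    refine mul_right_cancel₀ hi0 ?_
    rw [mul_assoc, ← h1, ← h2, one_mul]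
  have hg : g.natDegree = 0 := natDegree_eq_zero_of_isUnit (IsUnit.of_mul_eq_one_right _ hkg)
  have hg0 : g ≠ 0 := right_ne_zero_of_mul_eq_one hkg
  refine Finset.sup_congr rfl fun j _ ↦ ?_
  rw [h1]
  by_cases hj : v j = 0
  · simp [hj]
  · rw [natDegree_mul hg0 hj, hg, zero_add]

/-- The coefficient vector of the product of two linear forms. -/
def symProd {R : Type*} [CommSemiring R] (v w : Fin 2 → R) : Fin 3 → R :=
  ![v 0 * w 0, v 0 * w 1 + v 1 * w 0, v 1 * w 1]

/-- The polynomial ring in two variables over a field has no zero divisors. -/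
theorem symProd_ne_zero {k : Type*} [Field k] {v w : Fin 2 → k} (hv : v ≠ 0) (hw : w ≠ 0) :
    symProd v w ≠ 0 := by
  intro h
  have h0 : v 0 * w 0 = 0 := congrFun h 0
  have h1 : v 0 * w 1 + v 1 * w 0 = 0 := congrFun h 1
  have h2 : v 1 * w 1 = 0 := congrFun h 2
  obtain ⟨i, hi⟩ := Function.ne_iff.mp hv
  obtain ⟨j, hj⟩ := Function.ne_iff.mp hw
  fin_cases i <;> fin_cases j <;> simp_all

/-- The degree of primitive vectors is additive for the product of linear forms. -/
theorem IsPrimitiveVec.symProd {v w : Fin 2 → K[X]} (hv : IsPrimitiveVec v)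
    (hw : IsPrimitiveVec w) : IsPrimitiveVec (symProd v w) ∧
      vecDegree (symProd v w) = vecDegree v + vecDegree w := by
  constructor
  · refine isPrimitiveVec_of_forall fun M hM ↦ ?_
    let := Ideal.Quotient.field M
    obtain ⟨i, hi⟩ := hv.exists_notMem hM
    obtain ⟨j, hj⟩ := hw.exists_notMem hM
    have h := symProd_ne_zero (v := fun i ↦ Ideal.Quotient.mk M (v i))
      (w := fun i ↦ Ideal.Quotient.mk M (w i))
      (fun h0 ↦ hi (Ideal.Quotient.eq_zero_iff_mem.mp (congrFun h0 i)))
      (fun h0 ↦ hj (Ideal.Quotient.eq_zero_iff_mem.mp (congrFun h0 j)))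
    obtain ⟨l, hl⟩ := Function.ne_iff.mp h
    refine ⟨l, fun hmem ↦ hl ?_⟩
    rw [← Ideal.Quotient.eq_zero_iff_mem] at hmem
    rw [Pi.zero_apply, ← hmem]
    fin_cases l <;> simp [Polynomial.symProd]
  · have dv := natDegree_le_vecDegree v
    have dw := natDegree_le_vecDegree w
    refine vecDegree_eq (fun l ↦ ?_) ?_
    · fin_cases l
      · exact natDegree_mul_le_of_le (dv _) (dw _)
      · exact natDegree_add_le_of_degree_le (natDegree_mul_le_of_le (dv _) (dw _))
          (natDegree_mul_le_of_le (dv _) (dw _))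
      · exact natDegree_mul_le_of_le (dv _) (dw _)
    · obtain ⟨i, hi⟩ := hv.exists_coeff_ne_zero
      obtain ⟨j, hj⟩ := hw.exists_coeff_ne_zero
      have h := symProd_ne_zero (v := fun i ↦ (v i).coeff (vecDegree v))
        (w := fun i ↦ (w i).coeff (vecDegree w)) (fun h0 ↦ hi (congrFun h0 i))
        (fun h0 ↦ hj (congrFun h0 j))
      obtain ⟨l, hl⟩ := Function.ne_iff.mp h
      refine ⟨l, fun h0 ↦ hl ?_⟩
      rw [Pi.zero_apply, ← h0]
      fin_cases l <;> simp [Polynomial.symProd, coeff_mul_add_eq_of_natDegree_le (dv _) (dw _)]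

/-- Homogenizations of coprime polynomials have no common zeros. -/
theorem exists_aeval_homogenize_ne_zero {u : Fin 2 → K[X]} (hu : IsPrimitiveVec u) {k : Type*}
    [Field k] [Algebra K k] {x : Fin 2 → k} (hx : x ≠ 0) :
    ∃ i, MvPolynomial.aeval x ((u i).homogenize (vecDegree u)) ≠ 0 := by
  have hexp : ∀ i, MvPolynomial.aeval x ((u i).homogenize (vecDegree u)) =
      ∑ j ∈ Finset.range (vecDegree u + 1), algebraMap K k ((u i).coeff j) *
        (x 0 ^ j * x 1 ^ (vecDegree u - j)) := by
    intro i
    conv_lhs => rw [as_sum_range' (u i) (vecDegree u + 1)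
      (Nat.lt_succ_of_le (natDegree_le_vecDegree u i))]
    rw [homogenize_finsetSum, map_sum]
    refine Finset.sum_congr rfl fun j hj ↦ ?_
    rw [homogenize_monomial (Nat.lt_succ_iff.mp (Finset.mem_range.mp hj)),
      MvPolynomial.aeval_monomial, Finsupp.prod_fintype _ _ (by simp)]
    simp
  -- At infinity only the top coefficients survive. Elsewhere a common zero would give a common root
  -- `x 0 / x 1`, against the Bézout relation.
  by_cases h1 : x 1 = 0
  · have h0 : x 0 ≠ 0 := by
      intro h0
      apply hx
      ext i
      fin_cases i
      · exact h0
      · exact h1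
    obtain ⟨i, hi⟩ := hu.exists_coeff_ne_zero
    refine ⟨i, ?_⟩
    rw [hexp, Finset.sum_eq_single (vecDegree u)]
    · simpa [h0] using hi
    · intro j hj hne
      rw [h1, zero_pow (by have := Finset.mem_range.mp hj; lia), mul_zero, mul_zero]
    · simp
  · by_contra! h
    obtain ⟨c, hc⟩ := isPrimitiveVec_iff.mp hu
    have h2 : ∀ i, Polynomial.aeval (x 0 / x 1) (u i) = 0 := by
      intro i
      have := h i
      rw [hexp] at this
      rw [aeval_eq_sum_range' (Nat.lt_succ_of_le (natDegree_le_vecDegree u i))]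
      refine (mul_eq_zero.mp (?_ : x 1 ^ vecDegree u * _ = 0)).resolve_left (pow_ne_zero _ h1)
      rw [← this, Finset.mul_sum]
      refine Finset.sum_congr rfl fun j hj ↦ ?_
      obtain ⟨l, hl⟩ := Nat.exists_eq_add_of_le (Nat.lt_succ_iff.mp (Finset.mem_range.mp hj))
      rw [hl, Nat.add_sub_cancel_left, Algebra.smul_def, div_pow, pow_add]
      field_simp
    have := congrArg (Polynomial.aeval (x 0 / x 1)) hc
    simp [h2] at this

theorem isPrimitiveVec_pair_iff {a b : K[X]} : IsPrimitiveVec ![a, b] ↔ IsCoprime a b := by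
  rw [isPrimitiveVec_iff]
  constructor
  · rintro ⟨c, hc⟩
    exact ⟨c 0, c 1, by simpa using hc⟩
  · rintro ⟨r, s, h⟩
    exact ⟨![r, s], by simpa using h⟩

end Polynomial

/-! ### The coordinates `x` and `η = 2y + a₁x + a₃` -/

namespace WeierstrassCurve

section Coordinates

variable {L : Type*} [Field L] {V : WeierstrassCurve L}

/-- The `x`-coordinate of a point; the point at infinity gets `0`. -/
def xCoord : V.toAffine.Point → L
  | .zero => 0
  | .some x _ _ => x

/-- The function `2y + a₁x + a₃`, which changes sign under negation. -/
def etaCoord : V.toAffine.Point → L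
  | .zero => 0
  | .some x y _ => 2 * y + V.a₁ * x + V.a₃

theorem xCoord_some {x y : L} (h : V.toAffine.Nonsingular x y) :
    xCoord (Affine.Point.some x y h) = x := rfl

theorem etaCoord_some {x y : L} (h : V.toAffine.Nonsingular x y) :
    etaCoord (Affine.Point.some x y h) = 2 * y + V.a₁ * x + V.a₃ := rfl

theorem xCoord_neg (P : V.toAffine.Point) : xCoord (-P) = xCoord P := by
  rcases P with _ | ⟨x, y, h⟩ <;> rfl

theorem etaCoord_neg (P : V.toAffine.Point) : etaCoord (-P) = -etaCoord P := by
  rcases P with _ | ⟨x, y, h⟩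
  · exact neg_zero.symm
  · rw [Affine.Point.neg_some, etaCoord_some, etaCoord_some, Affine.negY]
    ring

theorem xRep_of_ne_zero {P : V.toAffine.Point} (h : P ≠ 0) : P.xRep = ![xCoord P, 1] := by
  rcases P with _ | ⟨x, y, hxy⟩
  · exact absurd rfl h
  · rfl

theorem etaCoord_sq {P : V.toAffine.Point} (h : P ≠ 0) : etaCoord P ^ 2 =
    4 * xCoord P ^ 3 + V.b₂ * xCoord P ^ 2 + 2 * V.b₄ * xCoord P + V.b₆ := by
  rcases P with _ | ⟨x, y, hxy⟩
  · exact absurd rfl h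
  · have := (Affine.equation_iff _ _).mp hxy.1
    rw [etaCoord_some, xCoord_some, b₂, b₄, b₆]
    linear_combination 4 * this

theorem eq_of_coords (h2 : (2 : L) ≠ 0) {P Q : V.toAffine.Point} (hP : P ≠ 0) (hQ : Q ≠ 0)
    (hx : xCoord P = xCoord Q) (he : etaCoord P = etaCoord Q) : P = Q := by
  rcases P with _ | ⟨x, y, h⟩
  · exact absurd rfl hP
  rcases Q with _ | ⟨x', y', h'⟩
  · exact absurd rfl hQ
  rw [xCoord_some, xCoord_some] at hx
  subst hx
  rw [etaCoord_some, etaCoord_some, add_left_inj, add_left_inj] at he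
  obtain rfl := mul_left_cancel₀ h2 he
  rfl

theorem eq_or_eq_neg_of_xCoord_eq {P Q : V.toAffine.Point} (hP : P ≠ 0) (hQ : Q ≠ 0)
    (hx : xCoord P = xCoord Q) : P = Q ∨ P = -Q := by
  rw [← Affine.Point.xRep_eq_xRep_iff, xRep_of_ne_zero hP, xRep_of_ne_zero hQ, hx]

/-- Points can be given by the coordinates `x` and `2y + a₁x + a₃`. -/
theorem exists_point_of_coords [V.IsElliptic] (h2 : (2 : L) ≠ 0) {x e : L}
    (h : e ^ 2 = 4 * x ^ 3 + V.b₂ * x ^ 2 + 2 * V.b₄ * x + V.b₆) :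
    ∃ P : V.toAffine.Point, P ≠ 0 ∧ xCoord P = x ∧ etaCoord P = e := by
  have heq : V.toAffine.Equation x ((e - V.a₁ * x - V.a₃) / 2) := by
    rw [Affine.equation_iff]
    rw [b₂, b₄, b₆] at h
    field_simp
    linear_combination h
  refine ⟨.some x _ (Affine.equation_iff_nonsingular.mp heq), Affine.Point.some_ne_zero _, rfl, ?_⟩
  rw [etaCoord_some]
  field_simp
  ring

theorem exists_xCoord_eq [V.IsElliptic] [IsAlgClosed L] (h2 : (2 : L) ≠ 0) (x : L) :
    ∃ P : V.toAffine.Point, P ≠ 0 ∧ xCoord P = x := by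
  obtain ⟨e, he⟩ := IsAlgClosed.exists_pow_nat_eq
    (4 * x ^ 3 + V.b₂ * x ^ 2 + 2 * V.b₄ * x + V.b₆) two_pos
  obtain ⟨P, h0, hx, -⟩ := exists_point_of_coords (V := V) h2 he
  exact ⟨P, h0, hx⟩

/-- A fibre holds at most the two points `±P`, and over `0` also the point at infinity, because of
its default value. This allows statements about almost all `x` to be pulled back to almost all
points. -/
theorem tendsto_xCoord : Filter.Tendsto (xCoord (V := V)) Filter.cofinite Filter.cofinite := by
  refine Filter.Tendsto.cofinite_of_finite_preimage_singleton fun x ↦ ?_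
  by_cases h : ∃ P : V.toAffine.Point, P ≠ 0 ∧ xCoord P = x
  · obtain ⟨P, hP, hx⟩ := h
    refine (Set.toFinite {0, P, -P}).subset fun Q hQ ↦ ?_
    by_cases hQ0 : Q = 0
    · exact Or.inl hQ0
    · exact Or.inr (eq_or_eq_neg_of_xCoord_eq hQ0 hP (hQ.trans hx.symm))
  · refine (Set.finite_singleton 0).subset fun Q hQ ↦ ?_
    by_contra hQ0
    exact h ⟨Q, hQ0, hQ⟩

variable [DecidableEq L]

/-- The chord and tangent formulas in the coordinates `x` and `2y + a₁x + a₃`. -/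
theorem exists_slope_add {P Q : V.toAffine.Point} (hP : P ≠ 0) (hQ : Q ≠ 0) (hPQ : P ≠ -Q) :
    P + Q ≠ 0 ∧ ∃ m : L, 4 * xCoord (P + Q) = m ^ 2 - V.b₂ - 4 * (xCoord P + xCoord Q) ∧
      etaCoord (P + Q) = -(etaCoord P + m * (xCoord (P + Q) - xCoord P)) ∧
      m * (xCoord P - xCoord Q) = etaCoord P - etaCoord Q ∧
      (P = Q → m * etaCoord P = 6 * xCoord P ^ 2 + V.b₂ * xCoord P + V.b₄) := by
  rcases P with _ | ⟨x₁, y₁, h₁⟩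
  · exact absurd rfl hP
  rcases Q with _ | ⟨x₂, y₂, h₂⟩
  · exact absurd rfl hQ
  have hxy : ¬(x₁ = x₂ ∧ y₁ = V.toAffine.negY x₂ y₂) := by
    rintro ⟨rfl, rfl⟩
    exact hPQ rfl
  rw [Affine.Point.add_some hxy]
  -- In the coordinates `(x, η)` a line `y = ℓ x + ν` has slope `2ℓ + a₁`.
  refine ⟨Affine.Point.some_ne_zero _, 2 * V.toAffine.slope x₁ x₂ y₁ y₂ + V.a₁, ?_, ?_, ?_, ?_⟩
  · simp only [xCoord_some, Affine.addX, b₂]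
    ring
  · simp only [etaCoord_some, xCoord_some, Affine.addX, Affine.addY, Affine.negAddY, Affine.negY]
    ring
  · simp only [etaCoord_some, xCoord_some]
    by_cases hx : x₁ = x₂
    · obtain rfl := hx
      have hy := Affine.Y_eq_of_Y_ne h₁.1 h₂.1 rfl (fun h ↦ hxy ⟨rfl, h⟩)
      rw [hy]
      ring
    · rw [Affine.slope_of_X_ne hx]
      have := sub_ne_zero.mpr hx
      field_simp
      ring
  · rintro h
    obtain ⟨rfl, rfl⟩ := (Affine.Point.some.injEq ..).mp h
    have hy : y₁ ≠ V.toAffine.negY x₁ y₁ := fun h ↦ hxy ⟨rfl, h⟩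
    rw [etaCoord_some, xCoord_some, Affine.slope_of_Y_ne rfl hy]
    have hne := sub_ne_zero.mpr hy
    have hη : y₁ - V.toAffine.negY x₁ y₁ = 2 * y₁ + V.a₁ * x₁ + V.a₃ := by
      rw [Affine.negY]
      ring
    rw [hη] at hne ⊢
    rw [b₂, b₄]
    linear_combination 2 * div_mul_cancel₀ (3 * x₁ ^ 2 + 2 * V.a₂ * x₁ + V.a₄ - V.a₁ * y₁) hne

/-- Negation fixes `x` and changes the sign of `η`. The default value `η = 0` at infinity makes `P =
0` no exception. -/
theorem two_nsmul_eq_zero_iff (h2 : (2 : L) ≠ 0) {P : V.toAffine.Point} :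
    2 • P = 0 ↔ etaCoord P = 0 := by
  rw [two_nsmul, ← eq_neg_iff_add_eq_zero]
  constructor
  · intro h
    have := congrArg etaCoord h
    rw [etaCoord_neg, eq_neg_iff_add_eq_zero, ← two_mul] at this
    exact (mul_eq_zero.mp this).resolve_left h2
  · intro h
    by_cases hP : P = 0
    · rw [hP, neg_zero]
    · exact eq_of_coords h2 hP (neg_ne_zero.mpr hP) (xCoord_neg P).symm
        (by rw [etaCoord_neg, h, neg_zero])

/-- The map `addSubMap` computes the `x`-coordinates of `P + Q` and `P - Q` from those of `P`
and `Q`. -/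
theorem exists_smul_symProd_xRep_add_sub [V.IsElliptic] (h2 : (2 : L) ≠ 0)
    (P Q : V.toAffine.Point) : ∃ c : L, c ≠ 0 ∧
      (fun i ↦ MvPolynomial.eval (Polynomial.symProd P.xRep Q.xRep) (V.addSubMap i)) =
        c • Polynomial.symProd (P + Q).xRep (P - Q).xRep := by
  have h4 : (4 : L) ≠ 0 := by
    rw [show (4 : L) = 2 * 2 by norm_num]
    exact mul_ne_zero h2 h2
  by_cases hP : P = 0
  · subst hP
    refine ⟨1, one_ne_zero, ?_⟩
    rw [zero_add, zero_sub, Affine.Point.xRep_neg, one_smul]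
    by_cases hQ : Q = 0
    · subst hQ
      ext i
      fin_cases i <;> simp [Polynomial.symProd, addSubMap]
    · rw [xRep_of_ne_zero hQ]
      ext i
      fin_cases i <;> simp [Polynomial.symProd, addSubMap] <;> ring
  by_cases hQ : Q = 0
  · subst hQ
    refine ⟨1, one_ne_zero, ?_⟩
    rw [add_zero, sub_zero, one_smul, xRep_of_ne_zero hP]
    ext i
    fin_cases i <;> simp [Polynomial.symProd, addSubMap] <;> ring
  -- The degenerate cases `P = ±Q` reduce to duplication; `![1, 0]` represents the point at
  -- infinity.
  have hdbl : ∀ P : V.toAffine.Point, P ≠ 0 → ∃ c : L, c ≠ 0 ∧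
      (fun i ↦ MvPolynomial.eval (Polynomial.symProd P.xRep P.xRep) (V.addSubMap i)) =
        c • Polynomial.symProd (P + P).xRep ![1, 0] := by
    intro P hP
    have hsq := etaCoord_sq hP
    have hb8 := V.b_relation
    by_cases h0 : P + P = 0
    · have hη := (two_nsmul_eq_zero_iff h2).mp ((two_nsmul P).trans h0)
      rw [hη] at hsq
      -- If `2P = 0`, the last two coordinates vanish, and the absence of common zeros makes the
      -- first one nonzero.
      have hne := addSubMap_ne_zero V (Polynomial.symProd_ne_zero P.xRep_ne_zero P.xRep_ne_zero)
      rw [h0, Affine.Point.xRep_zero]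
      refine ⟨MvPolynomial.eval (Polynomial.symProd P.xRep P.xRep) (V.addSubMap 0), ?_, ?_⟩
      · intro h
        refine hne (funext fun i ↦ ?_)
        fin_cases i
        · exact h
        · rw [xRep_of_ne_zero hP]
          simp [Polynomial.symProd, addSubMap]
          linear_combination -hsq
        · rw [xRep_of_ne_zero hP]
          simp [Polynomial.symProd, addSubMap]
          ring
      · rw [xRep_of_ne_zero hP]
        ext i
        fin_cases i
        · simp [Polynomial.symProd, addSubMap]
        · simp [Polynomial.symProd, addSubMap]
          linear_combination -hsq
        · simp [Polynomial.symProd, addSubMap]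
          ring
    · have hne : P ≠ -P := fun h ↦ h0 (eq_neg_iff_add_eq_zero.mp h)
      have hη : etaCoord P ≠ 0 := fun h ↦ h0 (by
        rw [← two_nsmul]
        exact (two_nsmul_eq_zero_iff h2).mpr h)
      obtain ⟨-, m, hX, -, -, hm⟩ := exists_slope_add hP hP hne
      have hm := hm rfl
      have hX' : 4 * (xCoord (P + P) * etaCoord P ^ 2) =
          (6 * xCoord P ^ 2 + V.b₂ * xCoord P + V.b₄) ^ 2 -
            (V.b₂ + 8 * xCoord P) * etaCoord P ^ 2 := by
        rw [← hm]
        linear_combination etaCoord P ^ 2 * hX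
      rw [hsq] at hX'
      refine ⟨etaCoord P ^ 2, pow_ne_zero 2 hη, ?_⟩
      rw [xRep_of_ne_zero hP, xRep_of_ne_zero h0, hsq]
      ext i
      fin_cases i
      · simp [Polynomial.symProd, addSubMap]
        refine mul_left_cancel₀ h4 ?_
        linear_combination -hX' - hb8
      · simp [Polynomial.symProd, addSubMap]
        ring
      · simp [Polynomial.symProd, addSubMap]
        ring
  by_cases h1 : P = Q
  · subst h1
    rw [sub_self]
    exact hdbl P hP
  by_cases h1' : P = -Q
  · subst h1'
    rw [neg_add_cancel, Affine.Point.xRep_neg, ← neg_add', Affine.Point.xRep_neg]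
    obtain ⟨c, hc, h⟩ := hdbl Q hQ
    refine ⟨c, hc, h.trans ?_⟩
    congr 1
    rw [Affine.Point.xRep_zero]
    ext i
    fin_cases i <;> simp [Polynomial.symProd]
  have hx : xCoord P - xCoord Q ≠ 0 := fun h ↦
    (eq_or_eq_neg_of_xCoord_eq hP hQ (sub_eq_zero.mp h)).elim h1 h1'
  obtain ⟨n1, m1, hX1, -, hm1, -⟩ := exists_slope_add hP hQ h1'
  obtain ⟨n2, m2, hX2, -, hm2, -⟩ := exists_slope_add hP (neg_ne_zero.mpr hQ)
    (by rwa [neg_neg])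
  rw [← sub_eq_add_neg] at n2 hX2
  rw [xCoord_neg] at hX2 hm2
  rw [etaCoord_neg] at hm2
  have hsP := etaCoord_sq hP
  have hsQ := etaCoord_sq hQ
  refine ⟨(xCoord P - xCoord Q) ^ 2, pow_ne_zero 2 hx, ?_⟩
  rw [xRep_of_ne_zero hP, xRep_of_ne_zero hQ, xRep_of_ne_zero n1, xRep_of_ne_zero n2]
  have hb8 := V.b_relation
  generalize xCoord (P + Q) = X1 at *
  generalize xCoord (P - Q) = X2 at *
  generalize xCoord P = x1 at *
  generalize xCoord Q = x2 at *
  generalize etaCoord P = e1 at *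
  generalize etaCoord Q = e2 at *
  -- The slopes `m1`, `m2` of the chords through `P, Q` and `P, -Q` enter symmetrically. The
  -- quantities `m1² + m2²` and `m1 m2` depend only on the `x`-coordinates once `e1²` and `e2²` are
  -- eliminated.
  have hs : (m1 ^ 2 + m2 ^ 2) * (x1 - x2) ^ 2 = 2 * e1 ^ 2 + 2 * e2 ^ 2 := by
    linear_combination (m1 * (x1 - x2) + (e1 - e2)) * hm1 + (m2 * (x1 - x2) + (e1 + e2)) * hm2
  have hp : (m1 * m2) * (x1 - x2) = 4 * (x1 ^ 2 + x1 * x2 + x2 ^ 2) + V.b₂ * (x1 + x2) +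
      2 * V.b₄ := by
    refine mul_right_cancel₀ hx ?_
    linear_combination m2 * (x1 - x2) * hm1 + (e1 - e2) * hm2 + hsP - hsQ
  ext i
  fin_cases i
  · simp [Polynomial.symProd, addSubMap]
    refine mul_left_cancel₀ (mul_ne_zero h4 h4) ?_
    linear_combination -(x1 - x2) ^ 2 * (4 * X2) * hX1 -
      (x1 - x2) ^ 2 * (m1 ^ 2 - V.b₂ - 4 * (x1 + x2)) * hX2 -
      (m1 * m2 * (x1 - x2) + 4 * (x1 ^ 2 + x1 * x2 + x2 ^ 2) + V.b₂ * (x1 + x2) + 2 * V.b₄) * hp +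
      (V.b₂ + 4 * (x1 + x2)) * (hs + 2 * hsP + 2 * hsQ) - 4 * hb8
  · simp [Polynomial.symProd, addSubMap]
    refine mul_left_cancel₀ h4 ?_
    linear_combination -(x1 - x2) ^ 2 * hX1 - (x1 - x2) ^ 2 * hX2 - hs - 2 * hsP - 2 * hsQ
  · simp [Polynomial.symProd, addSubMap]
    ring

end Coordinates

end WeierstrassCurve

/-! ### Endomorphisms as rational functions in `x` and `η` -/

namespace WeierstrassCurve

section RationalMaps

open Polynomial Filter

universe u

variable {K : Type u} [Field K] {L : Type*} [Field L] [Algebra K L] {W : WeierstrassCurve K}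

instance baseChange_isElliptic [W.IsElliptic] : (W⁄L).IsElliptic :=
  inferInstanceAs (W.map (algebraMap K L)).IsElliptic

theorem baseChange_a₁ : (W⁄L).a₁ = algebraMap K L W.a₁ := rfl

theorem baseChange_a₃ : (W⁄L).a₃ = algebraMap K L W.a₃ := rfl

theorem baseChange_b₂ : (W⁄L).b₂ = algebraMap K L W.b₂ := W.map_b₂ (algebraMap K L)

theorem baseChange_b₄ : (W⁄L).b₄ = algebraMap K L W.b₄ := W.map_b₄ (algebraMap K L)

theorem baseChange_b₆ : (W⁄L).b₆ = algebraMap K L W.b₆ := W.map_b₆ (algebraMap K L)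

theorem baseChange_b₈ : (W⁄L).b₈ = algebraMap K L W.b₈ := W.map_b₈ (algebraMap K L)

theorem aeval_Ψ₂Sq (x : L) : aeval x W.Ψ₂Sq =
    4 * x ^ 3 + (W⁄L).b₂ * x ^ 2 + 2 * (W⁄L).b₄ * x + (W⁄L).b₆ := by
  simp only [Ψ₂Sq, baseChange_b₂, baseChange_b₄, baseChange_b₆, map_add, map_mul, map_pow, aeval_C,
    aeval_X, map_ofNat]

theorem etaCoord_sq_eq_aeval {P : (W⁄L).toAffine.Point} (h : P ≠ 0) :
    etaCoord P ^ 2 = aeval (xCoord P) W.Ψ₂Sq := by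
  rw [etaCoord_sq h, aeval_Ψ₂Sq]

theorem Ψ₂Sq_ne_zero_of_isElliptic [W.IsElliptic] (h2 : (2 : K) ≠ 0) : W.Ψ₂Sq ≠ 0 := by
  refine W.Ψ₂Sq_ne_zero ?_
  rw [show (4 : K) = 2 * 2 by norm_num]
  exact mul_ne_zero h2 h2

theorem eventually_ne_zero : ∀ᶠ P : (W⁄L).toAffine.Point in cofinite, P ≠ 0 :=
  (Set.finite_singleton 0).eventually_cofinite_notMem

theorem eventually_aeval_ne_zero {f : K[X]} (hf : f ≠ 0) :
    ∀ᶠ P : (W⁄L).toAffine.Point in cofinite, aeval (xCoord P) f ≠ 0 := by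
  refine tendsto_xCoord.eventually (p := fun x ↦ aeval x f ≠ 0) ?_
  have h := finite_setOfPred_isRoot ((Polynomial.map_ne_zero_iff (algebraMap K L).injective).mpr hf)
  filter_upwards [h.eventually_cofinite_notMem] with x hx h0
  apply hx
  rwa [IsRoot.def, eval_map_algebraMap]

theorem eventually_neg {p : (W⁄L).toAffine.Point → Prop} (h : ∀ᶠ P in cofinite, p P) :
    ∀ᶠ P in cofinite, p (-P) :=
  neg_injective.tendsto_cofinite.eventually h

theorem two_ne_zero_of_algebra (h2 : (2 : K) ≠ 0) : (2 : L) ≠ 0 := by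
  intro h
  refine h2 ((algebraMap K L).injective ?_)
  rw [map_ofNat, h, map_zero]

variable [IsAlgClosed L] [W.IsElliptic] (h2 : (2 : K) ≠ 0)
include h2

theorem infinite_point (W : WeierstrassCurve K) [W.IsElliptic] :
    Infinite (W⁄L).toAffine.Point := by
  choose s hs hs' using exists_xCoord_eq (V := W⁄L) (two_ne_zero_of_algebra h2)
  have := IsAlgClosed.instInfinite (K := L)
  exact Infinite.of_injective s (Function.LeftInverse.injective hs')

/-- The identity principle by which polynomial identities are verified at generic points: the curve
is infinite and `x` has finite fibres. -/
theorem eq_zero_of_eventually_aeval_eq_zero {f : K[X]}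
    (h : ∀ᶠ P : (W⁄L).toAffine.Point in cofinite, aeval (xCoord P) f = 0) : f = 0 := by
  by_contra hf
  have := infinite_point (L := L) h2 W
  obtain ⟨P, h1, h2⟩ := (h.and (eventually_aeval_ne_zero hf)).exists
  exact h2 h1

omit [IsAlgClosed L] [W.IsElliptic] in
/-- Normal form of polynomials on the curve. -/
theorem exists_normalForm (F : MvPolynomial (Fin 3) K) : ∃ A B : K[X],
    ∀ P : (W⁄L).toAffine.Point, P ≠ 0 → MvPolynomial.aeval (homCoords P) F =
      aeval (xCoord P) A + etaCoord P * aeval (xCoord P) B := by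
  have h2' := two_ne_zero_of_algebra (L := L) h2
  have hmul : ∀ (F G : MvPolynomial (Fin 3) K),
      (∃ A B : K[X], ∀ P : (W⁄L).toAffine.Point, P ≠ 0 → MvPolynomial.aeval (homCoords P) F =
        aeval (xCoord P) A + etaCoord P * aeval (xCoord P) B) →
      (∃ A B : K[X], ∀ P : (W⁄L).toAffine.Point, P ≠ 0 → MvPolynomial.aeval (homCoords P) G =
        aeval (xCoord P) A + etaCoord P * aeval (xCoord P) B) →
      ∃ A B : K[X], ∀ P : (W⁄L).toAffine.Point, P ≠ 0 → MvPolynomial.aeval (homCoords P) (F * G) =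
        aeval (xCoord P) A + etaCoord P * aeval (xCoord P) B := by
    rintro F G ⟨A, B, h⟩ ⟨A', B', h'⟩
    refine ⟨A * A' + W.Ψ₂Sq * B * B', A * B' + B * A', fun P hP ↦ ?_⟩
    rw [map_mul, h P hP, h' P hP]
    simp only [map_add, map_mul, ← etaCoord_sq_eq_aeval hP]
    ring
  induction F using MvPolynomial.induction_on with
  | C a => exact ⟨C a, 0, fun P _ ↦ by simp⟩
  | add F G hF hG =>
    obtain ⟨A, B, h⟩ := hF
    obtain ⟨A', B', h'⟩ := hG
    refine ⟨A + A', B + B', fun P hP ↦ ?_⟩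
    rw [map_add, h P hP, h' P hP, map_add, map_add]
    ring
  | mul_X F i hF =>
    refine hmul F _ hF ?_
    fin_cases i
    · refine ⟨X, 0, fun P hP ↦ ?_⟩
      rcases P with _ | ⟨x, y, h⟩
      · exact absurd rfl hP
      · simp [homCoords, xCoord]
    · refine ⟨-C (2⁻¹) * (C W.a₁ * X + C W.a₃), C (2⁻¹), fun P hP ↦ ?_⟩
      rcases P with _ | ⟨x, y, h⟩
      · exact absurd rfl hP
      · have hinv : algebraMap K L 2⁻¹ * 2 = 1 := by
          rw [← map_ofNat (algebraMap K L) 2, ← map_mul, inv_mul_cancel₀ h2, map_one]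
        simp only [homCoords, xCoord, etaCoord, baseChange_a₁, baseChange_a₃, Fin.mk_one,
          MvPolynomial.aeval_X, Matrix.cons_val_one, Matrix.cons_val_zero, map_neg, map_mul, map_add,
          aeval_C, aeval_X]
        linear_combination (-y) * hinv
    · refine ⟨1, 0, fun P hP ↦ ?_⟩
      rcases P with _ | ⟨x, y, h⟩
      · exact absurd rfl hP
      · simp [homCoords]

variable [DecidableEq L]

/-- A nonzero endomorphism has finite fibres. -/
theorem tendsto_of_mem_endRing {φ : AddMonoid.End (W⁄L).toAffine.Point} (hφ : φ ∈ endRing L W)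
    (h0 : φ ≠ 0) : Tendsto φ cofinite cofinite := by
  have := infinite_point (L := L) h2 W
  refine Tendsto.cofinite_of_finite_preimage_singleton fun P ↦ ?_
  by_contra hinf
  exact h0 (addMonoidHom_eq_zero φ P (finite_ne_const hφ P hinf))

omit [IsAlgClosed L] [W.IsElliptic] [DecidableEq L] h2 in
theorem homCoords_of_ne_zero (P : (W⁄L).toAffine.Point) (hP : P ≠ 0) :
    homCoords P 0 = xCoord P ∧ 2 * homCoords P 1 + (W⁄L).a₁ * homCoords P 0 + (W⁄L).a₃ = etaCoord P ∧
      homCoords P 2 = 1 := by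
  rcases P with _ | ⟨x, y, h⟩
  · exact absurd rfl hP
  · exact ⟨rfl, rfl, rfl⟩

/-- The coordinates of a nonzero endomorphism: `x ∘ φ` and `η ∘ φ / η` are rational functions
of `x`. -/
theorem exists_coords_of_mem_endRing {φ : AddMonoid.End (W⁄L).toAffine.Point}
    (hφ : φ ∈ endRing L W) (h0 : φ ≠ 0) : ∃ a b c d : K[X], b ≠ 0 ∧ d ≠ 0 ∧
      ∀ᶠ P in cofinite, xCoord (φ P) * aeval (xCoord P) b = aeval (xCoord P) a ∧
        etaCoord (φ P) * aeval (xCoord P) d = etaCoord P * aeval (xCoord P) c := by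
  have htend := tendsto_of_mem_endRing h2 hφ h0
  obtain ⟨n, F, -, hF⟩ := hφ
  obtain ⟨A0, B0, hAB0⟩ := exists_normalForm (W := W) (L := L) h2 (F 0)
  obtain ⟨A1, B1, hAB1⟩ := exists_normalForm (W := W) (L := L) h2
    (2 * F 1 + MvPolynomial.C W.a₁ * F 0 + MvPolynomial.C W.a₃ * F 2)
  obtain ⟨A2, B2, hAB2⟩ := exists_normalForm (W := W) (L := L) h2 (F 2)
  have hev : ∀ᶠ P in cofinite, P ≠ 0 ∧ φ P ≠ 0 ∧ ∃ c : L, c ≠ 0 ∧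
      aeval (xCoord P) A0 + etaCoord P * aeval (xCoord P) B0 = c * xCoord (φ P) ∧
      aeval (xCoord P) A1 + etaCoord P * aeval (xCoord P) B1 = c * etaCoord (φ P) ∧
      aeval (xCoord P) A2 + etaCoord P * aeval (xCoord P) B2 = c := by
    have hF' : ∀ᶠ P in cofinite, ∃ c : L, c ≠ 0 ∧
      (fun i ↦ MvPolynomial.aeval (homCoords P) (F i)) = c • homCoords (φ P) := hF
    filter_upwards [hF', eventually_ne_zero,
      htend.eventually eventually_ne_zero] with P h hP hφP
    obtain ⟨c, hc, h⟩ := h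
    obtain ⟨e0, e1, e2⟩ := homCoords_of_ne_zero _ hφP
    have k0 := congrFun h 0
    have k1 := congrFun h 1
    have k2 := congrFun h 2
    simp only [Pi.smul_apply, smul_eq_mul] at k0 k1 k2
    refine ⟨hP, hφP, c, hc, ?_, ?_, ?_⟩
    · rw [← hAB0 P hP, k0, e0]
    · rw [← hAB1 P hP, ← e1]
      simp only [map_add, map_mul, map_ofNat, MvPolynomial.algHom_C, k0, k1, k2, e2]
      rw [baseChange_a₁, baseChange_a₃]
      ring
    · rw [← hAB2 P hP, k2, e2, mul_one]
  have h2' := two_ne_zero_of_algebra (L := L) h2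
  have hη : ∀ᶠ P : (W⁄L).toAffine.Point in cofinite, etaCoord P ≠ 0 := by
    filter_upwards [eventually_aeval_ne_zero (Ψ₂Sq_ne_zero_of_isElliptic h2 (W := W)),
      eventually_ne_zero] with P h hP h0
    rw [← etaCoord_sq_eq_aeval hP, h0] at h
    exact h (zero_pow two_ne_zero)
  -- Since `φ (-P) = -φ P`, comparing the normal forms at `P` and `-P` separates the parts that are
  -- even and odd in `η`.
  have hmain : ∀ᶠ P in cofinite, xCoord (φ P) * aeval (xCoord P) A2 = aeval (xCoord P) A0 ∧
      xCoord (φ P) * aeval (xCoord P) B2 = aeval (xCoord P) B0 ∧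
      etaCoord (φ P) * aeval (xCoord P) A2 = etaCoord P * aeval (xCoord P) B1 ∧
      etaCoord (φ P) * aeval (xCoord P) (W.Ψ₂Sq * B2) = etaCoord P * aeval (xCoord P) A1 := by
    filter_upwards [hev, eventually_neg hev, hη] with P h h' hη
    obtain ⟨hP, hφP, c, hc, e0, e1, e2⟩ := h
    obtain ⟨hP', hφP', c', hc', e0', e1', e2'⟩ := h'
    rw [map_neg, xCoord_neg, xCoord_neg, etaCoord_neg] at *
    rw [etaCoord_neg] at e1'
    have hsq := etaCoord_sq_eq_aeval hP
    subst e2 e2'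
    refine ⟨mul_left_cancel₀ h2' ?_, mul_left_cancel₀ (mul_ne_zero h2' hη) ?_,
      mul_left_cancel₀ h2' ?_, mul_left_cancel₀ h2' ?_⟩
    · linear_combination -e0 - e0'
    · linear_combination -e0 + e0'
    · linear_combination -e1 + e1'
    · rw [map_mul, ← hsq]
      linear_combination -etaCoord P * e1 - etaCoord P * e1'
  -- The denominator `A2 + η B2` is not identically zero; either nonzero part can serve as the
  -- denominator.
  by_cases hA2 : A2 = 0
  · by_cases hB2 : B2 = 0
    · have := infinite_point (L := L) h2 W
      obtain ⟨P, -, -, c, hc, -, -, h⟩ := hev.exists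
      exact absurd (by simpa [hA2, hB2] using h.symm) hc
    · refine ⟨B0, B2, A1, W.Ψ₂Sq * B2, hB2, mul_ne_zero (Ψ₂Sq_ne_zero_of_isElliptic h2) hB2, ?_⟩
      filter_upwards [hmain] with P h
      exact ⟨h.2.1, h.2.2.2⟩
  · refine ⟨A0, A2, B1, A2, hA2, hA2, ?_⟩
    filter_upwards [hmain] with P h
    exact ⟨h.1, h.2.2.1⟩

omit [IsAlgClosed L] [W.IsElliptic] [DecidableEq L] in
/-- A map with coordinates of this shape is given by a rational map. -/
theorem isRationalOver_of_coords {φ : (W⁄L).toAffine.Point → (W⁄L).toAffine.Point}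
    {a b c d : K[X]} (hb : b ≠ 0) (hd : d ≠ 0)
    (h : ∀ᶠ P in cofinite, φ P ≠ 0 ∧ xCoord (φ P) * aeval (xCoord P) b = aeval (xCoord P) a ∧
      etaCoord (φ P) * aeval (xCoord P) d = etaCoord P * aeval (xCoord P) c) :
    IsRationalOver L W φ := by
  have h2' := two_ne_zero_of_algebra (L := L) h2
  let u : K[X] →ₐ[K] MvPolynomial (Fin 3) K := aeval (MvPolynomial.X 0)
  have hu : ∀ (f : K[X]) (P : (W⁄L).toAffine.Point), P ≠ 0 →
      MvPolynomial.aeval (homCoords P) (u f) = aeval (xCoord P) f := by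
    intro f P hP
    rw [← (homCoords_of_ne_zero P hP).1]
    change MvPolynomial.aeval (homCoords P) (aeval (MvPolynomial.X 0) f) = _
    rw [← Polynomial.aeval_algHom_apply, MvPolynomial.aeval_X]
  let e : MvPolynomial (Fin 3) K :=
    2 * MvPolynomial.X 1 + MvPolynomial.C W.a₁ * MvPolynomial.X 0 + MvPolynomial.C W.a₃
  have he : ∀ P : (W⁄L).toAffine.Point, P ≠ 0 →
      MvPolynomial.aeval (homCoords P) e = etaCoord P := by
    intro P hP
    rw [← (homCoords_of_ne_zero P hP).2.1, baseChange_a₁, baseChange_a₃]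
    simp [e]
  -- These are `(x, y, 1)` multiplied by `2bd`, with `y` recovered from `2y = η - a₁x - a₃`.
  refine IsRationalOver.of_polynomials ![2 * u (a * d),
    e * u (c * b) - MvPolynomial.C W.a₁ * u (a * d) - MvPolynomial.C W.a₃ * u (b * d),
    2 * u (b * d)] ?_
  change ∀ᶠ P in cofinite, _
  filter_upwards [h, eventually_ne_zero, eventually_aeval_ne_zero hb, eventually_aeval_ne_zero hd]
    with P h hP hbP hdP
  obtain ⟨h0, hx, hη⟩ := h
  obtain ⟨e0, e1, e2⟩ := homCoords_of_ne_zero _ h0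
  refine ⟨2 * (aeval (xCoord P) b * aeval (xCoord P) d),
    mul_ne_zero h2' (mul_ne_zero hbP hdP), ?_⟩
  rw [baseChange_a₁, baseChange_a₃] at e1
  ext i
  fin_cases i
  · simp [hu _ P hP, e0]
    linear_combination (-2 * aeval (xCoord P) d) * hx
  · simp [hu _ P hP, he P hP]
    rw [e0] at e1
    linear_combination (-aeval (xCoord P) b) * hη +
      (aeval (xCoord P) d * algebraMap K L W.a₁) * hx -
      (aeval (xCoord P) b * aeval (xCoord P) d) * e1
  · simp [hu _ P hP, e2]

end RationalMaps

end WeierstrassCurve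

/-! ### The degree of an endomorphism as a positive definite form -/

namespace WeierstrassCurve

section Degree

open Polynomial Filter

universe u

theorem aeval_smul_of_isHomogeneous {σ K L : Type*} [Fintype σ] [Field K] [Field L] [Algebra K L]
    {n : ℕ} {f : MvPolynomial σ K} (hf : f.IsHomogeneous n) (c : L) (v : σ → L) :
    MvPolynomial.aeval (c • v) f = c ^ n * MvPolynomial.aeval v f := by
  rw [MvPolynomial.aeval_def, MvPolynomial.aeval_def, MvPolynomial.eval₂_eq',
    MvPolynomial.eval₂_eq', Finset.mul_sum]
  refine Finset.sum_congr rfl fun d hd ↦ ?_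
  have hdeg : ∑ i, d i = n := by
    rw [← Finsupp.degree_eq_sum]
    by_contra hne
    exact (MvPolynomial.mem_support_iff.mp hd) (hf.coeff_eq_zero hne)
  simp only [Pi.smul_apply, smul_eq_mul, mul_pow, Finset.prod_mul_distrib,
    Finset.prod_pow_eq_pow_sum, hdeg]
  ring

variable {K : Type u} [Field K] {L : Type*} [Field L] [Algebra K L] {W : WeierstrassCurve K}

theorem aeval_addSubMap (x : Fin 3 → L) (i : Fin 3) :
    MvPolynomial.aeval x (W.addSubMap i) = MvPolynomial.eval x ((W⁄L).addSubMap i) := by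
  have h : ∀ r : K, MvPolynomial.aeval x (MvPolynomial.C (σ := Fin 3) r) = algebraMap K L r :=
    fun r ↦ MvPolynomial.algHom_C _ r
  fin_cases i <;> simp [addSubMap, h, baseChange_b₂, baseChange_b₄, baseChange_b₆, baseChange_b₈]
  · exact Or.inl (Or.inl (map_ofNat _ 2))
  · exact Or.inl (Or.inl (map_ofNat _ 4))

/-- The polynomial vector `v` describes the effect of `φ` on `x`-coordinates. -/
def IsXMap (φ : (W⁄L).toAffine.Point → (W⁄L).toAffine.Point) (v : Fin 2 → K[X]) : Prop :=
  ∀ᶠ P in cofinite, ∃ c : L, c ≠ 0 ∧ (fun i ↦ aeval (xCoord P) (v i)) = c • (φ P).xRep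

open scoped Classical in
/-- The degree of a map that acts on `x`-coordinates by a rational function. -/
noncomputable def xDegree (φ : (W⁄L).toAffine.Point → (W⁄L).toAffine.Point) : ℕ :=
  if h : ∃ v : Fin 2 → K[X], IsPrimitiveVec v ∧ IsXMap φ v then vecDegree h.choose else 0

variable [IsAlgClosed L] [W.IsElliptic] (h2 : (2 : K) ≠ 0)
include h2

/-- Independence of the chosen vector: two primitive vectors for the same map are proportional at
generic points, hence as polynomials. -/
theorem xDegree_eq {φ : (W⁄L).toAffine.Point → (W⁄L).toAffine.Point} {v : Fin 2 → K[X]}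
    (hv : IsPrimitiveVec v) (h : IsXMap φ v) : xDegree φ = vecDegree v := by
  have hex : ∃ v : Fin 2 → K[X], IsPrimitiveVec v ∧ IsXMap φ v := ⟨v, hv, h⟩
  rw [xDegree, dif_pos hex]
  refine hex.choose_spec.1.vecDegree_eq_of_mul_eq_mul hv fun i j ↦ sub_eq_zero.mp ?_
  refine eq_zero_of_eventually_aeval_eq_zero (W := W) (L := L) h2 ?_
  filter_upwards [h, hex.choose_spec.2] with P h1 h3
  obtain ⟨c, -, h1⟩ := h1
  obtain ⟨d, -, h3⟩ := h3
  have e1 := fun i ↦ congrFun h1 i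
  have e3 := fun i ↦ congrFun h3 i
  simp only [Pi.smul_apply, smul_eq_mul] at e1 e3
  rw [map_sub, map_mul, map_mul, e1, e1, e3, e3]
  ring

omit [IsAlgClosed L] [W.IsElliptic] h2 in
theorem isXMap_of_coords {φ : (W⁄L).toAffine.Point → (W⁄L).toAffine.Point} {a b : K[X]} (hb : b ≠ 0)
    (h : ∀ᶠ P in cofinite, φ P ≠ 0 ∧ xCoord (φ P) * aeval (xCoord P) b = aeval (xCoord P) a) :
    IsXMap φ ![a, b] := by
  filter_upwards [h, eventually_aeval_ne_zero hb] with P h hbP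
  refine ⟨aeval (xCoord P) b, hbP, ?_⟩
  rw [xRep_of_ne_zero h.1]
  ext i
  fin_cases i
  · simp [← h.2, mul_comm]
  · simp

variable [DecidableEq L]

/-- The coordinates of a nonzero endomorphism, with a reduced fraction for the `x`-coordinate. -/
theorem exists_coprime_coords {φ : AddMonoid.End (W⁄L).toAffine.Point}
    (hφ : φ ∈ endRing L W) (h0 : φ ≠ 0) : ∃ a b c d : K[X], IsCoprime a b ∧ b ≠ 0 ∧ d ≠ 0 ∧
      ∀ᶠ P in cofinite, φ P ≠ 0 ∧ xCoord (φ P) * aeval (xCoord P) b = aeval (xCoord P) a ∧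
        etaCoord (φ P) * aeval (xCoord P) d = etaCoord P * aeval (xCoord P) c := by
  obtain ⟨a, b, c, d, hb, hd, h⟩ := exists_coords_of_mem_endRing h2 hφ h0
  let : GCDMonoid K[X] := UniqueFactorizationMonoid.toGCDMonoid _
  have hcop := isCoprime_div_gcd_div_gcd (p := a) hb
  obtain ⟨a', ha'⟩ := GCDMonoid.gcd_dvd_left a b
  obtain ⟨b', hb'⟩ := GCDMonoid.gcd_dvd_right a b
  set g := GCDMonoid.gcd a b with hg
  have hg0 : g ≠ 0 := by
    rintro h0
    rw [h0, zero_mul] at hb'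
    exact hb hb'
  have hb0 : b' ≠ 0 := by
    rintro rfl
    rw [mul_zero] at hb'
    exact hb hb'
  rw [ha', hb', mul_div_cancel_left₀ _ hg0,
    mul_div_cancel_left₀ _ hg0] at hcop
  refine ⟨a', b', c, d, hcop, hb0, hd, ?_⟩
  filter_upwards [h, eventually_aeval_ne_zero hg0,
    (tendsto_of_mem_endRing h2 hφ h0).eventually eventually_ne_zero] with P hP hgP hφP
  refine ⟨hφP, mul_left_cancel₀ hgP ?_, hP.2⟩
  rw [← map_mul, ← ha', ← hP.1, hb', map_mul]
  ring

theorem exists_isXMap {φ : AddMonoid.End (W⁄L).toAffine.Point} (hφ : φ ∈ endRing L W) :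
    ∃ v : Fin 2 → K[X], IsPrimitiveVec v ∧ IsXMap φ v := by
  by_cases h0 : φ = 0
  · subst h0
    refine ⟨![1, 0], isPrimitiveVec_pair_iff.mpr isCoprime_one_left, Eventually.of_forall fun P ↦ ?_⟩
    refine ⟨1, one_ne_zero, ?_⟩
    ext i
    rw [one_smul, show (0 : AddMonoid.End (W⁄L).toAffine.Point) P = 0 from rfl]
    fin_cases i <;> simp
  · obtain ⟨a, b, c, d, hab, hb, -, h⟩ := exists_coprime_coords h2 hφ h0
    exact ⟨![a, b], isPrimitiveVec_pair_iff.mpr hab,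
      isXMap_of_coords hb (h.mono fun P hP ↦ ⟨hP.1, hP.2.1⟩)⟩

/-- The vectors `symProd s t` and `addSubMap` applied to `symProd v w` both describe the unordered
pair of `x`-coordinates of `φ P ± ψ P`. Both are primitive, the second because the quadratic forms
in `addSubMap` have no common zero, so their degrees `deg s + deg t` and `2 (deg v + deg w)` agree.
-/
theorem xDegree_add_add_xDegree_sub {φ ψ : AddMonoid.End (W⁄L).toAffine.Point}
    (hφ : φ ∈ endRing L W) (hψ : ψ ∈ endRing L W) :
    xDegree ⇑(φ + ψ) + xDegree ⇑(φ - ψ) = 2 * xDegree φ + 2 * xDegree ψ := by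
  have h2' := two_ne_zero_of_algebra (L := L) h2
  obtain ⟨v, hv, hv'⟩ := exists_isXMap h2 hφ
  obtain ⟨w, hw, hw'⟩ := exists_isXMap h2 hψ
  obtain ⟨s, hs, hs'⟩ := exists_isXMap h2 (add_mem hφ hψ)
  obtain ⟨t, ht, ht'⟩ := exists_isXMap h2 (sub_mem hφ hψ)
  rw [xDegree_eq h2 hv hv', xDegree_eq h2 hw hw', xDegree_eq h2 hs hs', xDegree_eq h2 ht ht',
    ← mul_add, ← (hv.symProd hw).2, ← (hs.symProd ht).2]
  have hF := (hv.symProd hw).1.aeval (F := W.addSubMap) W.isHomogeneous_addSubMap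
    fun k _ _ x hx ↦ by
      obtain ⟨i, hi⟩ := Function.ne_iff.mp (addSubMap_ne_zero (W⁄k) hx)
      exact ⟨i, by rwa [aeval_addSubMap]⟩
  rw [← hF.2]
  refine ((hs.symProd ht).1).vecDegree_eq_of_mul_eq_mul hF.1 fun i j ↦ sub_eq_zero.mp ?_
  refine eq_zero_of_eventually_aeval_eq_zero (W := W) (L := L) h2 ?_
  filter_upwards [hv', hw', hs', ht'] with P e1 e2 e3 e4
  obtain ⟨c1, -, e1⟩ := e1
  obtain ⟨c2, -, e2⟩ := e2
  obtain ⟨c3, -, e3⟩ := e3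
  obtain ⟨c4, -, e4⟩ := e4
  have hsym : ∀ v w : Fin 2 → K[X], (fun i ↦ aeval (xCoord P) (symProd v w i)) =
      symProd (fun i ↦ aeval (xCoord P) (v i)) (fun i ↦ aeval (xCoord P) (w i)) := by
    intro v w
    ext i
    fin_cases i <;> simp [symProd]
  have hsmul : ∀ (c d : L) (v w : Fin 2 → L), symProd (c • v) (d • w) = (c * d) • symProd v w := by
    intro c d v w
    ext i
    fin_cases i <;> simp [symProd] <;> ring
  have k1 : (fun i ↦ aeval (xCoord P) (symProd s t i)) =
      (c3 * c4) • symProd (φ P + ψ P).xRep (φ P - ψ P).xRep := by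
    rw [hsym, e3, e4, hsmul]
    rfl
  obtain ⟨c, -, hc⟩ := exists_smul_symProd_xRep_add_sub (V := W⁄L) h2' (φ P) (ψ P)
  have k2 : (fun i ↦ aeval (xCoord P) (MvPolynomial.aeval (symProd v w) (W.addSubMap i))) =
      ((c1 * c2) ^ 2 * c) • symProd (φ P + ψ P).xRep (φ P - ψ P).xRep := by
    rw [mul_smul, ← hc]
    ext i
    have : aeval (xCoord P) (MvPolynomial.aeval (symProd v w) (W.addSubMap i)) =
        MvPolynomial.aeval (fun i ↦ aeval (xCoord P) (symProd v w i)) (W.addSubMap i) := by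
      rw [← MvPolynomial.comp_aeval]
      rfl
    rw [this, hsym, e1, e2, hsmul, aeval_smul_of_isHomogeneous (W.isHomogeneous_addSubMap i),
      aeval_addSubMap]
    rfl
  have l1 := fun i ↦ congrFun k1 i
  have l2 := fun i ↦ congrFun k2 i
  simp only [Pi.smul_apply, smul_eq_mul] at l1 l2
  rw [map_sub, map_mul, map_mul, l1, l1, l2, l2]
  ring

theorem xDegree_zero : xDegree ⇑(0 : AddMonoid.End (W⁄L).toAffine.Point) = 0 := by
  rw [xDegree_eq (v := ![1, 0]) h2 (isPrimitiveVec_pair_iff.mpr isCoprime_one_left)]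
  · simp [vecDegree]
  · refine Eventually.of_forall fun P ↦ ⟨1, one_ne_zero, ?_⟩
    ext i
    rw [one_smul, show (0 : AddMonoid.End (W⁄L).toAffine.Point) P = 0 from rfl]
    fin_cases i <;> simp

theorem xDegree_one : xDegree ⇑(1 : AddMonoid.End (W⁄L).toAffine.Point) = 1 := by
  rw [xDegree_eq (v := ![X, 1]) h2 (isPrimitiveVec_pair_iff.mpr isCoprime_one_right)]
  · simp [vecDegree, Finset.univ_fin2]
  · exact isXMap_of_coords one_ne_zero (eventually_ne_zero.mono fun P hP ↦ ⟨hP, by simp⟩)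

/-- Composition substitutes one primitive vector into the homogenisation of the other, which
multiplies degrees. Generic points must map to generic points, so `ψ = 0` is treated apart. -/
theorem xDegree_mul {φ ψ : AddMonoid.End (W⁄L).toAffine.Point} (hφ : φ ∈ endRing L W)
    (hψ : ψ ∈ endRing L W) : xDegree ⇑(φ * ψ) = xDegree φ * xDegree ψ := by
  by_cases h0 : ψ = 0
  · subst h0
    rw [mul_zero, xDegree_zero h2, mul_zero]
  obtain ⟨v, hv, hv'⟩ := exists_isXMap h2 hφ
  obtain ⟨w, hw, hw'⟩ := exists_isXMap h2 hψ
  have hF := hw.aeval (F := fun i ↦ (v i).homogenize (vecDegree v))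
    (fun i ↦ isHomogeneous_homogenize _) fun k _ _ x hx ↦ exists_aeval_homogenize_ne_zero hv hx
  rw [xDegree_eq h2 hv hv', xDegree_eq h2 hw hw', ← hF.2]
  refine xDegree_eq h2 hF.1 ?_
  have htend := tendsto_of_mem_endRing h2 hψ h0
  filter_upwards [hw', htend.eventually hv', htend.eventually eventually_ne_zero]
    with P e1 e2 hP
  obtain ⟨c, hc, e1⟩ := e1
  obtain ⟨d, hd, e2⟩ := e2
  refine ⟨c ^ vecDegree v * d, mul_ne_zero (pow_ne_zero _ hc) hd, ?_⟩
  ext i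
  have : aeval (xCoord P) (MvPolynomial.aeval w ((v i).homogenize (vecDegree v))) =
      MvPolynomial.aeval (fun i ↦ aeval (xCoord P) (w i)) ((v i).homogenize (vecDegree v)) := by
    rw [← MvPolynomial.comp_aeval]
    rfl
  rw [this, e1, aeval_smul_of_isHomogeneous (isHomogeneous_homogenize _), xRep_of_ne_zero hP,
    aeval_homogenize_of_eq_one (natDegree_le_vecDegree v i) _ rfl]
  have := congrFun e2 i
  simp only [Matrix.cons_val_zero, Pi.smul_apply, smul_eq_mul] at this ⊢
  rw [this, mul_assoc]
  rfl

/-- Degree `0` would make `x ∘ φ` constant at generic points, whereas a nonzero endomorphism has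
finite fibres. -/
theorem eq_zero_of_xDegree_eq_zero {φ : AddMonoid.End (W⁄L).toAffine.Point}
    (hφ : φ ∈ endRing L W) (h : xDegree φ = 0) : φ = 0 := by
  by_contra h0
  obtain ⟨a, b, c, d, hab, hb, -, hev⟩ := exists_coprime_coords h2 hφ h0
  rw [xDegree_eq h2 (isPrimitiveVec_pair_iff.mpr hab)
    (isXMap_of_coords hb (hev.mono fun P hP ↦ ⟨hP.1, hP.2.1⟩))] at h
  have ha' := natDegree_le_vecDegree ![a, b] 0
  have hb' := natDegree_le_vecDegree ![a, b] 1
  rw [h, Nat.le_zero] at ha' hb'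
  obtain ⟨a, rfl⟩ := natDegree_eq_zero.mp ha'
  obtain ⟨b, rfl⟩ := natDegree_eq_zero.mp hb'
  have hb0 : algebraMap K L b ≠ 0 := by
    rw [Ne, map_eq_zero]
    rintro rfl
    exact hb C_0
  have := infinite_point (L := L) h2 W
  have htend := tendsto_xCoord.comp (tendsto_of_mem_endRing h2 hφ h0)
  have hne := htend.eventually
    (Set.finite_singleton (algebraMap K L a / algebraMap K L b)).eventually_cofinite_notMem
  obtain ⟨P, h1, h3⟩ := (hev.and hne).exists
  refine h3 ?_
  have := h1.2.1
  rw [aeval_C, aeval_C] at this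
  exact (eq_div_iff hb0).mpr this

theorem isDegreeForm_xDegree :
    IsDegreeForm (fun φ : endRing L W ↦ (xDegree (φ : AddMonoid.End (W⁄L).toAffine.Point) : ℤ)) where
  parallelogram φ ψ := by exact_mod_cast xDegree_add_add_xDegree_sub h2 φ.2 ψ.2
  map_mul φ ψ := by exact_mod_cast xDegree_mul h2 φ.2 ψ.2
  map_one := by exact_mod_cast xDegree_one h2
  nonneg φ := Int.natCast_nonneg _
  eq_zero φ h := Subtype.ext (eq_zero_of_xDegree_eq_zero h2 φ.2 (by exact_mod_cast h))

end Degree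

end WeierstrassCurve

/-! ### The Frobenius endomorphism and inseparability -/

namespace WeierstrassCurve

section Frobenius

open Polynomial Filter

variable {p : ℕ} [Fact p.Prime] {L : Type*} [Field L] [Algebra (ZMod p) L] [DecidableEq L]
  {W : WeierstrassCurve (ZMod p)}

variable (L W) in
/-- The Frobenius endomorphism of an elliptic curve over the prime field. -/
noncomputable def frobeniusEnd : AddMonoid.End (W⁄L).toAffine.Point :=
  Affine.Point.map (W' := W.toAffine) (FiniteField.frobeniusAlgHom (ZMod p) L)

theorem frobeniusEnd_eq_zero_iff {P : (W⁄L).toAffine.Point} : frobeniusEnd L W P = 0 ↔ P = 0 :=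
  map_eq_zero_iff _ (Affine.Point.map_injective _)

theorem homCoords_frobeniusEnd (P : (W⁄L).toAffine.Point) (i : Fin 3) :
    homCoords (frobeniusEnd L W P) i = homCoords P i ^ p := by
  have hp := (Fact.out : p.Prime).ne_zero
  rcases P with _ | ⟨x, y, h⟩
  · change homCoords 0 i = homCoords 0 i ^ p
    fin_cases i <;> simp [homCoords, hp]
  · change homCoords (Affine.Point.map _ (Affine.Point.some x y h)) i = _
    rw [Affine.Point.map_some]
    fin_cases i <;> simp [homCoords]

theorem xCoord_frobeniusEnd {P : (W⁄L).toAffine.Point} (hP : P ≠ 0) :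
    xCoord (frobeniusEnd L W P) = xCoord P ^ p := by
  rw [← (homCoords_of_ne_zero P hP).1,
    ← (homCoords_of_ne_zero _ (frobeniusEnd_eq_zero_iff.not.mpr hP)).1, homCoords_frobeniusEnd]

theorem etaCoord_frobeniusEnd {P : (W⁄L).toAffine.Point} (hP : P ≠ 0) :
    etaCoord (frobeniusEnd L W P) = etaCoord P ^ p := by
  have h := map_ofNat (FiniteField.frobeniusAlgHom (ZMod p) L) 2
  rw [← (homCoords_of_ne_zero P hP).2.1,
    ← (homCoords_of_ne_zero _ (frobeniusEnd_eq_zero_iff.not.mpr hP)).2.1, homCoords_frobeniusEnd,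
    homCoords_frobeniusEnd]
  have hf : ∀ x : L, x ^ p = FiniteField.frobeniusAlgHom (ZMod p) L x := fun x ↦ by
    rw [FiniteField.coe_frobeniusAlgHom, ZMod.card]
  simp only [hf, map_add, map_mul, h, baseChange_a₁, baseChange_a₃, AlgHom.commutes]

omit [DecidableEq L] in
theorem aeval_pow_prime (x : L) (f : (ZMod p)[X]) : aeval (x ^ p) f = aeval x f ^ p := by
  rw [← expand_aeval, ZMod.expand_card, map_pow]

theorem frobeniusEnd_mem_endRing : frobeniusEnd L W ∈ endRing L W := by
  refine IsRationalOver.of_polynomials (fun i ↦ MvPolynomial.X i ^ p) ?_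
  convert! Set.finite_empty
  ext P
  simp only [Set.mem_ofPred_eq, Set.mem_empty_iff_false, iff_false, not_not]
  refine ⟨1, one_ne_zero, ?_⟩
  ext i
  simp [homCoords_frobeniusEnd]

/-- The forms defining `φ` have coefficients in `F_p`, which are fixed by `p`-th powers; the two
composites therefore agree at generic points. -/
theorem commute_frobeniusEnd [Infinite (W⁄L).toAffine.Point]
    {φ : AddMonoid.End (W⁄L).toAffine.Point} (hφ : φ ∈ endRing L W) :
    φ * frobeniusEnd L W = frobeniusEnd L W * φ := by
  have hpr : ∀ (x : Fin 3 → L) (F : MvPolynomial (Fin 3) (ZMod p)),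
      MvPolynomial.aeval (fun i ↦ x i ^ p) F = MvPolynomial.aeval x F ^ p := by
    intro x F
    have hf : ∀ x : L, x ^ p = FiniteField.frobeniusAlgHom (ZMod p) L x := fun x ↦ by
      rw [FiniteField.coe_frobeniusAlgHom, ZMod.card]
    simp only [hf]
    rw [← MvPolynomial.comp_aeval]
    rfl
  refine addMonoidEnd_ext (mul_mem hφ frobeniusEnd_mem_endRing :)
    (mul_mem frobeniusEnd_mem_endRing hφ :) ?_
  obtain ⟨n, F, -, hF⟩ := hφ
  have hF' : ∀ᶠ P in cofinite, ∃ c : L, c ≠ 0 ∧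
      (fun i ↦ MvPolynomial.aeval (homCoords P) (F i)) = c • homCoords (φ P) := hF
  have htend : Tendsto (frobeniusEnd L W) cofinite cofinite :=
    (Affine.Point.map_injective _).tendsto_cofinite
  refine Set.infinite_of_finite_compl ?_
  change ∀ᶠ P in cofinite, φ (frobeniusEnd L W P) = frobeniusEnd L W (φ P)
  filter_upwards [hF', htend.eventually hF'] with P h h'
  obtain ⟨c, hc, h⟩ := h
  obtain ⟨d, hd, h'⟩ := h'
  refine homCoords_inj hd (pow_ne_zero p hc) (h'.symm.trans ?_)
  ext i
  have := congrFun h i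
  simp only [Pi.smul_apply, smul_eq_mul] at this ⊢
  rw [homCoords_frobeniusEnd, ← mul_pow, ← this, ← hpr]
  congr 2
  ext j
  rw [homCoords_frobeniusEnd]

variable [IsAlgClosed L] [W.IsElliptic] (h2 : (2 : ZMod p) ≠ 0)
include h2

/-- Coordinates have `p`-th roots in `L`, and these satisfy the curve equation because the Frobenius
of `L` is injective. -/
theorem frobeniusEnd_bijective : Function.Bijective (frobeniusEnd L W) := by
  have h2' := two_ne_zero_of_algebra (L := L) h2
  have hp0 := (Fact.out : p.Prime).pos
  have hf : ∀ x : L, x ^ p = FiniteField.frobeniusAlgHom (ZMod p) L x := fun x ↦ by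
    rw [FiniteField.coe_frobeniusAlgHom, ZMod.card]
  refine ⟨Affine.Point.map_injective _, fun P ↦ ?_⟩
  by_cases hP : P = 0
  · exact ⟨0, by rw [hP, map_zero]⟩
  obtain ⟨x, hx⟩ := IsAlgClosed.exists_pow_nat_eq (xCoord P) hp0
  obtain ⟨e, he⟩ := IsAlgClosed.exists_pow_nat_eq (etaCoord P) hp0
  have hsq : e ^ 2 = aeval x W.Ψ₂Sq := by
    apply (FiniteField.frobeniusAlgHom (ZMod p) L).injective
    change FiniteField.frobeniusAlgHom (ZMod p) L _ = FiniteField.frobeniusAlgHom (ZMod p) L _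
    rw [← hf, ← hf, ← aeval_pow_prime, hx, ← etaCoord_sq_eq_aeval hP, ← he]
    ring
  rw [aeval_Ψ₂Sq] at hsq
  obtain ⟨Q, hQ, hQx, hQe⟩ := exists_point_of_coords h2' hsq
  refine ⟨Q, eq_of_coords h2' (frobeniusEnd_eq_zero_iff.not.mpr hQ) hP ?_ ?_⟩
  · rw [xCoord_frobeniusEnd hQ, hQx, hx]
  · rw [etaCoord_frobeniusEnd hQ, hQe, he]

theorem xDegree_frobeniusEnd : xDegree ⇑(frobeniusEnd L W) = p := by
  rw [xDegree_eq (v := ![X ^ p, 1]) h2 (isPrimitiveVec_pair_iff.mpr isCoprime_one_right)]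
  · simp [vecDegree, Finset.univ_fin2]
  · refine isXMap_of_coords one_ne_zero (eventually_ne_zero.mono fun P hP ↦
      ⟨frobeniusEnd_eq_zero_iff.not.mpr hP, ?_⟩)
    simp [xCoord_frobeniusEnd hP]

/-- The `x`-coordinate of an injective endomorphism of degree greater than `1` is an inseparable
function. -/
theorem derivative_eq_zero_of_injective {φ : AddMonoid.End (W⁄L).toAffine.Point}
    (hinj : Function.Injective φ) {a b : (ZMod p)[X]} (hab : IsCoprime a b)
    (hdeg : 1 < vecDegree ![a, b])
    (h : ∀ᶠ P in cofinite, φ P ≠ 0 ∧ xCoord (φ P) * aeval (xCoord P) b = aeval (xCoord P) a) :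
    derivative a = 0 ∧ derivative b = 0 := by
  -- The Wronskian is, up to sign, the numerator of the derivative of `a / b`. If it is nonzero, the
  -- map `a / b` has only finitely many ramification points.
  rw [← hab.wronskian_eq_zero_iff]
  by_contra hw
  have h2' := two_ne_zero_of_algebra (L := L) h2
  have := infinite_point (L := L) h2 W
  have hL : Infinite L := IsAlgClosed.instInfinite
  have hS : (xCoord '' {P : (W⁄L).toAffine.Point | ¬ (φ P ≠ 0 ∧
      xCoord (φ P) * aeval (xCoord P) b = aeval (xCoord P) a)}).Finite := Set.Finite.image _ h
  set S := xCoord '' {P : (W⁄L).toAffine.Point | ¬ (φ P ≠ 0 ∧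
      xCoord (φ P) * aeval (xCoord P) b = aeval (xCoord P) a)} with hSdef
  have hR : {x : L | aeval x (wronskian a b) = 0}.Finite := by
    refine (finite_setOfPred_isRoot ((Polynomial.map_ne_zero_iff
      (algebraMap (ZMod p) L).injective).mpr hw)).subset fun x hx ↦ ?_
    change IsRoot _ _
    rwa [IsRoot.def, eval_map_algebraMap]
  set n := vecDegree ![a, b] with hn
  -- A generic value `c`: not taken at an exceptional or ramified point, and not the value at
  -- infinity. Then `a - c b` keeps degree at least `n` and has simple roots, so at least two
  -- distinct ones.
  obtain ⟨c, hc⟩ := (((hS.union hR).image fun x ↦ aeval x a / aeval x b).union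
    (Set.finite_singleton (algebraMap (ZMod p) L (a.coeff n) /
      algebraMap (ZMod p) L (b.coeff n)))).infinite_compl.nonempty
  simp only [Set.mem_compl_iff, Set.mem_union, not_or, Set.mem_image, not_exists, not_and,
    Set.mem_singleton_iff] at hc
  obtain ⟨hc1, hc2⟩ := hc
  set A := a.map (algebraMap (ZMod p) L)
  set B := b.map (algebraMap (ZMod p) L)
  have hA : ∀ x : L, A.eval x = aeval x a := fun x ↦ eval_map_algebraMap _ _
  have hB : ∀ x : L, B.eval x = aeval x b := fun x ↦ eval_map_algebraMap _ _
  have hAB : ∀ x : L, ¬ (aeval x a = 0 ∧ aeval x b = 0) := by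
    rintro x ⟨ha0, hb0⟩
    obtain ⟨r, s, hrs⟩ := hab
    have := congrArg (aeval x) hrs
    rw [map_add, map_mul, map_mul, ha0, hb0, map_one] at this
    simp at this
  set f := A - C c * B with hf
  have hroot : ∀ x, f.IsRoot x → aeval x b ≠ 0 ∧ c = aeval x a / aeval x b := by
    intro x hx
    rw [IsRoot.def, hf, eval_sub, eval_mul, eval_C, hA, hB, sub_eq_zero] at hx
    have hbx : aeval x b ≠ 0 := by
      intro h0
      rw [h0, mul_zero] at hx
      exact hAB x ⟨hx, h0⟩
    exact ⟨hbx, by rw [hx, mul_div_cancel_right₀ _ hbx]⟩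
  have hsimple : ∀ x, f.IsRoot x → f.derivative.eval x ≠ 0 := by
    intro x hx h0
    obtain ⟨hbx, hcx⟩ := hroot x hx
    refine hc1 x (Or.inr ?_) hcx.symm
    have hA' : A.derivative.eval x = aeval x (derivative a) := by
      rw [derivative_map, eval_map_algebraMap]
    have hB' : B.derivative.eval x = aeval x (derivative b) := by
      rw [derivative_map, eval_map_algebraMap]
    rw [hf, derivative_sub, derivative_C_mul, eval_sub, eval_mul, eval_C, hA', hB',
      sub_eq_zero] at h0
    change aeval x (wronskian a b) = 0
    rw [wronskian, map_sub, map_mul, map_mul, h0, hcx]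
    field_simp
    ring
  have hcop : IsCoprime f f.derivative := by
    rw [isCoprime_iff_aeval_ne_zero_of_isAlgClosed L L]
    intro x
    by_cases hx : f.IsRoot x
    · right
      simpa using hsimple x hx
    · left
      simpa using hx
  have hfdeg : n ≤ f.natDegree := by
    refine le_natDegree_of_ne_zero ?_
    rw [hf, coeff_sub, coeff_C_mul, coeff_map, coeff_map]
    intro h0
    rw [sub_eq_zero] at h0
    by_cases hb0 : algebraMap (ZMod p) L (b.coeff n) = 0
    · rw [hb0, mul_zero] at h0
      obtain ⟨i, hi⟩ := (isPrimitiveVec_pair_iff.mpr hab).exists_coeff_ne_zero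
      fin_cases i
      · exact hi ((map_eq_zero _).mp h0)
      · exact hi ((map_eq_zero _).mp hb0)
    · exact hc2 (by rw [h0, mul_div_cancel_right₀ _ hb0])
  have hcard : f.roots.toFinset.card = f.natDegree := by
    rw [Multiset.toFinset_card_of_nodup (nodup_roots hcop), ← (IsAlgClosed.splits f).natDegree_eq_card_roots]
  obtain ⟨x, hx, y, hy, hxy⟩ := Finset.one_lt_card.mp (hcard ▸ hdeg.trans_le hfdeg)
  rw [Multiset.mem_toFinset] at hx hy
  have hlift : ∀ x, f.IsRoot x → ∃ P : (W⁄L).toAffine.Point, P ≠ 0 ∧ xCoord P = x ∧ φ P ≠ 0 ∧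
      xCoord (φ P) = c := by
    intro x hx
    obtain ⟨P, hP, hPx⟩ := exists_xCoord_eq (V := W⁄L) h2' x
    obtain ⟨hbx, hcx⟩ := hroot x hx
    by_cases hex : x ∈ S
    · exact absurd hcx.symm (hc1 x (Or.inl hex))
    · have := not_not.mp fun h0 ↦ hex ⟨P, h0, hPx⟩
      refine ⟨P, hP, hPx, this.1, ?_⟩
      rw [hcx, eq_div_iff hbx, ← hPx, this.2]
  obtain ⟨P, hP, rfl, hφP, hPc⟩ := hlift x (isRoot_of_mem_roots hx)
  obtain ⟨Q, hQ, rfl, hφQ, hQc⟩ := hlift y (isRoot_of_mem_roots hy)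
  -- Equal `x ∘ φ` means `φ P = ±φ Q`; injectivity gives `P = ±Q`, contradicting the distinct
  -- `x`-coordinates.
  rcases eq_or_eq_neg_of_xCoord_eq hφP hφQ (hPc.trans hQc.symm) with h1 | h1
  · exact hxy (congrArg xCoord (hinj h1))
  · rw [← map_neg] at h1
    exact hxy ((congrArg xCoord (hinj h1)).trans (xCoord_neg Q))

end Frobenius

end WeierstrassCurve

/-! ### Factoring through Frobenius, and its trace on supersingular curves -/

namespace WeierstrassCurve

section Supersingular

open Polynomial Filter

variable {p : ℕ} [Fact p.Prime] {L : Type*} [Field L] [Algebra (ZMod p) L] [DecidableEq L]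
  {W : WeierstrassCurve (ZMod p)} [IsAlgClosed L] [W.IsElliptic] (h2 : (2 : ZMod p) ≠ 0)
include h2

/-- An injective endomorphism of degree greater than `1` factors through Frobenius. -/
theorem exists_eq_mul_frobeniusEnd {φ : AddMonoid.End (W⁄L).toAffine.Point}
    (hφ : φ ∈ endRing L W) (hinj : Function.Injective φ) (hdeg : 1 < xDegree φ) :
    ∃ ψ ∈ endRing L W, φ = ψ * frobeniusEnd L W := by
  have hp : p.Prime := Fact.out
  have h0 : φ ≠ 0 := by
    rintro rfl
    rw [xDegree_zero h2] at hdeg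
    exact absurd hdeg (by norm_num)
  obtain ⟨a, b, c, d, hab, hb, hd, h⟩ := exists_coprime_coords h2 hφ h0
  have hx : ∀ᶠ P in cofinite, φ P ≠ 0 ∧ xCoord (φ P) * aeval (xCoord P) b = aeval (xCoord P) a :=
    h.mono fun P hP ↦ ⟨hP.1, hP.2.1⟩
  rw [xDegree_eq h2 (isPrimitiveVec_pair_iff.mpr hab) (isXMap_of_coords hb hx)] at hdeg
  obtain ⟨ha', hb'⟩ := derivative_eq_zero_of_injective h2 hinj hab hdeg hx
  set f := W.Ψ₂Sq with hf
  obtain ⟨m, hm⟩ : Odd p := hp.odd_of_ne_two (by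
    rintro rfl
    exact h2 rfl)
  have hmp : ∀ x : L, x ^ p = x ^ (2 * m + 1) := fun x ↦ congrArg (x ^ ·) hm
  -- As `η^p = η f^m`, the relation `η(φ P) = η c / d` becomes `η(φ P) = η^p g / (d f)^p`. The
  -- denominator is now a function of `x^p`, and `g` should be one too.
  set g := c * f ^ (m + 1) * d ^ (2 * m) with hg
  have hpow : ∀ q : (ZMod p)[X], derivative (q ^ p) = 0 := by
    intro q
    rw [derivative_pow, CharP.cast_eq_zero, C_0, zero_mul, zero_mul]
  -- The curve equation at `φ P`, cleared of denominators. Every factor except `g²` is already known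
  -- to have derivative zero, so `2 g g' = 0`.
  have hid : g ^ 2 * (f ^ p * b ^ 3) =
      (4 * a ^ 3 + C W.b₂ * a ^ 2 * b + 2 * C W.b₄ * a * b ^ 2 + C W.b₆ * b ^ 3) *
        ((d * f) ^ p) ^ 2 := by
    rw [← sub_eq_zero]
    refine eq_zero_of_eventually_aeval_eq_zero (W := W) (L := L) h2 ?_
    filter_upwards [h, eventually_ne_zero] with P hP hP0
    obtain ⟨hφP, hX, hE⟩ := hP
    have h3 := etaCoord_sq hφP
    have h4 := etaCoord_sq_eq_aeval hP0
    rw [baseChange_b₂, baseChange_b₄, baseChange_b₆] at h3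
    simp only [hg, map_sub, map_add, map_mul, map_pow, aeval_C, map_ofNat]
    rw [← hf] at h4
    rw [← hX]
    generalize aeval (xCoord P) b = B at *
    generalize aeval (xCoord P) c = c' at *
    generalize aeval (xCoord P) d = d' at *
    generalize aeval (xCoord P) f = f' at *
    rw [hmp, hmp]
    have h5 : (etaCoord (φ P) * d') ^ 2 = f' * c' ^ 2 := by
      rw [hE, ← h4]
      ring
    have h6 : (4 * (xCoord (φ P) * B) ^ 3 +
        algebraMap (ZMod p) L W.b₂ * (xCoord (φ P) * B) ^ 2 * B +
        2 * algebraMap (ZMod p) L W.b₄ * (xCoord (φ P) * B) * B ^ 2 +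
        algebraMap (ZMod p) L W.b₆ * B ^ 3) = B ^ 3 * etaCoord (φ P) ^ 2 := by
      rw [h3]
      ring
    rw [h6]
    linear_combination (-(B ^ 3 * d' ^ (4 * m) * f' ^ (4 * m + 2))) * h5
  have hg' : derivative g = 0 := by
    have h1 := congrArg derivative hid
    have h4' : derivative (4 : (ZMod p)[X]) = 0 := derivative_ofNat 4
    have h2'' : derivative (2 : (ZMod p)[X]) = 0 := derivative_ofNat 2
    simp only [derivative_mul, derivative_add, derivative_pow _ 3, derivative_pow _ 2, hpow, ha',
      hb', derivative_C, h4', h2'', mul_zero, zero_mul, add_zero] at h1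
    have hfb : f ^ p * b ^ 3 ≠ 0 :=
      mul_ne_zero (pow_ne_zero _ (Ψ₂Sq_ne_zero_of_isElliptic h2)) (pow_ne_zero _ hb)
    have h3 := (mul_eq_zero.mp h1).resolve_right hfb
    rcases mul_eq_zero.mp h3 with h5 | h5
    · have h6 : (C ((2 : ℕ) : ZMod p)) ≠ 0 := by
        rw [Ne, C_eq_zero]
        exact_mod_cast h2
      have h7 := (mul_eq_zero.mp h5).resolve_left h6
      rw [pow_eq_zero_iff (by norm_num)] at h7
      rw [h7, derivative_zero]
    · exact h5
  have hexp : ∀ q : (ZMod p)[X], derivative q = 0 → expand (ZMod p) p (contract p q) = q :=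
    fun q hq ↦ expand_contract p hq hp.ne_zero
  have hev : ∀ (q : (ZMod p)[X]) (x : L), derivative q = 0 → aeval (x ^ p) (contract p q) =
      aeval x q := by
    intro q x hq
    rw [← expand_aeval, hexp q hq]
  let e := AddEquiv.ofBijective (frobeniusEnd L W) (frobeniusEnd_bijective h2)
  -- As a group homomorphism `ψ` is `φ ∘ π⁻¹`. Rationality follows by contracting `a`, `b`, `g` from
  -- polynomials in `x^p` to polynomials in `x`; `(d f)^p` at `x` is `d f` at `x^p`.
  let ψ : AddMonoid.End (W⁄L).toAffine.Point := φ.comp e.symm.toAddMonoidHom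
  have hψ : ∀ P, ψ (frobeniusEnd L W P) = φ P := fun P ↦ congrArg φ (e.symm_apply_apply P)
  refine ⟨ψ, ?_, ?_⟩
  · refine isRationalOver_of_coords (a := contract p a) (b := contract p b) (c := contract p g)
      (d := d * f) h2 ?_ (mul_ne_zero hd (Ψ₂Sq_ne_zero_of_isElliptic h2)) ?_
    · intro h0
      apply hb
      rw [← hexp b hb', h0, map_zero]
    · have hmain : ∀ᶠ P in cofinite, ψ (frobeniusEnd L W P) ≠ 0 ∧
          xCoord (ψ (frobeniusEnd L W P)) * aeval (xCoord (frobeniusEnd L W P)) (contract p b) =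
            aeval (xCoord (frobeniusEnd L W P)) (contract p a) ∧
          etaCoord (ψ (frobeniusEnd L W P)) * aeval (xCoord (frobeniusEnd L W P)) (d * f) =
            etaCoord (frobeniusEnd L W P) * aeval (xCoord (frobeniusEnd L W P)) (contract p g) := by
        filter_upwards [h, eventually_ne_zero] with P hP hP0
        obtain ⟨hφP, hX, hE⟩ := hP
        have h4 := etaCoord_sq_eq_aeval hP0
        rw [hψ, xCoord_frobeniusEnd hP0, etaCoord_frobeniusEnd hP0, hev _ _ ha', hev _ _ hb',
          hev _ _ hg', aeval_pow_prime]
        refine ⟨hφP, hX, ?_⟩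
        simp only [hg, map_mul, map_pow]
        rw [← hf] at h4
        rw [hmp, hmp, pow_succ (etaCoord P), pow_mul, h4]
        linear_combination aeval (xCoord P) d ^ (2 * m) * aeval (xCoord P) f ^ (2 * m + 1) * hE
      filter_upwards [e.symm.injective.tendsto_cofinite.eventually hmain] with R hR
      rwa [show frobeniusEnd L W (e.symm R) = R from e.apply_symm_apply R] at hR
  · ext P : 1
    exact (hψ P).symm

omit h2 in
variable (L W) in
/-- The Frobenius endomorphism as an element of the endomorphism ring. -/
noncomputable def frobenius : endRing L W := ⟨frobeniusEnd L W, frobeniusEnd_mem_endRing⟩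

/-- The trace of Frobenius of a supersingular curve over a prime field vanishes. -/
theorem trace_frobenius (hp5 : 5 ≤ p) (hE : W.IsSupersingular L p) :
    (isDegreeForm_xDegree (L := L) (W := W) h2).trace (frobenius L W) = 0 := by
  have hp : p.Prime := Fact.out
  set hd := isDegreeForm_xDegree (L := L) (W := W) h2
  have hdπ : ((xDegree ⇑(frobeniusEnd L W) : ℕ) : ℤ) = p := by
    rw [xDegree_frobeniusEnd h2]
  set t := hd.trace (frobenius L W) with ht
  have hle : t ^ 2 ≤ 4 * p := by
    have h1 : t ^ 2 ≤ 4 * ((xDegree ⇑(frobeniusEnd L W) : ℕ) : ℤ) := hd.trace_sq_le (frobenius L W)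
    rwa [hdπ] at h1
  -- The element `t - π` plays the role of the dual of Frobenius: it has degree `p`, and `π φ = p`.
  set φ : endRing L W := t • 1 + (-1 : ℤ) • frobenius L W with hφ
  have hdφ : xDegree (φ : AddMonoid.End (W⁄L).toAffine.Point) = p := by
    have h1 := hd.map_add_zsmul (frobenius L W) t (-1)
    rw [← hφ, ← ht] at h1
    have h3 : ((xDegree (φ : AddMonoid.End (W⁄L).toAffine.Point) : ℕ) : ℤ) =
        t ^ 2 + t * -1 * t + (-1) ^ 2 * ((xDegree ⇑(frobeniusEnd L W) : ℕ) : ℤ) := h1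
    rw [hdπ] at h3
    have h4 : ((xDegree (φ : AddMonoid.End (W⁄L).toAffine.Point) : ℕ) : ℤ) = p := by
      rw [h3]
      ring
    exact_mod_cast h4
  have hmul : frobenius L W * φ = (p : ℤ) • 1 := by
    have h1 := hd.mul_self_eq (frobenius L W)
    rw [← ht] at h1
    have h3 : frobenius L W * frobenius L W = t • frobenius L W - (p : ℤ) • 1 := by
      rw [h1, ← hdπ]
      rfl
    rw [hφ, mul_add, mul_smul_comm, mul_smul_comm, h3, mul_one]
    module
  have hinj : Function.Injective (φ : AddMonoid.End (W⁄L).toAffine.Point) := by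
    rw [injective_iff_map_eq_zero]
    intro P hP
    have h1 := congrArg (fun r : endRing L W ↦ (r : AddMonoid.End (W⁄L).toAffine.Point) P) hmul
    have h3 : frobeniusEnd L W ((φ : AddMonoid.End (W⁄L).toAffine.Point) P) = (p : ℤ) • P := h1
    rw [hP, map_zero, natCast_zsmul] at h3
    exact hE 1 le_rfl P (by rw [pow_one, ← h3])
  obtain ⟨ψ, hψ, hφψ⟩ := exists_eq_mul_frobeniusEnd h2 φ.2 hinj (by rw [hdφ]; exact hp.one_lt)
  -- Taking degrees in `t = (ψ + 1) π` gives `t² = p · deg (ψ + 1)`.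
  have ht1 : t • (1 : endRing L W) = (⟨ψ, hψ⟩ + 1) * frobenius L W := by
    have h1 : φ = ⟨ψ, hψ⟩ * frobenius L W := Subtype.ext hφψ
    rw [add_mul, one_mul, ← h1, hφ]
    module
  have ht2 := hd.map_mul (⟨ψ, hψ⟩ + 1) (frobenius L W)
  rw [← ht1, hd.map_zsmul_one] at ht2
  have hdvd : (p : ℤ) ∣ t := by
    refine (Nat.prime_iff_prime_int.mp hp).dvd_of_dvd_pow (n := 2) ?_
    rw [ht2]
    exact Dvd.intro_left _ (congrArg _ hdπ.symm)
  obtain ⟨k, hk⟩ := hdvd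
  -- A nonzero multiple of `p` would give `p² ≤ t² ≤ 4p`, impossible for `p ≥ 5`.
  by_contra h0
  have hk0 : k ≠ 0 := by
    rintro rfl
    rw [mul_zero] at hk
    exact h0 hk
  have hk1 : 1 ≤ k ^ 2 := by
    have := pow_pos (abs_pos.mpr hk0) 2
    rw [sq_abs] at this
    lia
  have hp5' : (5 : ℤ) ≤ p := by exact_mod_cast hp5
  rw [hk, mul_pow] at hle
  have := mul_le_mul_of_nonneg_left hk1 (sq_nonneg (p : ℤ))
  nlinarith

theorem frobenius_mul_self (hp5 : 5 ≤ p) (hE : W.IsSupersingular L p) :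
    frobenius L W * frobenius L W = -((p : ℤ) • (1 : endRing L W)) := by
  have h := (isDegreeForm_xDegree (L := L) (W := W) h2).mul_self_of_trace_eq_zero
    (trace_frobenius h2 hp5 hE)
  rw [h]
  change -((xDegree ⇑(frobeniusEnd L W) : ℤ) • (1 : endRing L W)) = _
  rw [xDegree_frobeniusEnd h2]

theorem commute_frobenius (φ : endRing L W) : φ * frobenius L W = frobenius L W * φ := by
  have := infinite_point (L := L) h2 W
  exact Subtype.ext (commute_frobeniusEnd φ.2)

omit [IsAlgClosed L] h2 [W.IsElliptic] in
/-- The fixed points of Frobenius are the points over the prime field. -/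
theorem frobeniusEnd_eq_self_iff {P : (W⁄L).toAffine.Point} : frobeniusEnd L W P = P ↔
    ∃ Q : (W⁄(ZMod p)).toAffine.Point, Affine.Point.baseChange (ZMod p) L Q = P := by
  have hroot : ∀ x : L, x ^ p = x → ∃ y : ZMod p, algebraMap (ZMod p) L y = x := by
    intro x hx
    have : CharP L p := charP_of_injective_algebraMap (algebraMap (ZMod p) L).injective p
    exact (bot_le : ⊥ ≤ (algebraMap (ZMod p) L).fieldRange)
      ((Subfield.mem_bot_iff_pow_eq_self L p).mpr hx)
  constructor
  · intro h
    rcases P with _ | ⟨x, y, hxy⟩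
    · exact ⟨0, rfl⟩
    · change Affine.Point.map _ (Affine.Point.some x y hxy) = _ at h
      rw [Affine.Point.map_some] at h
      obtain ⟨hx, hy⟩ := (Affine.Point.some.injEq ..).mp h
      rw [FiniteField.coe_frobeniusAlgHom, ZMod.card] at hx hy
      obtain ⟨x, rfl⟩ := hroot x hx
      obtain ⟨y, rfl⟩ := hroot y hy
      refine ⟨.some x y ((Affine.baseChange_nonsingular W.toAffine
        (Algebra.ofId (ZMod p) L).injective ..).mp hxy), rfl⟩
  · rintro ⟨Q, rfl⟩
    rcases Q with _ | ⟨x, y, hxy⟩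
    · rfl
    · exact Affine.Point.map_baseChange (W' := W.toAffine) (FiniteField.frobeniusAlgHom (ZMod p) L)
        (Affine.Point.some x y hxy)

end Supersingular

end WeierstrassCurve

/-- The generator of `ℤ[(1 + √-p)/2]` satisfies `(ω + ω - 1)² = -p`. -/
theorem exists_intAdjoinHalf_sq (p : ℕ) :
    ∃ ω : intAdjoinHalf p, (ω + ω - 1) * (ω + ω - 1) = -((p : ℤ) • 1) := by
  refine ⟨⟨_, Subring.subset_closure rfl⟩, Subtype.ext ?_⟩
  have h : (Real.sqrt p : ℂ) * Real.sqrt p = p := by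
    rw [← Complex.ofReal_mul, Real.mul_self_sqrt (Nat.cast_nonneg p), Complex.ofReal_natCast]
  push_cast
  linear_combination (Real.sqrt p : ℂ) * Real.sqrt p * Complex.I_mul_I - h

/-! ### From the ring isomorphism to rational `2`-torsion -/

namespace WeierstrassCurve

section TwoTorsion

open Polynomial Filter

variable {p : ℕ} [Fact p.Prime] {L : Type*} [Field L] [Algebra (ZMod p) L] [DecidableEq L]
  {W : WeierstrassCurve (ZMod p)} [IsAlgClosed L] [W.IsElliptic] (h2 : (2 : ZMod p) ≠ 0)
include h2

/-- Both `2α - 1` and `π` are square roots of `-p` and they commute. Without zero divisors this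
forces `2α - 1 = ±π`, and on `2`-torsion `2α - 1` and both signs act trivially. -/
theorem frobeniusEnd_eq_self_of_ringEquiv (hp5 : 5 ≤ p) (hE : W.IsSupersingular L p)
    (e : endRing L W ≃+* intAdjoinHalf p) {P : (W⁄L).toAffine.Point} (hP : (2 : ℕ) • P = 0) :
    frobeniusEnd L W P = P := by
  obtain ⟨ω, hω⟩ := exists_intAdjoinHalf_sq p
  set α := e.symm ω with hα
  have hα2 : (α + α - 1) * (α + α - 1) = -((p : ℤ) • 1) := by
    apply e.injective
    rw [map_neg, map_zsmul, map_one, ← hω, map_mul, map_sub, map_add, map_one, hα,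
      e.apply_symm_apply]
  have := (isDegreeForm_xDegree (L := L) (W := W) h2).noZeroDivisors
  have hcomm := commute_frobenius h2 (α + α - 1)
  have hmul : (α + α - 1 - frobenius L W) * (α + α - 1 + frobenius L W) = 0 := by
    rw [sub_mul, mul_add, mul_add, hα2, frobenius_mul_self h2 hp5 hE, hcomm]
    abel
  have hαP : (α + α - 1 : endRing L W).1 P = P := by
    change α.1 P + α.1 P - P = P
    rw [← map_add, ← two_nsmul, hP, map_zero, zero_sub, neg_eq_iff_add_eq_zero, ← two_nsmul, hP]
  rcases mul_eq_zero.mp hmul with h | h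
  · rw [sub_eq_zero.mp h] at hαP
    exact hαP
  · rw [eq_neg_of_add_eq_zero_left h] at hαP
    have h1 : -(frobeniusEnd L W P) = P := hαP
    rw [neg_eq_iff_eq_neg.mp h1, neg_eq_iff_add_eq_zero, ← two_nsmul, hP]

end TwoTorsion

end WeierstrassCurve

/-! ### Rational maps that need not be homomorphisms -/

namespace WeierstrassCurve

section RationalMaps

open Polynomial Filter

variable {K : Type*} [Field K] {L : Type*} [Field L] [Algebra K L] {W : WeierstrassCurve K}

theorem IsRationalOver.congr {φ ψ : (W⁄L).toAffine.Point → (W⁄L).toAffine.Point}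
    (hφ : IsRationalOver L W φ) (h : ∀ᶠ P in cofinite, ψ P = φ P) : IsRationalOver L W ψ := by
  obtain ⟨n, F, hFn, hF⟩ := hφ
  refine ⟨n, F, hFn, ?_⟩
  have hF' : ∀ᶠ P in cofinite, ∃ c : L, c ≠ 0 ∧
      (fun i ↦ MvPolynomial.aeval (homCoords P) (F i)) = c • homCoords (φ P) := hF
  change ∀ᶠ P in cofinite, ∃ c : L, c ≠ 0 ∧
      (fun i ↦ MvPolynomial.aeval (homCoords P) (F i)) = c • homCoords (ψ P)
  filter_upwards [hF', h] with P h1 h2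
  rwa [h2]

theorem IsRationalOver.comp {φ ψ : (W⁄L).toAffine.Point → (W⁄L).toAffine.Point}
    (hφ : IsRationalOver L W φ) (hψ : IsRationalOver L W ψ) (htend : Tendsto ψ cofinite cofinite) :
    IsRationalOver L W (φ ∘ ψ) := by
  obtain ⟨n, F, hFn, hF⟩ := hφ
  obtain ⟨_, G, -, hG⟩ := hψ
  have hF' : ∀ᶠ P in cofinite, ∃ c : L, c ≠ 0 ∧
      (fun i ↦ MvPolynomial.aeval (homCoords P) (F i)) = c • homCoords (φ P) := hF
  have hG' : ∀ᶠ P in cofinite, ∃ c : L, c ≠ 0 ∧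
      (fun i ↦ MvPolynomial.aeval (homCoords P) (G i)) = c • homCoords (ψ P) := hG
  refine IsRationalOver.of_polynomials (fun i ↦ MvPolynomial.bind₁ G (F i)) ?_
  change ∀ᶠ P in cofinite, _
  filter_upwards [hG', htend.eventually hF'] with P h' h
  obtain ⟨d, hd, h'⟩ := h'
  obtain ⟨c, hc, h⟩ := h
  refine ⟨d ^ n * c, mul_ne_zero (pow_ne_zero _ hd) hc, ?_⟩
  ext i
  rw [MvPolynomial.aeval_bind₁, h', aeval_smul_of_homogeneous (hFn i)]
  have := congrFun h i
  simp only [Pi.smul_apply, smul_eq_mul] at this ⊢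
  rw [this, mul_assoc]
  rfl

variable [DecidableEq L]

theorem isRationalOver_const (Q : (W⁄K).toAffine.Point) [DecidableEq K] :
    IsRationalOver L W fun _ ↦ Affine.Point.baseChange (W' := W.toAffine) K L Q := by
  refine IsRationalOver.of_polynomials (fun i ↦ MvPolynomial.C (homCoords Q i)) ?_
  convert! Set.finite_empty
  ext P
  simp only [Set.mem_ofPred_eq, Set.mem_empty_iff_false, iff_false, not_not]
  refine ⟨1, one_ne_zero, ?_⟩
  ext i
  rw [one_smul, MvPolynomial.algHom_C]
  rcases Q with _ | ⟨x, y, h⟩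
  · change algebraMap K L (homCoords 0 i) = homCoords 0 i
    fin_cases i <;> simp [homCoords]
  · change _ = homCoords (Affine.Point.map _ (Affine.Point.some x y h)) i
    rw [Affine.Point.map_some]
    fin_cases i <;> simp [homCoords]

/-- Two rational maps agree almost everywhere or at only finitely many points; this decides between
the duplication and the addition formula. -/
theorem IsRationalOver.add {φ ψ : (W⁄L).toAffine.Point → (W⁄L).toAffine.Point}
    (hφ : IsRationalOver L W φ) (hψ : IsRationalOver L W ψ) :
    IsRationalOver L W (fun P ↦ φ P + ψ P) := by
  have hφ' := hφ
  have hψ' := hψ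
  obtain ⟨_, F, -, hF⟩ := hφ
  obtain ⟨_, G, -, hG⟩ := hψ
  have hW : ∀ Q : (W⁄L).toAffine.Point, (W.map (MvPolynomial.C (σ := Fin 3))).map
      (MvPolynomial.aeval (R := K) (homCoords Q)).toRingHom = W⁄L := by
    intro Q
    rw [WeierstrassCurve.map_map]
    congr 1
    ext
    simp
  have main : ∀ (Q : (W⁄L).toAffine.Point) (H : Fin 3 → MvPolynomial (Fin 3) K) (c d : L),
      c ≠ 0 → d ≠ 0 →
      (fun i ↦ MvPolynomial.aeval (homCoords Q) (H i)) =
        (W⁄L).toProjective.add (c • homCoords (φ Q)) (d • homCoords (ψ Q)) →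
      ∃ e : L, e ≠ 0 ∧ (fun i ↦ MvPolynomial.aeval (homCoords Q) (H i)) =
        e • homCoords (φ Q + ψ Q) := by
    intro Q H c d hc hd h
    have hns : ∀ (c : L) (P : (W⁄L).toAffine.Point), c ≠ 0 →
        (W⁄L).toProjective.Nonsingular (c • homCoords P) :=
      fun c P hc ↦ (Projective.nonsingular_smul _ hc.isUnit).mpr (homCoords_nonsingular P)
    obtain ⟨e, he, he'⟩ := exists_smul_homCoords
      (Projective.nonsingular_add (hns c (φ Q) hc) (hns d (ψ Q) hd))
    rw [Projective.Point.toAffine_add (hns c _ hc) (hns d _ hd),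
      Projective.Point.toAffine_smul _ hc.isUnit, Projective.Point.toAffine_smul _
      hd.isUnit, toAffine_homCoords, toAffine_homCoords] at he'
    exact ⟨e, he, h.trans he'⟩
  by_cases hinf : {Q | φ Q = ψ Q}.Infinite
  · have hne := finite_ne_of_infinite_eq' hφ' hψ' hinf
    refine IsRationalOver.of_polynomials
      ((W.map (MvPolynomial.C (σ := Fin 3))).toProjective.dblXYZ F)
      ((hF.union hne).subset fun Q hQ ↦ ?_)
    by_contra hcon
    simp only [Set.mem_union, Set.mem_ofPred_eq, not_or, not_not] at hcon
    obtain ⟨⟨c, hc, h⟩, hne⟩ := hcon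
    refine hQ (main Q _ c c hc hc ?_)
    rw [← hne, Projective.add_self]
    have := Projective.map_dblXYZ (W' := (W.map (MvPolynomial.C (σ := Fin 3))).toProjective)
      (MvPolynomial.aeval (R := K) (homCoords Q)).toRingHom F
    change WeierstrassCurve.Projective.dblXYZ ((W.map (MvPolynomial.C (σ := Fin 3))).map
      (MvPolynomial.aeval (R := K) (homCoords Q)).toRingHom) _ = _ at this
    rw [hW] at this
    rw [← h]
    exact this.symm
  · refine IsRationalOver.of_polynomials
      ((W.map (MvPolynomial.C (σ := Fin 3))).toProjective.addXYZ F G)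
      (((hF.union hG).union (Set.not_infinite.mp hinf)).subset fun Q hQ ↦ ?_)
    by_contra hcon
    simp only [Set.mem_union, Set.mem_ofPred_eq, not_or, not_not] at hcon
    obtain ⟨⟨⟨c, hc, h⟩, ⟨d, hd, h'⟩⟩, hne⟩ := hcon
    refine hQ (main Q _ c d hc hd ?_)
    rw [Projective.add_of_not_equiv]
    · have := Projective.map_addXYZ (W' := (W.map (MvPolynomial.C (σ := Fin 3))).toProjective)
        (MvPolynomial.aeval (R := K) (homCoords Q)).toRingHom F G
      change WeierstrassCurve.Projective.addXYZ ((W.map (MvPolynomial.C (σ := Fin 3))).map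
        (MvPolynomial.aeval (R := K) (homCoords Q)).toRingHom) _ _ = _ at this
      rw [hW] at this
      rw [← h, ← h']
      exact this.symm
    · rintro ⟨u, hu⟩
      refine hne (homCoords_inj (c := c) (d := u * d) hc (mul_ne_zero u.ne_zero hd) ?_)
      rw [mul_smul]
      exact hu.symm

end RationalMaps

end WeierstrassCurve

/-! ### Halving points when the `2`-torsion is rational -/

namespace WeierstrassCurve

section Halving

variable {L : Type*} [Field L] {V : WeierstrassCurve L}

/-- The three nontrivial `2`-torsion points of `V` have the distinct `x`-coordinates `e₁`, `e₂`
and `e₃`. -/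
structure IsSplitBy (V : WeierstrassCurve L) (e₁ e₂ e₃ : L) : Prop where
  b₂_eq : V.b₂ = -4 * (e₁ + e₂ + e₃)
  b₄_eq : V.b₄ = 2 * (e₁ * e₂ + e₁ * e₃ + e₂ * e₃)
  b₆_eq : V.b₆ = -4 * (e₁ * e₂ * e₃)
  ne₁₂ : e₁ ≠ e₂
  ne₁₃ : e₁ ≠ e₃
  ne₂₃ : e₂ ≠ e₃

namespace IsSplitBy

variable {e₁ e₂ e₃ : L} (hV : V.IsSplitBy e₁ e₂ e₃)
include hV

theorem etaCoord_sq {P : V.toAffine.Point} (hP : P ≠ 0) :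
    etaCoord P ^ 2 = 4 * ((xCoord P - e₁) * (xCoord P - e₂) * (xCoord P - e₃)) := by
  rw [WeierstrassCurve.etaCoord_sq hP, hV.b₂_eq, hV.b₄_eq, hV.b₆_eq]
  ring

theorem baseChange {L' : Type*} [Field L'] [Algebra L L'] :
    (V⁄L').IsSplitBy (algebraMap L L' e₁) (algebraMap L L' e₂) (algebraMap L L' e₃) where
  b₂_eq := by simp [baseChange_b₂, hV.b₂_eq, map_ofNat (algebraMap L L') 4]
  b₄_eq := by simp [baseChange_b₄, hV.b₄_eq, map_ofNat (algebraMap L L') 2]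
  b₆_eq := by simp [baseChange_b₆, hV.b₆_eq, map_ofNat (algebraMap L L') 4]
  ne₁₂ h := hV.ne₁₂ ((algebraMap L L').injective h)
  ne₁₃ h := hV.ne₁₃ ((algebraMap L L').injective h)
  ne₂₃ h := hV.ne₂₃ ((algebraMap L L').injective h)

variable [DecidableEq L]

/-- Halving a point of a curve whose `2`-torsion points are rational. -/
theorem exists_two_nsmul_eq_of_sq [V.IsElliptic] (h2 : (2 : L) ≠ 0) {P : V.toAffine.Point}
    (hP : P ≠ 0) {w₁ w₂ w₃ : L} (hw₁ : w₁ ^ 2 = xCoord P - e₁) (hw₂ : w₂ ^ 2 = xCoord P - e₂)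
    (hw₃ : w₃ ^ 2 = xCoord P - e₃) (hw : 2 * (w₁ * w₂ * w₃) = etaCoord P) :
    ∃ Q : V.toAffine.Point, Q ≠ 0 ∧ xCoord Q = xCoord P + (w₁ * w₂ + w₁ * w₃ + w₂ * w₃) ∧
      etaCoord Q = 2 * ((w₁ + w₂) * (w₁ + w₃) * (w₂ + w₃)) ∧ 2 • Q = P := by
  obtain ⟨hb₂, hb₄, hb₆, h12, h13, h23⟩ := hV
  obtain rfl : e₁ = xCoord P - w₁ ^ 2 := by linear_combination hw₁
  obtain rfl : e₂ = xCoord P - w₂ ^ 2 := by linear_combination hw₂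
  obtain rfl : e₃ = xCoord P - w₃ ^ 2 := by linear_combination hw₃
  -- With this `x`-coordinate, `x(Q) - e₁ = (w₁ + w₂)(w₁ + w₃)` and cyclically, so the cubic takes a
  -- square value at `x(Q)`. The tangent at `Q` has slope `2 (w₁ + w₂ + w₃)`.
  obtain ⟨Q, hQ, hx, hη⟩ := exists_point_of_coords (V := V) h2
    (x := xCoord P + (w₁ * w₂ + w₁ * w₃ + w₂ * w₃))
    (e := 2 * ((w₁ + w₂) * (w₁ + w₃) * (w₂ + w₃))) (by
      rw [hb₂, hb₄, hb₆]
      ring)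
  have hne : ∀ {a b : L}, xCoord P - a ^ 2 ≠ xCoord P - b ^ 2 → a + b ≠ 0 := by
    intro a b hab h
    exact hab (by linear_combination (b - a) * h)
  have hη0 : etaCoord Q ≠ 0 := by
    rw [hη]
    exact mul_ne_zero h2 (mul_ne_zero (mul_ne_zero (hne h12) (hne h13)) (hne h23))
  have hQQ : Q ≠ -Q := by
    rw [Ne, eq_neg_iff_add_eq_zero, ← two_nsmul, two_nsmul_eq_zero_iff h2]
    exact hη0
  obtain ⟨hadd, m, hm1, hm2, -, hm3⟩ := exists_slope_add hQ hQ hQQ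
  have hm : m = 2 * (w₁ + w₂ + w₃) := by
    refine mul_right_cancel₀ hη0 ?_
    rw [hm3 rfl, hη, hx, hb₂, hb₄]
    ring
  have hxQ : xCoord (Q + Q) = xCoord P := by
    refine mul_left_cancel₀ (mul_ne_zero h2 h2) ?_
    rw [hm, hb₂, hx] at hm1
    linear_combination hm1
  refine ⟨Q, hQ, hx, hη, ?_⟩
  rw [two_nsmul]
  refine eq_of_coords h2 hadd hP hxQ ?_
  rw [hm2, hxQ, hm, hη, hx, ← hw]
  ring

/-- Arbitrary square roots satisfy the product condition up to sign, and changing the sign of `w₁`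
corrects it. -/
theorem two_nsmul_surjective [IsAlgClosed L] [V.IsElliptic] (h2 : (2 : L) ≠ 0) :
    Function.Surjective fun Q : V.toAffine.Point ↦ 2 • Q := by
  intro P
  by_cases hP : P = 0
  · exact ⟨0, by simp [hP]⟩
  obtain ⟨w₁, hw₁⟩ := IsAlgClosed.exists_pow_nat_eq (xCoord P - e₁) two_pos
  obtain ⟨w₂, hw₂⟩ := IsAlgClosed.exists_pow_nat_eq (xCoord P - e₂) two_pos
  obtain ⟨w₃, hw₃⟩ := IsAlgClosed.exists_pow_nat_eq (xCoord P - e₃) two_pos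
  have hsq : (2 * (w₁ * w₂ * w₃)) ^ 2 = etaCoord P ^ 2 := by
    rw [hV.etaCoord_sq hP, ← hw₁, ← hw₂, ← hw₃]
    ring
  rcases sq_eq_sq_iff_eq_or_eq_neg.mp hsq with h | h
  · obtain ⟨Q, -, -, -, hQ⟩ := hV.exists_two_nsmul_eq_of_sq h2 hP hw₁ hw₂ hw₃ h
    exact ⟨Q, hQ⟩
  · obtain ⟨Q, -, -, -, hQ⟩ := hV.exists_two_nsmul_eq_of_sq h2 hP (w₁ := -w₁)
      (by rw [neg_sq, hw₁]) hw₂ hw₃ (by linear_combination -h)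
    exact ⟨Q, hQ⟩

end IsSplitBy

/-- A line meets a plane cubic `η² = 4 (x - e₁) (x - e₂) (x - e₃)` in three points. -/
theorem line_identities (h2 : (2 : L) ≠ 0) {e₁ e₂ e₃ x y z η θ m : L}
    (hx : η ^ 2 = 4 * ((x - e₁) * (x - e₂) * (x - e₃)))
    (hy : θ ^ 2 = 4 * ((y - e₁) * (y - e₂) * (y - e₃)))
    (hm : m * (y - x) = θ + η) (hne : y ≠ x)
    (hz : 4 * z = m ^ 2 + 4 * (e₁ + e₂ + e₃) - 4 * (y + x)) :
    (m * (e₁ - x) - η) ^ 2 = 4 * ((z - e₁) * (x - e₁) * (y - e₁)) ∧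
    (m * (e₂ - x) - η) ^ 2 = 4 * ((z - e₂) * (x - e₂) * (y - e₂)) ∧
    (m * (e₃ - x) - η) ^ 2 = 4 * ((z - e₃) * (x - e₃) * (y - e₃)) ∧
    (m * (e₁ - x) - η) * (m * (e₂ - x) - η) * (m * (e₃ - x) - η) =
      -(θ + m * (z - y)) * η * θ := by
  obtain rfl : θ = m * (y - x) - η := by linear_combination -hm
  have h4 : (4 : L) ≠ 0 := by
    rw [show (4 : L) = 2 * 2 by norm_num]
    exact mul_ne_zero h2 h2
  have hyx := sub_ne_zero.mpr hne
  -- With `ℓ(T) = m (T - x) - η`, the identity is `4 ∏ (T - eᵢ) - ℓ(T)² = 4 (T - x)(T - y)(T - z)`;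
  -- `hz`, `c2`, `c3` compare coefficients. Setting `T = eᵢ` gives the squares.
  have c2 : 4 * (e₁ * e₂ + e₁ * e₃ + e₂ * e₃) + 2 * m * (m * x + η) =
      4 * (z * x + z * y + x * y) := by
    refine mul_right_cancel₀ hyx ?_
    linear_combination hx - hy - (y - x) * (x + y) * hz
  have c3 : 4 * (e₁ * e₂ * e₃) + (m * x + η) ^ 2 = 4 * (z * x * y) := by
    linear_combination x * c2 + hx + x ^ 2 * hz
  have hsq : ∀ e, (e - e₁) * (e - e₂) * (e - e₃) = 0 →
      (m * (e - x) - η) ^ 2 = 4 * ((z - e) * (x - e) * (y - e)) := by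
    intro e he
    linear_combination 4 * he - e * c2 + c3 - e ^ 2 * hz
  refine ⟨hsq _ (by ring), hsq _ (by ring), hsq _ (by ring), mul_left_cancel₀ h4 ?_⟩
  -- The two cubics differ by `ℓ²`, so the product of `ℓ` over the `eᵢ` equals its product over `x`,
  -- `y`, `z`.
  linear_combination m ^ 3 * c3 - m ^ 2 * (m * x + η) * c2 - m * (m * x + η) ^ 2 * hz

end Halving

end WeierstrassCurve

/-! ### Halving `π - 1` and dividing `1 + π` by `2` -/

namespace WeierstrassCurve

section Splitting

open Polynomial Filter

variable {K : Type*} [Field K] {L : Type*} [Field L] [Algebra K L] {W : WeierstrassCurve K}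
  [IsAlgClosed L] [W.IsElliptic] (h2 : (2 : K) ≠ 0)
include h2

/-- The roots of `Ψ₂Sq` are the `x`-coordinates of the nonzero `2`-torsion points, so the cubic
splits over `K`. They are distinct because `Δ` is, up to a power of `2`, the discriminant of the
cubic. -/
theorem exists_isSplitBy (h : ∀ P : (W⁄L).toAffine.Point, P ≠ 0 → etaCoord P = 0 →
    xCoord P ∈ (algebraMap K L).range) : ∃ e₁ e₂ e₃ : K, W.IsSplitBy e₁ e₂ e₃ := by
  have h4 : (4 : K) ≠ 0 := by
    rw [show (4 : K) = 2 * 2 by norm_num]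
    exact mul_ne_zero h2 h2
  have hsplit : W.Ψ₂Sq.Splits := by
    refine Splits.of_splits_map (algebraMap K L) (IsAlgClosed.splits _) fun x hx ↦ ?_
    have hx' : aeval x W.Ψ₂Sq = 0 := by
      rw [← eval_map_algebraMap]
      exact isRoot_of_mem_roots hx
    rw [aeval_Ψ₂Sq] at hx'
    obtain ⟨P, hP, rfl, hη⟩ := exists_point_of_coords (V := W⁄L)
      (two_ne_zero_of_algebra (L := L) h2) (x := x) (e := 0) (by rw [hx', zero_pow two_ne_zero])
    exact h P hP hη
  have hcard := hsplit.natDegree_eq_card_roots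
  rw [W.natDegree_Ψ₂Sq h4] at hcard
  obtain ⟨e₁, e₂, e₃, he⟩ := Multiset.card_eq_three.mp hcard.symm
  have hprod := hsplit.eq_prod_roots
  rw [he, W.leadingCoeff_Ψ₂Sq h4] at hprod
  have hexp : W.Ψ₂Sq = C 4 * X ^ 3 + C (-4 * (e₁ + e₂ + e₃)) * X ^ 2 +
      C (4 * (e₁ * e₂ + e₁ * e₃ + e₂ * e₃)) * X + C (-4 * (e₁ * e₂ * e₃)) := by
    rw [hprod]
    simp only [Multiset.insert_eq_cons, Multiset.map_cons, Multiset.map_singleton,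
      Multiset.prod_cons, Multiset.prod_singleton, map_mul, map_add, map_neg]
    ring
  rw [Ψ₂Sq] at hexp
  obtain ⟨-, hb₂, hb₄, hb₆⟩ := (Cubic.mk.injEq ..).mp ((Cubic.toPoly_injective
    (P := ⟨4, W.b₂, 2 * W.b₄, W.b₆⟩) (Q := ⟨4, -4 * (e₁ + e₂ + e₃),
      4 * (e₁ * e₂ + e₁ * e₃ + e₂ * e₃), -4 * (e₁ * e₂ * e₃)⟩)).mp hexp)
  replace hb₄ : W.b₄ = 2 * (e₁ * e₂ + e₁ * e₃ + e₂ * e₃) :=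
    mul_left_cancel₀ h2 (by linear_combination hb₄)
  have hΔ : 4 * W.Δ = 64 * ((e₁ - e₂) * (e₁ - e₃) * (e₂ - e₃)) ^ 2 := by
    rw [Δ]
    have h8 : 4 * W.b₈ = _ := W.b_relation
    rw [hb₂, hb₄, hb₆] at h8 ⊢
    linear_combination (-16 * (e₁ + e₂ + e₃) ^ 2) * h8
  have hne : (e₁ - e₂) * (e₁ - e₃) * (e₂ - e₃) ≠ 0 := by
    intro h0
    rw [h0, zero_pow two_ne_zero, mul_zero] at hΔ
    exact mul_ne_zero h4 W.isUnit_Δ.ne_zero hΔ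
  simp only [mul_ne_zero_iff, sub_ne_zero] at hne
  exact ⟨e₁, e₂, e₃, hb₂, hb₄, hb₆, hne.1.1, hne.1.2, hne.2⟩

end Splitting

section HalfFrobenius

open Polynomial Filter

variable {p : ℕ} [Fact p.Prime] {L : Type*} [Field L] [Algebra (ZMod p) L] [DecidableEq L]
  {W : WeierstrassCurve (ZMod p)} [IsAlgClosed L] [W.IsElliptic] (h2 : (2 : ZMod p) ≠ 0)
include h2

/-- If the `2`-torsion is rational, then `π - 1` can be halved, as a rational map. -/
theorem exists_isRationalOver_two_nsmul_eq {e₁ e₂ e₃ : ZMod p} (hW : W.IsSplitBy e₁ e₂ e₃) :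
    ∃ β : (W⁄L).toAffine.Point → (W⁄L).toAffine.Point, IsRationalOver L W β ∧
      ∀ᶠ P in cofinite, 2 • β P = frobeniusEnd L W P - P := by
  have hp : p.Prime := Fact.out
  have h2' := two_ne_zero_of_algebra (L := L) h2
  obtain ⟨m, hm⟩ : Odd p := hp.odd_of_ne_two (by
    rintro rfl
    exact h2 rfl)
  have hmp : ∀ x : L, x ^ p = x ^ (2 * m + 1) := fun x ↦ congrArg (x ^ ·) hm
  have hchar : CharP L p := charP_of_injective_algebraMap (algebraMap (ZMod p) L).injective p
  set δ : (ZMod p)[X] := X ^ p - X with hδ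
  set F := W.Ψ₂Sq with hF
  -- With `D = π P - P` and `ℓ` the line through `-P` and `π P`, one has `ℓ(e)² = 4 (x(D) - e)(x -
  -- e)(x^p - e)`. As `(x - e)(x^p - e) = (x - e)^(p + 1) = q(e)²`, the root `w = ℓ(e) / (2 q(e))`
  -- of `x(D) - e` is rational in `P`. Moreover `ℓ(e) δ = η n(e)`, so `wᵢ M = η Nᵢ` with common
  -- denominator `M`.
  set q : ZMod p → (ZMod p)[X] := fun e ↦ (X - C e) ^ (m + 1) with hq
  set n : ZMod p → (ZMod p)[X] := fun e ↦ (F ^ m + 1) * (C e - X) - δ with hn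
  set N₁ := n e₁ * (q e₂ * q e₃) with hN₁
  set N₂ := n e₂ * (q e₁ * q e₃) with hN₂
  set N₃ := n e₃ * (q e₁ * q e₂) with hN₃
  set M := C 2 * δ * (q e₁ * q e₂ * q e₃) with hM
  have hδ0 : δ ≠ 0 := FiniteField.X_pow_card_sub_X_ne_zero _ hp.one_lt
  have hq0 : ∀ e, q e ≠ 0 := fun e ↦ pow_ne_zero _ (X_sub_C_ne_zero e)
  have hM0 : M ≠ 0 := mul_ne_zero (mul_ne_zero (C_ne_zero.mpr h2) hδ0)
    (mul_ne_zero (mul_ne_zero (hq0 _) (hq0 _)) (hq0 _))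
  set e₁' := algebraMap (ZMod p) L e₁ with he₁'
  set e₂' := algebraMap (ZMod p) L e₂ with he₂'
  set e₃' := algebraMap (ZMod p) L e₃ with he₃'
  have hW' : (W⁄L).IsSplitBy e₁' e₂' e₃' := hW.baseChange
  have hex : ∀ᶠ P in cofinite, ∃ R : (W⁄L).toAffine.Point, (R ≠ 0 ∧
      xCoord R * aeval (xCoord P) (M ^ 2) =
        aeval (xCoord P) (C e₁ * M ^ 2 + F * ((N₁ + N₂) * (N₁ + N₃))) ∧
      etaCoord R * aeval (xCoord P) (M ^ 3) =
        etaCoord P * aeval (xCoord P) (C 2 * F * ((N₁ + N₂) * (N₁ + N₃) * (N₂ + N₃)))) ∧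
      2 • R = frobeniusEnd L W P - P := by
    filter_upwards [eventually_ne_zero, eventually_aeval_ne_zero hδ0,
      eventually_aeval_ne_zero (hq0 e₁), eventually_aeval_ne_zero (hq0 e₂),
      eventually_aeval_ne_zero (hq0 e₃)] with P hP hδP hq₁ hq₂ hq₃
    have hηF := etaCoord_sq_eq_aeval hP
    have hπP := frobeniusEnd_eq_zero_iff.not.mpr hP
    have hsq := hW'.etaCoord_sq hP
    have hsq' := hW'.etaCoord_sq hπP
    rw [xCoord_frobeniusEnd hP, etaCoord_frobeniusEnd hP] at hsq'
    have hx : xCoord P ^ p ≠ xCoord P := by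
      simpa [hδ, sub_ne_zero] using hδP
    obtain ⟨hD, l, hl1, hl2, hl3, -⟩ := exists_slope_add hπP (neg_ne_zero.mpr hP) (by
      rw [neg_neg]
      intro h
      exact hx (by rw [← xCoord_frobeniusEnd hP, h]))
    rw [← sub_eq_add_neg] at hD hl1 hl2
    rw [xCoord_neg, xCoord_frobeniusEnd hP, hW'.b₂_eq] at hl1
    rw [xCoord_frobeniusEnd hP, etaCoord_frobeniusEnd hP] at hl2
    rw [xCoord_neg, etaCoord_neg, xCoord_frobeniusEnd hP, etaCoord_frobeniusEnd hP,
      sub_neg_eq_add] at hl3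
    set D := frobeniusEnd L W P - P with hDdef
    obtain ⟨k1, k2, k3, k4⟩ := line_identities h2' hsq hsq' hl3 hx
      (z := xCoord D) (by linear_combination hl1)
    rw [← hl2] at k4
    have hev : ∀ e : ZMod p, aeval (xCoord P) (q e) = (xCoord P - algebraMap (ZMod p) L e) ^ (m + 1) :=
      fun e ↦ by simp [hq]
    have hsub : ∀ e : ZMod p, xCoord P ^ p - algebraMap (ZMod p) L e =
        (xCoord P - algebraMap (ZMod p) L e) ^ (2 * m + 1) := by
      intro e
      rw [← hmp, sub_pow_char, ← map_pow, ZMod.pow_card]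
    have hw : ∀ e : ZMod p, aeval (xCoord P) (q e) ≠ 0 →
        (l * (algebraMap (ZMod p) L e - xCoord P) - etaCoord P) ^ 2 =
          4 * ((xCoord D - algebraMap (ZMod p) L e) * (xCoord P - algebraMap (ZMod p) L e) *
            (xCoord P ^ p - algebraMap (ZMod p) L e)) →
        ((l * (algebraMap (ZMod p) L e - xCoord P) - etaCoord P) /
          (2 * aeval (xCoord P) (q e))) ^ 2 = xCoord D - algebraMap (ZMod p) L e := by
      intro e hqe h
      rw [div_pow, h, div_eq_iff (pow_ne_zero _ (mul_ne_zero h2' hqe)), hsub, hev]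
      ring
    have hn' : ∀ e : ZMod p, (l * (algebraMap (ZMod p) L e - xCoord P) - etaCoord P) *
        aeval (xCoord P) δ = etaCoord P * aeval (xCoord P) (n e) := by
      intro e
      have hpow : etaCoord P ^ p = etaCoord P * aeval (xCoord P) F ^ m := by
        rw [hmp, pow_succ, pow_mul, hηF]
        ring
      simp only [hn, hδ, map_sub, map_mul, map_add, map_pow, map_one, aeval_X, aeval_C]
      rw [hpow] at hl3
      linear_combination (algebraMap (ZMod p) L e - xCoord P) * hl3
    have hwM : ∀ e : ZMod p, aeval (xCoord P) (q e) ≠ 0 → ∀ Y : L,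
        (l * (algebraMap (ZMod p) L e - xCoord P) - etaCoord P) / (2 * aeval (xCoord P) (q e)) *
          (2 * aeval (xCoord P) δ * (aeval (xCoord P) (q e) * Y)) =
        etaCoord P * (aeval (xCoord P) (n e) * Y) := by
      intro e hqe Y
      rw [← mul_assoc (etaCoord P), ← hn']
      field_simp
    have hw₁ := hw e₁ hq₁ k1
    have hw₂ := hw e₂ hq₂ k2
    have hw₃ := hw e₃ hq₃ k3
    have hM₁ := hwM e₁ hq₁ (aeval (xCoord P) (q e₂ * q e₃))
    have hM₂ := hwM e₂ hq₂ (aeval (xCoord P) (q e₁ * q e₃))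
    have hM₃ := hwM e₃ hq₃ (aeval (xCoord P) (q e₁ * q e₂))
    -- The sign condition for halving holds automatically: `4 q(e₁) q(e₂) q(e₃) = η^(p + 1)`, where
    -- `4^(m + 1) = 4` because `2^p = 2` in characteristic `p`.
    have hprod : 2 * ((l * (e₁' - xCoord P) - etaCoord P) / (2 * aeval (xCoord P) (q e₁)) *
        ((l * (e₂' - xCoord P) - etaCoord P) / (2 * aeval (xCoord P) (q e₂))) *
        ((l * (e₃' - xCoord P) - etaCoord P) / (2 * aeval (xCoord P) (q e₃)))) = etaCoord D := by
      have h4 : (4 : L) ^ (m + 1) = 4 := by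
        have h5 : (2 : L) ^ p = 2 := by
          have := congrArg (algebraMap (ZMod p) L) (ZMod.pow_card (2 : ZMod p))
          rwa [map_pow, map_ofNat] at this
        rw [show (4 : L) = 2 ^ 2 by norm_num, ← pow_mul, show 2 * (m + 1) = 2 * m + 1 + 1 by ring,
          pow_succ, ← hmp, h5]
        norm_num
      have h6 : 4 * (aeval (xCoord P) (q e₁) * aeval (xCoord P) (q e₂) * aeval (xCoord P) (q e₃)) =
          etaCoord P * etaCoord P ^ p := by
        rw [hev, hev, hev, ← mul_pow, ← mul_pow, ← h4, ← mul_pow, ← hsq, hmp]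
        ring
      rw [div_mul_div_comm, div_mul_div_comm, k4, mul_div_assoc', div_eq_iff (by positivity)]
      linear_combination (-2 * etaCoord D) * h6
    obtain ⟨R, hR, hRx, hRη, hRD⟩ := hW'.exists_two_nsmul_eq_of_sq h2' hD hw₁ hw₂ hw₃ hprod
    generalize (l * (e₁' - xCoord P) - etaCoord P) / (2 * aeval (xCoord P) (q e₁)) = w₁ at *
    generalize (l * (e₂' - xCoord P) - etaCoord P) / (2 * aeval (xCoord P) (q e₂)) = w₂ at *
    generalize (l * (e₃' - xCoord P) - etaCoord P) / (2 * aeval (xCoord P) (q e₃)) = w₃ at *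
    have hM₁' : w₁ * aeval (xCoord P) M = etaCoord P * aeval (xCoord P) N₁ := by
      rw [hN₁, map_mul _ (n e₁), ← hM₁, hM]
      simp only [map_mul, map_ofNat]
      ring
    have hM₂' : w₂ * aeval (xCoord P) M = etaCoord P * aeval (xCoord P) N₂ := by
      rw [hN₂, map_mul _ (n e₂), ← hM₂, hM]
      simp only [map_mul, map_ofNat]
      ring
    have hM₃' : w₃ * aeval (xCoord P) M = etaCoord P * aeval (xCoord P) N₃ := by
      rw [hN₃, map_mul _ (n e₃), ← hM₃, hM]
      simp only [map_mul, map_ofNat]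
      ring
    refine ⟨R, ⟨hR, ?_, ?_⟩, hRD⟩
    · simp only [map_add, map_mul, map_pow, aeval_C]
      rw [hRx, ← hηF]
      calc _ = e₁' * aeval (xCoord P) M ^ 2 +
            (w₁ * aeval (xCoord P) M + w₂ * aeval (xCoord P) M) *
              (w₁ * aeval (xCoord P) M + w₃ * aeval (xCoord P) M) := by
            linear_combination (-aeval (xCoord P) M ^ 2) * hw₁
        _ = _ := by
            rw [hM₁', hM₂', hM₃']
            ring
    · simp only [map_add, map_mul, map_pow, map_ofNat]
      rw [hRη, ← hηF]
      calc _ = 2 * ((w₁ * aeval (xCoord P) M + w₂ * aeval (xCoord P) M) *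
              (w₁ * aeval (xCoord P) M + w₃ * aeval (xCoord P) M) *
              (w₂ * aeval (xCoord P) M + w₃ * aeval (xCoord P) M)) := by ring
        _ = _ := by
            rw [hM₁', hM₂', hM₃']
            ring
  have := infinite_point (L := L) h2 W
  obtain ⟨β, hβ⟩ : ∃ β : (W⁄L).toAffine.Point → (W⁄L).toAffine.Point, ∀ᶠ P in cofinite,
      (β P ≠ 0 ∧ xCoord (β P) * aeval (xCoord P) (M ^ 2) =
        aeval (xCoord P) (C e₁ * M ^ 2 + F * ((N₁ + N₂) * (N₁ + N₃))) ∧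
      etaCoord (β P) * aeval (xCoord P) (M ^ 3) =
        etaCoord P * aeval (xCoord P) (C 2 * F * ((N₁ + N₂) * (N₁ + N₃) * (N₂ + N₃)))) ∧
      2 • β P = frobeniusEnd L W P - P := hex.choice
  exact ⟨β, isRationalOver_of_coords h2 (pow_ne_zero 2 hM0) (pow_ne_zero 3 hM0)
    (hβ.mono fun P h ↦ h.1), hβ.mono fun P h ↦ h.2⟩

/-- If the `2`-torsion is rational, then `1 + π` is divisible by `2`. -/
theorem exists_two_zsmul_eq_one_add_frobenius
    (h : ∀ P : (W⁄L).toAffine.Point, (2 : ℕ) • P = 0 →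
      ∃ Q : (W⁄(ZMod p)).toAffine.Point, Affine.Point.baseChange (ZMod p) L Q = P) :
    ∃ α : endRing L W, (2 : ℤ) • α = 1 + frobenius L W := by
  have h2' := two_ne_zero_of_algebra (L := L) h2
  have hinf := infinite_point (L := L) h2 W
  have hfix : ∀ P : (W⁄L).toAffine.Point, (2 : ℕ) • P = 0 → frobeniusEnd L W P = P :=
    fun P hP ↦ frobeniusEnd_eq_self_iff.mpr (h P hP)
  obtain ⟨e₁, e₂, e₃, hW⟩ := exists_isSplitBy (W := W) (L := L) h2 fun P hP hη ↦ by
    obtain ⟨Q, rfl⟩ := h P ((two_nsmul_eq_zero_iff h2').mpr hη)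
    rcases Q with _ | ⟨x, y, hxy⟩
    · exact absurd rfl hP
    · exact ⟨x, rfl⟩
  have hsurj := (hW.baseChange (L' := L)).two_nsmul_surjective h2'
  obtain ⟨β, hβ, hβ'⟩ := exists_isRationalOver_two_nsmul_eq (L := L) h2 hW
  set τ : AddMonoid.End (W⁄L).toAffine.Point := 1 + 1 with hτ
  have hτP : ∀ P, τ P = 2 • P := fun P ↦ (two_nsmul P).symm
  have hτmem : τ ∈ endRing L W := add_mem (one_mem _) (one_mem _)
  have hsurj' : Function.Surjective τ := fun P ↦ by
    obtain ⟨Q, hQ⟩ := hsurj P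
    exact ⟨Q, (hτP Q).trans hQ⟩
  have hτ0 : τ ≠ 0 := by
    intro h0
    obtain ⟨P, hP⟩ := (eventually_ne_zero (W := W) (L := L)).exists
    obtain ⟨Q, rfl⟩ := hsurj' P
    exact hP (by rw [h0]; rfl)
  have htend := tendsto_of_mem_endRing h2 hτmem hτ0
  set σ : AddMonoid.End (W⁄L).toAffine.Point := frobeniusEnd L W - 1 with hσ
  have hσP : ∀ P, σ P = frobeniusEnd L W P - P := fun P ↦ rfl
  have hσmem : σ ∈ endRing L W := sub_mem frobeniusEnd_mem_endRing (one_mem _)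
  have hker : ∀ P, τ P = 0 → σ P = 0 := fun P hP ↦ by
    rw [hσP, hfix P (by rw [← hτP, hP]), sub_self]
  -- The quotient `(π - 1) / 2` exists as a group homomorphism; it remains to show that it is
  -- rational, by comparison with `β`.
  let φ : AddMonoid.End (W⁄L).toAffine.Point := AddMonoidHom.liftOfSurjective τ hsurj' ⟨σ, hker⟩
  have hφ : ∀ P, φ (τ P) = σ P := AddMonoidHom.liftOfRightInverse_comp_apply _ _ _ ⟨σ, hker⟩
  have hfin : {P : (W⁄L).toAffine.Point | τ P = 0}.Finite := by
    have := htend.eventually eventually_ne_zero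
    simpa [Filter.eventually_cofinite] using this
  have hev : ∀ᶠ P in cofinite, β (τ P) - σ P ∈ {P : (W⁄L).toAffine.Point | τ P = 0} := by
    filter_upwards [htend.eventually hβ'] with P hP
    rw [map_sub, hτP (β _), hP, ← hσP, hτP, hτP, map_nsmul, sub_self]
  -- Generically `β (2P)` and `π P - P` differ by a `2`-torsion point. There are finitely many, so
  -- one `T` occurs infinitely often, and then, both sides being rational maps, at almost every
  -- point.
  obtain ⟨T, hT, hTinf⟩ : ∃ T, τ T = 0 ∧ {P | β (τ P) = σ P + T}.Infinite := by
    by_contra! hcon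
    have hevfin : {P | ¬ β (τ P) - σ P ∈ {P : (W⁄L).toAffine.Point | τ P = 0}}.Finite := hev
    refine Set.infinite_univ
      ((hevfin.union (hfin.biUnion fun T hT ↦ hcon T hT)).subset fun P _ ↦ ?_)
    by_cases hP : β (τ P) - σ P ∈ {P : (W⁄L).toAffine.Point | τ P = 0}
    · exact Or.inr (Set.mem_biUnion hP (add_sub_cancel _ _).symm)
    · exact Or.inl hP
  obtain ⟨Q, hQ⟩ := h (-T) (by rw [← hτP, map_neg, hT, neg_zero])
  have hTrat : IsRationalOver L W fun _ ↦ T := by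
    obtain ⟨Q, hQ⟩ := h T (by rw [← hτP, hT])
    exact hQ ▸ isRationalOver_const Q
  have heq : {P | β (τ P) ≠ σ P + T}.Finite :=
    finite_ne_of_infinite_eq' (hβ.comp (ψ := τ) hτmem htend)
      (IsRationalOver.add (φ := σ) hσmem hTrat) hTinf
  have hφmem : φ ∈ endRing L W := by
    -- So `φ = β - T` almost everywhere. The translation is defined over the base field because the
    -- `2`-torsion is rational.
    refine (hβ.add (hQ ▸ isRationalOver_const Q : IsRationalOver L W fun _ ↦ -T)).congr ?_
    refine (heq.image τ).subset fun R hR ↦ ?_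
    obtain ⟨P, rfl⟩ := hsurj' R
    refine ⟨P, fun hP ↦ hR ?_, rfl⟩
    change φ (τ P) = β (τ P) + -T
    rw [hφ, hP, add_neg_cancel_right]
  -- From `2φ = π - 1` follows `2 (φ + 1) = 1 + π`.
  refine ⟨⟨φ, hφmem⟩ + 1, Subtype.ext ?_⟩
  ext P : 1
  change (2 : ℤ) • (φ P + P) = P + frobeniusEnd L W P
  have h3 : (2 : ℤ) • φ P = frobeniusEnd L W P - P := by
    rw [← hσP, ← hφ, hτP, map_nsmul]
    exact natCast_zsmul _ 2
  rw [smul_add, h3, two_zsmul]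
  abel

end HalfFrobenius

end WeierstrassCurve

theorem lemma3p3 (p : ℕ) [Fact p.Prime] (hp : 5 < p)
    [DecidableEq (AlgebraicClosure (ZMod p))]
    (E : WeierstrassCurve (ZMod p)) [E.IsElliptic]
    (hE : E.IsSupersingular (AlgebraicClosure (ZMod p)) p) :
    Nonempty (E.endRing (AlgebraicClosure (ZMod p)) ≃+* intAdjoinHalf p) ↔
      ∀ P : (E⁄(AlgebraicClosure (ZMod p))).toAffine.Point, (2 : ℕ) • P = 0 →
        ∃ Q : (E⁄(ZMod p)).toAffine.Point,
          WeierstrassCurve.Affine.Point.baseChange (ZMod p) (AlgebraicClosure (ZMod p)) Q = P := by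
  have h2 : (2 : ZMod p) ≠ 0 := by
    intro h
    have h' : ((2 : ℕ) : ZMod p) = 0 := by exact_mod_cast h
    have := Nat.le_of_dvd two_pos ((ZMod.natCast_eq_zero_iff 2 p).mp h')
    lia
  refine ⟨fun ⟨e⟩ P hP ↦ frobeniusEnd_eq_self_iff.mp
    (frobeniusEnd_eq_self_of_ringEquiv h2 hp.le hE e hP), fun h ↦ ?_⟩
  obtain ⟨α, hα⟩ := exists_two_zsmul_eq_one_add_frobenius h2 h
  exact (isDegreeForm_xDegree h2).nonempty_ringEquiv_intAdjoinHalf Fact.out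
    (frobenius_mul_self h2 hp.le hE) hα (commute_frobenius h2)
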